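/- Let $k_1,k_2\ge 0$ be integers with $k_1+k_2\ge 1$. For real $C,\tilde C$ put $$D_{C,\tilde C}(s)=\tilde C(\cos s)^{2k_1+2}(\sin s)^{2k_2+2}-1-(C^2-1)\cos^2 s,\qquad \Omega_{C,\tilde C}=\{s\in(0,\tfrac{\pi}{2}) : D_{C,\tilde C}(s)>0\},$$ $$J_1^C(\tilde C)=\int_{\Omega_{C,\tilde C}}\frac{\tan s}{\sqrt{D_{C,\tilde C}(s)}}\,ds,\qquad J_2^C(\tilde C)=\int_{\Omega_{C,\tilde C}}\frac{\cot s}{\sqrt{D_{C,\tilde C}(s)}}\,ds .$$ For $C\ne 0$ and $\Omega_{C,\tilde C}\neq\emptyset$ both integrals converge, and: (1) The set of pairs $(C,\tilde C)$ with $C>0$, $\Omega_{C,\tilde C}\ne\emptyset$ and both $J_1^C(\tilde C)\in\pi\mathbb Q$ and $C\,J_2^C(\tilde C)\in\pi\mathbb Q$ has at least the cardinality of $\mathbb Q\times\mathbb Q$. (2) Let $M_1,M_2$ be closed smooth manifolds of dimensions $k_1,k_2$ and let $f_j:M_j\to \mathbb S^{2m_j+1}\subset\mathbb C^{m_j+1}$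 $(j=1,2)$ be minimal immersions that are $\mathscr C$-totally real, i.e. the vector field $i f_j$ is normal along $f_j$. Let $(C,\tilde C)$ be any pair with $C\neq0$, $\Omega_{C,\tilde C}\ne\emptyset$, $J_1^C(\tilde C)\in\pi\mathbb Q$ and $C\,J_2^C(\tilde C)\in\pi\mathbb Q$. Then there is a smooth immersed curve $\gamma=(\gamma_1,\gamma_2)=(\cos\theta\, e^{is_1},\sin\theta\, e^{is_2}):\mathbb R\to\mathbb S^3\subset\mathbb C^2$ with parameters $(C,\tilde C)$ such that $$G_\gamma:\mathbb R\times M_1\times M_2\to\mathbb S^{2m_1+2m_2+3},\qquad G_\gamma(t,x,y)=(\gamma_1(t)f_1(x),\gamma_2(t)f_2(y)),$$ is a doubly spiral minimal product of varying magnitudes (that is, $G_\gamma$ is a minimal immersion, neither $\gamma_1$ nor $\gamma_2$ has constant argument, and $|\gamma_1|,|\gamma_2|$ are not both constant), and $G_\gamma=F\circ q$ for a smooth surjection $q$ onto a closed manifold $N$ of dimension $k_1+k_2+1$ and a minimal immersion $F:N\to\mathbb S^{2m_1+2m_2+3}$. Here $\gamma$ has parameters $(C,\tilde C)$ if $\theta,s_1,s_2$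 are smooth real functions and there are $\alpha<\beta$ such that on $(\alpha,\beta)$ one has $\theta'>0$, $\theta((\alpha,\beta))=\Omega_{C,\tilde C}$, $s_1'=\dfrac{\tan\theta}{\sqrt{D_{C,\tilde C}(\theta)}}\,\theta'$ and $s_2'=\dfrac{C\cot\theta}{\sqrt{D_{C,\tilde C}(\theta)}}\,\theta'$, and, for $e\in\{\alpha,\beta\}$ and all $t\in\mathbb R$, $\theta(2e-t)=\theta(t)$ and $s_l(2e-t)=2s_l(e)-s_l(t)$ for $l=1,2$. -/

import Mathlib

open scoped Manifold ContDiff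
open MeasureTheory

universe u v

namespace SpiralProduct

noncomputable section

/-! ### Minimal immersions into unit spheres -/

section Minimal

variable {E : Type*} [NormedAddCommGroup E] [NormedSpace ℝ E] [FiniteDimensional ℝ E]
  {H : Type*} [TopologicalSpace H] (I : ModelWithCorners ℝ E H)
  {M : Type*} [TopologicalSpace M] [ChartedSpace H M]
  {V : Type*} [NormedAddCommGroup V] [InnerProductSpace ℝ V]

/-- `f` is a smooth immersion of `M` into the unit sphere of `V`. -/
def IsSphericalImmersion (f : M → V) : Prop :=
  ContMDiff I 𝓘(ℝ, V) ∞ f ∧ (∀ x, Function.Injective (mfderiv I 𝓘(ℝ, V) f x)) ∧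
    ∀ x, ‖f x‖ = 1

/-- The map `f` read in the preferred chart around `x`. -/
def localRep (f : M → V) (x : M) : E → V := f ∘ (extChartAt I x).symm

/-- The `i`-th coordinate vector field at `x`, mapped to `V` by the differential of `f`. -/
def coordTangent (f : M → V) (x : M) (i : Fin (Module.finrank ℝ E)) : V :=
  fderiv ℝ (localRep I f x) (extChartAt I x x) (Module.finBasis ℝ E i)

/-- The matrix `g_ij` of the metric induced by `f` at `x`. -/
def inducedMetric (f : M → V) (x : M) :
    Matrix (Fin (Module.finrank ℝ E)) (Fin (Module.finrank ℝ E)) ℝ :=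
  Matrix.of fun i j => inner ℝ (coordTangent I f x i) (coordTangent I f x j)

/-- The second coordinate derivatives `∂_i ∂_j f` at `x`. -/
def coordHessian (f : M → V) (x : M) (i j : Fin (Module.finrank ℝ E)) : V :=
  fderiv ℝ (fderiv ℝ (localRep I f x)) (extChartAt I x x)
    (Module.finBasis ℝ E i) (Module.finBasis ℝ E j)

/-- The span of the position vector `f x` and of the tangent space of `f` at `x`. Its orthogonal
complement is the normal space at `x` of `f` as a map into the unit sphere. -/
def radialTangentSpan (f : M → V) (x : M) : Submodule ℝ V :=
  Submodule.span ℝ (insert (f x) (Set.range (coordTangent I f x)))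

instance (f : M → V) (x : M) : FiniteDimensional ℝ (radialTangentSpan I f x) :=
  FiniteDimensional.span_of_finite ℝ ((Set.finite_range _).insert _)

/-- The second fundamental form of `f`, as a map into the unit sphere: the component of `∂_i ∂_j f`
in the normal space of `f` in the sphere. -/
def secondFundamentalForm (f : M → V) (x : M) (i j : Fin (Module.finrank ℝ E)) : V :=
  (radialTangentSpan I f x)ᗮ.starProjection (coordHessian I f x i j)

/-- The (unnormalized) mean curvature vector `∑ g^{ij} B_{ij}` of `f`, as a map into the sphere. -/
def meanCurvature (f : M → V) (x : M) : V :=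
  ∑ i, ∑ j, (inducedMetric I f x)⁻¹ i j • secondFundamentalForm I f x i j

/-- `f` is a minimal immersion of `M` into the unit sphere of `V`. -/
def IsSphericalMinimalImmersion (f : M → V) : Prop :=
  IsSphericalImmersion I f ∧ ∀ x, meanCurvature I f x = 0

end Minimal

/-- `f` is `𝒞`-totally real: the vector field `i · f` is normal along `f`. -/
def IsCTotallyReal {E : Type*} [NormedAddCommGroup E] [NormedSpace ℝ E]
    {H : Type*} [TopologicalSpace H] (I : ModelWithCorners ℝ E H)
    {M : Type*} [TopologicalSpace M] [ChartedSpace H M]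
    {V : Type*} [NormedAddCommGroup V] [InnerProductSpace ℂ V] (f : M → V) : Prop :=
  ∀ (x : M) (w : TangentSpace I x),
    (inner ℂ (Complex.I • f x) (mfderiv I 𝓘(ℝ, V) f x w : V)).re = 0

/-! ### `γ`-products -/

/-- `γ` is a smooth immersed curve in the unit sphere of `ℂ²`. -/
def IsImmersedCurve (γ : ℝ → ℂ × ℂ) : Prop :=
  ContDiff ℝ ∞ γ ∧ (∀ t, deriv γ t ≠ 0) ∧ ∀ t, ‖(γ t).1‖ ^ 2 + ‖(γ t).2‖ ^ 2 = 1

/-- The `γ`-product `(t, x, y) ↦ (γ₁(t) f₁(x), γ₂(t) f₂(y))`, into the orthogonal sum `V₁ ⊕ V₂`. -/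
def gammaProduct {M₁ M₂ V₁ V₂ : Type*} [NormedAddCommGroup V₁] [InnerProductSpace ℂ V₁]
    [NormedAddCommGroup V₂] [InnerProductSpace ℂ V₂]
    (γ : ℝ → ℂ × ℂ) (f₁ : M₁ → V₁) (f₂ : M₂ → V₂) (p : ℝ × M₁ × M₂) : WithLp 2 (V₁ × V₂) :=
  WithLp.toLp 2 ((γ p.1).1 • f₁ p.2.1, (γ p.1).2 • f₂ p.2.2)

/-- Both moduli of `γ` are constant. -/
def HasSteadyMagnitudes (γ : ℝ → ℂ × ℂ) : Prop :=
  (∀ t t', ‖(γ t).1‖ = ‖(γ t').1‖) ∧ ∀ t t', ‖(γ t).2‖ = ‖(γ t').2‖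

/-- The argument of the complex-valued function `z` is constant. -/
def HasConstantArgument (z : ℝ → ℂ) : Prop :=
  ∃ φ : ℝ, ∀ t, z t = ‖z t‖ * Complex.exp (φ * Complex.I)

/-- Neither component of `γ` has constant argument. -/
def IsDoublySpiral (γ : ℝ → ℂ × ℂ) : Prop :=
  ¬ HasConstantArgument (fun t => (γ t).1) ∧ ¬ HasConstantArgument (fun t => (γ t).2)

/-! ### The pendulum, the integrals and the solution curves -/

/-- `C̃ (cos s)^(2k₁+2) (sin s)^(2k₂+2) - 1 - (C² - 1) cos² s`. -/
def radicand (k₁ k₂ : ℕ) (C C' s : ℝ) : ℝ :=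
  C' * Real.cos s ^ (2 * k₁ + 2) * Real.sin s ^ (2 * k₂ + 2) - 1 - (C ^ 2 - 1) * Real.cos s ^ 2

/-- The basic domain `Ω_{C, C̃}` of the pendulum. -/
def basicDomain (k₁ k₂ : ℕ) (C C' : ℝ) : Set ℝ :=
  {s | s ∈ Set.Ioo 0 (Real.pi / 2) ∧ 0 < radicand k₁ k₂ C C' s}

/-- The integrand of `J₁`. -/
def integrand₁ (k₁ k₂ : ℕ) (C C' s : ℝ) : ℝ := Real.tan s / √(radicand k₁ k₂ C C' s)

/-- The integrand of `J₂`. -/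
def integrand₂ (k₁ k₂ : ℕ) (C C' s : ℝ) : ℝ := Real.cot s / √(radicand k₁ k₂ C C' s)

/-- `J₁^C(C̃)`. -/
def J₁ (k₁ k₂ : ℕ) (C C' : ℝ) : ℝ := ∫ s in basicDomain k₁ k₂ C C', integrand₁ k₁ k₂ C C' s

/-- `J₂^C(C̃)`. -/
def J₂ (k₁ k₂ : ℕ) (C C' : ℝ) : ℝ := ∫ s in basicDomain k₁ k₂ C C', integrand₂ k₁ k₂ C C' s

/-- The set `π ℚ`. -/
def piRat : Set ℝ := {r | ∃ q : ℚ, r = Real.pi * q}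

/-- `C̃` is allowed for `C`, and both `J₁^C(C̃)` and `C · J₂^C(C̃)` lie in `π ℚ`. -/
def IsClosingPair (k₁ k₂ : ℕ) (C C' : ℝ) : Prop :=
  (basicDomain k₁ k₂ C C').Nonempty ∧ J₁ k₁ k₂ C C' ∈ piRat ∧ C * J₂ k₁ k₂ C C' ∈ piRat

/-- `γ = (cos θ e^{i s₁}, sin θ e^{i s₂})` is a global solution curve with parameters `(C, C̃)`:
on some interval `(α, β)` the angle `θ` runs increasingly through `Ω_{C, C̃}`, with
`ds₁/dθ = tan θ / √(...)` and `ds₂/dθ = C cot θ / √(...)`; and `γ` is obtained from this segment by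
repeated rotational reflections at its two end points. -/
def IsSolutionCurve (k₁ k₂ : ℕ) (C C' : ℝ) (γ : ℝ → ℂ × ℂ) : Prop :=
  ∃ θ s₁ s₂ : ℝ → ℝ, ContDiff ℝ ∞ θ ∧ ContDiff ℝ ∞ s₁ ∧ ContDiff ℝ ∞ s₂ ∧
    (∀ t, γ t = (Real.cos (θ t) * Complex.exp (s₁ t * Complex.I),
      Real.sin (θ t) * Complex.exp (s₂ t * Complex.I))) ∧
    ∃ α β : ℝ, α < β ∧ θ '' Set.Ioo α β = basicDomain k₁ k₂ C C' ∧
      (∀ t ∈ Set.Ioo α β, 0 < deriv θ t ∧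
        deriv s₁ t = integrand₁ k₁ k₂ C C' (θ t) * deriv θ t ∧
        deriv s₂ t = C * integrand₂ k₁ k₂ C C' (θ t) * deriv θ t) ∧
      ∀ e ∈ ({α, β} : Set ℝ), ∀ t, θ (2 * e - t) = θ t ∧
        s₁ (2 * e - t) = 2 * s₁ e - s₁ t ∧ s₂ (2 * e - t) = 2 * s₂ e - s₂ t

/-- The map `G` factors through a minimal immersion of a closed smooth manifold `N` of dimension `n`
into the unit sphere: `G = F ∘ q`, with `q` smooth and onto. -/
def FactorsThroughClosedMinimal {E : Type*} [NormedAddCommGroup E] [NormedSpace ℝ E]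
    {H : Type*} [TopologicalSpace H] (I : ModelWithCorners ℝ E H)
    {P : Type u} [TopologicalSpace P] [ChartedSpace H P]
    {V : Type*} [NormedAddCommGroup V] [InnerProductSpace ℝ V] (n : ℕ) (G : P → V) : Prop :=
  ∃ (E' : Type) (_ : NormedAddCommGroup E') (_ : NormedSpace ℝ E') (_ : FiniteDimensional ℝ E')
    (N : Type u) (_ : TopologicalSpace N) (_ : ChartedSpace E' N),
    Module.finrank ℝ E' = n ∧ IsManifold 𝓘(ℝ, E') ∞ N ∧ CompactSpace N ∧ T2Space N ∧
    ∃ (F : N → V) (q : P → N), IsSphericalMinimalImmersion 𝓘(ℝ, E') F ∧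
      ContMDiff I 𝓘(ℝ, E') ∞ q ∧ Function.Surjective q ∧ ∀ p, G p = F (q p)

end

end SpiralProduct

namespace SpiralProduct

noncomputable section

/-! ### The Poincaré–Miranda theorem in the plane -/

/-- An angle that stays in an open half plane and ends on the positive side of its initial
direction increases. -/
lemma angle_lt_of_cos_pos {B : ℝ → ℝ} (hB : Continuous B) {a b φ : ℝ} (hab : a ≤ b)
    (hcos : ∀ s ∈ Set.Icc a b, 0 < Real.cos (B s - φ)) (hsin : 0 < Real.sin (B b - B a)) :
    B a < B b := by
  by_contra! h
  have h1 : B b + Real.pi ≤ B a := by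
    by_contra! h2
    have : Real.sin (B b - B a) ≤ 0 :=
      Real.sin_nonpos_of_nonpos_of_neg_pi_le (by linarith) (by linarith)
    linarith
  obtain ⟨s, hs, hs'⟩ := intermediate_value_Icc' hab hB.continuousOn
    (show B b + Real.pi ∈ Set.Icc (B b) (B a) from ⟨by linarith [Real.pi_pos], h1⟩)
  have h3 := hcos s hs
  rw [hs', show B b + Real.pi - φ = (B b - φ) + Real.pi by ring, Real.cos_add_pi] at h3
  linarith [hcos b ⟨hab, le_rfl⟩]

/-- **Poincaré–Miranda theorem** for a rectangle in the plane. -/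
theorem exists_zero_of_rectangle {a b c d : ℝ} (hab : a ≤ b) (hcd : c ≤ d) {f g : ℝ → ℝ → ℝ}
    (hf : ContinuousOn (Function.uncurry f) (Set.Icc a b ×ˢ Set.Icc c d))
    (hg : ContinuousOn (Function.uncurry g) (Set.Icc a b ×ˢ Set.Icc c d))
    (hleft : ∀ y ∈ Set.Icc c d, f a y < 0) (hright : ∀ y ∈ Set.Icc c d, 0 < f b y)
    (hbot : ∀ x ∈ Set.Icc a b, g x c < 0) (htop : ∀ x ∈ Set.Icc a b, 0 < g x d) :
    ∃ x ∈ Set.Icc a b, ∃ y ∈ Set.Icc c d, f x y = 0 ∧ g x y = 0 := by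
  by_contra! hne
  let P : ℝ × ℝ → ℝ × ℝ := fun z => (Set.projIcc a b hab z.1, Set.projIcc c d hcd z.2)
  have hP : Continuous P := by
    refine Continuous.prodMk ?_ ?_
    · exact continuous_subtype_val.comp (continuous_projIcc.comp continuous_fst)
    · exact continuous_subtype_val.comp (continuous_projIcc.comp continuous_snd)
  have hPm : ∀ z, P z ∈ Set.Icc a b ×ˢ Set.Icc c d := fun z =>
    ⟨(Set.projIcc a b hab z.1).2, (Set.projIcc c d hcd z.2).2⟩
  have hPe : ∀ x ∈ Set.Icc a b, ∀ y ∈ Set.Icc c d, P (x, y) = (x, y) := fun x hx y hy => by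
    simp [P, Set.projIcc_of_mem hab hx, Set.projIcc_of_mem hcd hy]
  let F : ℝ × ℝ → ℝ := fun z => Function.uncurry f (P z)
  let G : ℝ × ℝ → ℝ := fun z => Function.uncurry g (P z)
  have hF : Continuous F := hf.comp_continuous hP hPm
  have hG : Continuous G := hg.comp_continuous hP hPm
  have hFe : ∀ x ∈ Set.Icc a b, ∀ y ∈ Set.Icc c d, F (x, y) = f x y := fun x hx y hy => by
    simp [F, hPe x hx y hy]
  have hGe : ∀ x ∈ Set.Icc a b, ∀ y ∈ Set.Icc c d, G (x, y) = g x y := fun x hx y hy => by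
    simp [G, hPe x hx y hy]
  let h : C(ℝ × ℝ, ℂ) := ⟨fun z => (F z : ℂ) + G z * Complex.I, by fun_prop⟩
  have h_ne : ∀ z, h z ≠ 0 := by
    intro z hz
    have h1 := congrArg Complex.re hz
    have h2 := congrArg Complex.im hz
    simp [h] at h1 h2
    exact hne _ (hPm z).1 _ (hPm z).2 h1 h2
  obtain ⟨L, ⟨-, hL⟩, -⟩ := Complex.isCoveringMapOn_exp.existsUnique_continuousMap_lifts h
    (a₀ := (0, 0)) (Complex.exp_log (h_ne _)) h_ne
  let A : ℝ × ℝ → ℝ := fun z => (L z).im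
  have hA : Continuous A := Complex.continuous_im.comp L.continuous
  have hexp : ∀ z, F z = Real.exp (L z).re * Real.cos (A z) ∧
      G z = Real.exp (L z).re * Real.sin (A z) := by
    intro z
    have h0 := congrFun hL z
    have h1 := congrArg Complex.re h0
    have h2 := congrArg Complex.im h0
    simp [h, Complex.exp_re, Complex.exp_im] at h1 h2
    exact ⟨h1.symm, h2.symm⟩
  have cpos : ∀ z, 0 < F z → 0 < Real.cos (A z) := fun z hz => by
    rw [(hexp z).1] at hz; exact (pos_iff_pos_of_mul_pos hz).1 (Real.exp_pos _)
  have spos : ∀ z, 0 < G z → 0 < Real.sin (A z) := fun z hz => by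
    rw [(hexp z).2] at hz; exact (pos_iff_pos_of_mul_pos hz).1 (Real.exp_pos _)
  have cneg : ∀ z, F z < 0 → Real.cos (A z) < 0 := fun z hz => by
    rw [(hexp z).1] at hz; exact (pos_iff_neg_of_mul_neg hz).1 (Real.exp_pos _)
  have sneg : ∀ z, G z < 0 → Real.sin (A z) < 0 := fun z hz => by
    rw [(hexp z).2] at hz; exact (pos_iff_neg_of_mul_neg hz).1 (Real.exp_pos _)
  have ha : a ∈ Set.Icc a b := ⟨le_rfl, hab⟩
  have hb : b ∈ Set.Icc a b := ⟨hab, le_rfl⟩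
  have hc : c ∈ Set.Icc c d := ⟨le_rfl, hcd⟩
  have hd : d ∈ Set.Icc c d := ⟨hcd, le_rfl⟩
  have right : ∀ y ∈ Set.Icc c d, 0 < Real.cos (A (b, y)) := fun y hy =>
    cpos _ (by rw [hFe b hb y hy]; exact hright y hy)
  have left : ∀ y ∈ Set.Icc c d, Real.cos (A (a, y)) < 0 := fun y hy =>
    cneg _ (by rw [hFe a ha y hy]; exact hleft y hy)
  have top : ∀ x ∈ Set.Icc a b, 0 < Real.sin (A (x, d)) := fun x hx =>
    spos _ (by rw [hGe x hx d hd]; exact htop x hx)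
  have bot : ∀ x ∈ Set.Icc a b, Real.sin (A (x, c)) < 0 := fun x hx =>
    sneg _ (by rw [hGe x hx c hc]; exact hbot x hx)
  have e1 : A (b, c) < A (b, d) := by
    refine angle_lt_of_cos_pos (B := fun y => A (b, y)) (φ := 0) (by fun_prop) hcd
      (fun y hy => by simpa using right y hy) ?_
    simp only [Real.sin_sub]
    nlinarith [mul_pos (right c hc) (top b hb), mul_pos (right d hd) (neg_pos.2 (bot b hb))]
  have e2 : A (b, d) < A (a, d) := by
    have := angle_lt_of_cos_pos (B := fun x => A (-x, d)) (φ := Real.pi / 2) (by fun_prop)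
      (neg_le_neg hab) (fun x hx => by
        simp only [Real.cos_sub_pi_div_two]
        exact top _ ⟨by linarith [hx.2], by linarith [hx.1]⟩) (by
        simp only [Real.sin_sub, neg_neg]
        nlinarith [mul_pos (right d hd) (top a ha), mul_pos (neg_pos.2 (left d hd)) (top b hb)])
    simpa using this
  have e3 : A (a, d) < A (a, c) := by
    have := angle_lt_of_cos_pos (B := fun y => A (a, -y)) (φ := Real.pi) (by fun_prop)
      (neg_le_neg hcd) (fun y hy => by
        simp only [Real.cos_sub_pi]
        exact neg_pos.2 (left _ ⟨by linarith [hy.2], by linarith [hy.1]⟩)) (by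
        simp only [Real.sin_sub, neg_neg]
        nlinarith [mul_pos (neg_pos.2 (left c hc)) (top a ha),
          mul_pos (neg_pos.2 (left d hd)) (neg_pos.2 (bot a ha))])
    simpa using this
  have e4 : A (a, c) < A (b, c) := by
    refine angle_lt_of_cos_pos (B := fun x => A (x, c)) (φ := -(Real.pi / 2)) (by fun_prop) hab
      (fun x hx => by
        simp only [sub_neg_eq_add, Real.cos_add_pi_div_two]
        exact neg_pos.2 (bot x hx)) ?_
    simp only [Real.sin_sub]
    nlinarith [mul_pos (right c hc) (neg_pos.2 (bot a ha)),
      mul_pos (neg_pos.2 (left c hc)) (neg_pos.2 (bot b hb))]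
  linarith

/-! ### Divided differences -/

/-- `P` has smooth first and second divided differences, with values `P₁` and `P₂ / 2` on the
diagonal. -/
def HasDividedDifferences (P P₁ P₂ : ℝ → ℝ) : Prop :=
  ContDiff ℝ ∞ P ∧ ∃ (S : ℝ × ℝ → ℝ) (R : ℝ × ℝ × ℝ → ℝ), ContDiff ℝ ∞ S ∧ ContDiff ℝ ∞ R ∧
    (∀ x y, P y - P x = (y - x) * S (x, y)) ∧
    (∀ x y z, S (x, z) - S (x, y) = (z - y) * R (x, y, z)) ∧
    (∀ x, S (x, x) = P₁ x) ∧ ∀ x, 2 * R (x, x, x) = P₂ x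

lemma HasDividedDifferences.mul {P P₁ P₂ Q Q₁ Q₂ : ℝ → ℝ} (hP : HasDividedDifferences P P₁ P₂)
    (hQ : HasDividedDifferences Q Q₁ Q₂) :
    HasDividedDifferences (fun x => P x * Q x) (fun x => P₁ x * Q x + P x * Q₁ x)
      (fun x => P₂ x * Q x + 2 * (P₁ x * Q₁ x) + P x * Q₂ x) := by
  obtain ⟨cP, S, R, cS, cR, h1, h2, h3, h4⟩ := hP
  obtain ⟨cQ, S', R', cS', cR', h1', h2', h3', h4'⟩ := hQ
  refine ⟨cP.mul cQ, fun z => S z * Q z.2 + P z.1 * S' z,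
    fun z => R z * Q z.2.2 + S (z.1, z.2.1) * S' (z.2.1, z.2.2) + P z.1 * R' z, by fun_prop,
    by fun_prop, ?_, ?_, ?_, ?_⟩
  · intro x y; linear_combination Q y * h1 x y + P x * h1' x y
  · intro x y z
    linear_combination Q z * h2 x y z + S (x, y) * h1' y z + P x * h2' x y z
  · intro x; simp [h3, h3']
  · intro x
    simp only [h3, h3', ← h4, ← h4']; ring

lemma hasDividedDifferences_affine (α β : ℝ) :
    HasDividedDifferences (fun u => α + β * u) (fun _ => β) (fun _ => 0) := by
  refine ⟨by fun_prop, fun _ => β, fun _ => 0, contDiff_const, contDiff_const, ?_, ?_, ?_, ?_⟩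
  · intro x y; ring
  · intro x y z; ring
  · simp
  · simp

lemma hasDividedDifferences_affine_pow (α β : ℝ) (n : ℕ) :
    HasDividedDifferences (fun u => (α + β * u) ^ (n + 1))
      (fun u => (n + 1) * β * (α + β * u) ^ n)
      (fun u => (n + 1) * n * β ^ 2 * (α + β * u) ^ (n - 1)) := by
  induction n with
  | zero => simpa using hasDividedDifferences_affine α β
  | succ n ih =>
    have h := ih.mul (hasDividedDifferences_affine α β)
    convert h using 2 with u
    · ring
    · push_cast; ring
    · rcases n with _ | n
      · simp; ring
      · simp only [Nat.add_sub_cancel]; push_cast; ring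

/-! ### The pendulum in the variable `u = sin² s` -/

/-- `(1 - u)^(k₁+1) u^(k₂+1)`. -/
def weight (k₁ k₂ : ℕ) (u : ℝ) : ℝ := (1 - u) ^ (k₁ + 1) * u ^ (k₂ + 1)

/-- The radicand as a polynomial in `u = sin² s`, with `c = C²`. -/
def polyRadicand (k₁ k₂ : ℕ) (c T u : ℝ) : ℝ := T * weight k₁ k₂ u - u - c * (1 - u)

lemma continuous_polyRadicand (k₁ k₂ : ℕ) :
    Continuous fun z : ℝ × ℝ × ℝ => polyRadicand k₁ k₂ z.1 z.2.1 z.2.2 := by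
  unfold polyRadicand weight; fun_prop

lemma weight_pos {k₁ k₂ : ℕ} {u : ℝ} (hu : u ∈ Set.Ioo (0 : ℝ) 1) : 0 < weight k₁ k₂ u :=
  mul_pos (pow_pos (sub_pos.2 hu.2) _) (pow_pos hu.1 _)

lemma radicand_eq_polyRadicand (k₁ k₂ : ℕ) (C T s : ℝ) :
    radicand k₁ k₂ C T s = polyRadicand k₁ k₂ (C ^ 2) T (Real.sin s ^ 2) := by
  unfold radicand polyRadicand weight
  rw [← Real.cos_sq', ← pow_mul, ← pow_mul]
  rw [show 2 * (k₁ + 1) = 2 * k₁ + 2 by ring, show 2 * (k₂ + 1) = 2 * k₂ + 2 by ring]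
  linear_combination Real.sin_sq_add_cos_sq s

lemma exists_weight_dividedDifference (k₁ k₂ : ℕ) : ∃ q : ℝ × ℝ × ℝ → ℝ, ContDiff ℝ ∞ q ∧
    (∀ c T x y z, x ≠ y → polyRadicand k₁ k₂ c T x = 0 → polyRadicand k₁ k₂ c T y = 0 →
      polyRadicand k₁ k₂ c T z = (z - x) * (y - z) * (T * q (x, y, z))) ∧
    ∀ x, 2 * q (x, x, x) = - ((k₁ + 1) * k₁ * (1 - x) ^ (k₁ - 1) * x ^ (k₂ + 1)
      - 2 * ((k₁ + 1) * (1 - x) ^ k₁ * ((k₂ + 1) * x ^ k₂))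
      + (1 - x) ^ (k₁ + 1) * ((k₂ + 1) * k₂ * x ^ (k₂ - 1))) := by
  obtain ⟨-, S, R, -, hR, h1, h2, -, h4⟩ := (hasDividedDifferences_affine_pow 1 (-1) k₁).mul
    (hasDividedDifferences_affine_pow 0 1 k₂)
  refine ⟨fun z => - R z, hR.neg, ?_, ?_⟩
  · intro c T x y z hxy hx hy
    have hw : ∀ u, weight k₁ k₂ u = (1 + -1 * u) ^ (k₁ + 1) * (0 + 1 * u) ^ (k₂ + 1) := by
      intro u; unfold weight; ring
    unfold polyRadicand at *
    rw [hw] at *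
    have e1 := h1 x y
    have e2 := h1 x z
    have e3 := h2 x y z
    have e4 : T * S (x, y) - 1 + c = 0 := by
      have : (y - x) * (T * S (x, y) - 1 + c) = 0 := by
        linear_combination hy - hx - T * e1
      exact (mul_eq_zero.1 this).resolve_left (sub_ne_zero.2 hxy.symm)
    linear_combination hx + T * e2 + T * (z - x) * e3 + (z - x) * e4
  · intro x
    have := h4 x
    simp only [neg_mul, one_mul, zero_add, mul_neg, ← sub_eq_add_neg] at this
    linear_combination -this

/-- The negative of the second divided difference of `weight`. -/
def kernel (k₁ k₂ : ℕ) : ℝ × ℝ × ℝ → ℝ := (exists_weight_dividedDifference k₁ k₂).choose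

lemma contDiff_kernel (k₁ k₂ : ℕ) : ContDiff ℝ ∞ (kernel k₁ k₂) :=
  (exists_weight_dividedDifference k₁ k₂).choose_spec.1

lemma polyRadicand_eq_mul_kernel {k₁ k₂ : ℕ} {c T x y : ℝ} (hxy : x ≠ y)
    (hx : polyRadicand k₁ k₂ c T x = 0) (hy : polyRadicand k₁ k₂ c T y = 0) (z : ℝ) :
    polyRadicand k₁ k₂ c T z = (z - x) * (y - z) * (T * kernel k₁ k₂ (x, y, z)) :=
  (exists_weight_dividedDifference k₁ k₂).choose_spec.2.1 c T x y z hxy hx hy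

lemma two_mul_kernel_diagonal (k₁ k₂ : ℕ) (x : ℝ) :
    2 * kernel k₁ k₂ (x, x, x) = - ((k₁ + 1) * k₁ * (1 - x) ^ (k₁ - 1) * x ^ (k₂ + 1)
      - 2 * ((k₁ + 1) * (1 - x) ^ k₁ * ((k₂ + 1) * x ^ k₂))
      + (1 - x) ^ (k₁ + 1) * ((k₂ + 1) * k₂ * x ^ (k₂ - 1))) :=
  (exists_weight_dividedDifference k₁ k₂).choose_spec.2.2 x

lemma _root_.ConvexOn.mul_le_of_mem_Icc {s : Set ℝ} {f : ℝ → ℝ} (hf : ConvexOn ℝ s f) {p q u : ℝ}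
    (hp : p ∈ s) (hq : q ∈ s) (hpq : p < q) (hu : u ∈ Set.Icc p q) :
    (q - p) * f u ≤ (q - u) * f p + (u - p) * f q := by
  have hpos : 0 < q - p := sub_pos.2 hpq
  have h := hf.2 hp hq (show 0 ≤ (q - u) / (q - p) from div_nonneg (sub_nonneg.2 hu.2) hpos.le)
    (show 0 ≤ (u - p) / (q - p) from div_nonneg (sub_nonneg.2 hu.1) hpos.le)
    (by field_simp; ring)
  have e : ((q - u) / (q - p)) • p + ((u - p) / (q - p)) • q = u := by
    simp only [smul_eq_mul]; field_simp; ring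
  rw [e] at h
  have h' := mul_le_mul_of_nonneg_left h hpos.le
  simp only [smul_eq_mul] at h'
  rwa [show (q - p) * ((q - u) / (q - p) * f p + (u - p) / (q - p) * f q)
    = (q - u) * f p + (u - p) * f q by field_simp] at h'

/-- `u^(-n) (1 - u)^(-m)`, for `0 < u < 1`. -/
def invWeight (n m : ℕ) (u : ℝ) : ℝ := Real.exp (-(n * Real.log u) - m * Real.log (1 - u))

lemma convexOn_invWeight (n m : ℕ) : ConvexOn ℝ (Set.Ioo (0 : ℝ) 1) (invWeight n m) := by
  have hlog : ConcaveOn ℝ (Set.Ioo (0 : ℝ) 1) Real.log :=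
    strictConcaveOn_log_Ioi.concaveOn.subset (fun u hu => hu.1) (convex_Ioo 0 1)
  have hlog' : ConcaveOn ℝ (Set.Ioo (0 : ℝ) 1) fun u => Real.log (1 - u) := by
    refine ⟨convex_Ioo 0 1, fun x hx y hy a b ha hb hab => ?_⟩
    have := hlog.2 (x := 1 - x) (y := 1 - y) ⟨by linarith [hx.2], by linarith [hx.1]⟩
      ⟨by linarith [hy.2], by linarith [hy.1]⟩ ha hb hab
    convert this using 2
    simp only [smul_eq_mul]; linear_combination -hab
  have hconv : ConvexOn ℝ (Set.Ioo (0 : ℝ) 1)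
      fun u => -(n * Real.log u) - m * Real.log (1 - u) := by
    refine ⟨convex_Ioo 0 1, fun x hx y hy a b ha hb hab => ?_⟩
    have h1 := mul_le_mul_of_nonneg_left (hlog.2 hx hy ha hb hab) (Nat.cast_nonneg (α := ℝ) n)
    have h2 := mul_le_mul_of_nonneg_left (hlog'.2 hx hy ha hb hab) (Nat.cast_nonneg (α := ℝ) m)
    simp only [smul_eq_mul] at h1 h2 ⊢
    linarith
  refine ⟨convex_Ioo 0 1, fun x hx y hy a b ha hb hab => ?_⟩
  exact (Real.exp_le_exp.2 (hconv.2 hx hy ha hb hab)).trans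
    (convexOn_exp.2 (Set.mem_univ _) (Set.mem_univ _) ha hb hab)

lemma invWeight_mul {n m : ℕ} {u : ℝ} (hu : u ∈ Set.Ioo (0 : ℝ) 1) :
    invWeight n m u * ((1 - u) ^ m * u ^ n) = 1 := by
  have h1 : (1 - u) ^ m = Real.exp (m * Real.log (1 - u)) := by
    rw [Real.exp_nat_mul, Real.exp_log (sub_pos.2 hu.2)]
  have h2 : u ^ n = Real.exp (n * Real.log u) := by
    rw [Real.exp_nat_mul, Real.exp_log hu.1]
  rw [h1, h2, invWeight, ← Real.exp_add, ← Real.exp_add, Real.exp_eq_one_iff]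
  ring

/-- The convex potential whose sublevel sets are the basic domains. -/
def potential (k₁ k₂ : ℕ) (c u : ℝ) : ℝ := invWeight k₂ (k₁ + 1) u + c * invWeight (k₂ + 1) k₁ u

lemma convexOn_potential (k₁ k₂ : ℕ) {c : ℝ} (hc : 0 ≤ c) :
    ConvexOn ℝ (Set.Ioo (0 : ℝ) 1) (potential k₁ k₂ c) :=
  (convexOn_invWeight _ _).add ((convexOn_invWeight _ _).smul hc)

lemma polyRadicand_eq_weight_mul {k₁ k₂ : ℕ} (c T : ℝ) {u : ℝ} (hu : u ∈ Set.Ioo (0 : ℝ) 1) :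
    polyRadicand k₁ k₂ c T u = weight k₁ k₂ u * (T - potential k₁ k₂ c u) := by
  have h1 := invWeight_mul (n := k₂) (m := k₁ + 1) hu
  have h2 := invWeight_mul (n := k₂ + 1) (m := k₁) hu
  unfold polyRadicand potential weight
  linear_combination u * h1 + c * (1 - u) * h2

lemma polyRadicand_pos_iff {k₁ k₂ : ℕ} {c T u : ℝ} (hu : u ∈ Set.Ioo (0 : ℝ) 1) :
    0 < polyRadicand k₁ k₂ c T u ↔ potential k₁ k₂ c u < T := by
  rw [polyRadicand_eq_weight_mul c T hu, mul_pos_iff_of_pos_left (weight_pos hu), sub_pos]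

/-- `(x, y)` is the basic domain in the variable `u = sin² s`, and `x`, `y` are simple zeros of the
radicand. -/
structure IsRootPair (k₁ k₂ : ℕ) (c T x y : ℝ) : Prop where
  left_pos : 0 < x
  lt : x < y
  right_lt : y < 1
  left_zero : polyRadicand k₁ k₂ c T x = 0
  right_zero : polyRadicand k₁ k₂ c T y = 0
  pos_iff : ∀ u ∈ Set.Ioo (0 : ℝ) 1, 0 < polyRadicand k₁ k₂ c T u ↔ u ∈ Set.Ioo x y
  neg_of_notMem : ∀ u ∈ Set.Ioo (0 : ℝ) 1, u ∉ Set.Icc x y → polyRadicand k₁ k₂ c T u < 0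
  kernel_pos : ∀ z ∈ Set.Icc x y, 0 < T * kernel k₁ k₂ (x, y, z)

/-- Condition under which the potential blows up at both ends. -/
def IsConfining (k₂ : ℕ) (c : ℝ) : Prop := 0 < c ∨ 0 ≤ c ∧ 1 ≤ k₂

lemma IsConfining.nonneg {k₂ : ℕ} {c : ℝ} (h : IsConfining k₂ c) : 0 ≤ c :=
  h.elim le_of_lt And.left

lemma pos_of_polyRadicand_pos {k₁ k₂ : ℕ} {c T u : ℝ} (hc : 0 ≤ c) (hu : u ∈ Set.Ioo (0 : ℝ) 1)
    (h : 0 < polyRadicand k₁ k₂ c T u) : 0 < T := by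
  have h1 : 0 < T * weight k₁ k₂ u := by
    unfold polyRadicand at h
    nlinarith [hu.1, mul_nonneg hc (sub_pos.2 hu.2).le]
  exact (pos_iff_pos_of_mul_pos h1).2 (weight_pos hu)

lemma IsConfining.exists_neg {k₁ k₂ : ℕ} {c T z₀ : ℝ} (h : IsConfining k₂ c) (hz₀ : 0 < z₀)
    (hz₁ : z₀ < 1) (hT : 0 < T) : ∃ z ∈ Set.Ioo 0 z₀, polyRadicand k₁ k₂ c T z < 0 := by
  have hsmall : ∀ ε > 0, ∃ z ∈ Set.Ioo 0 z₀, z < ε := fun ε hε =>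
    ⟨min ε z₀ / 2, ⟨by positivity, by linarith [min_le_right ε z₀]⟩, by
      linarith [min_le_left ε z₀, lt_min hε hz₀]⟩
  rcases h with h | ⟨h, h'⟩
  · have hcont : Filter.Tendsto (fun z => polyRadicand k₁ k₂ c T z) (nhds 0)
        (nhds (polyRadicand k₁ k₂ c T 0)) :=
      Continuous.tendsto ((continuous_polyRadicand k₁ k₂).comp
        (by fun_prop : Continuous fun z : ℝ => (c, T, z))) 0
    have h0 : polyRadicand k₁ k₂ c T 0 < 0 := by simp [polyRadicand, weight, h]
    obtain ⟨ε, hε, h1⟩ := Metric.eventually_nhds_iff.1 (hcont.eventually_lt_const h0)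
    obtain ⟨z, hz, hzε⟩ := hsmall ε hε
    exact ⟨z, hz, h1 (by simpa [abs_of_pos hz.1] using hzε)⟩
  · obtain ⟨z, hz, hzε⟩ := hsmall (1 / T) (by positivity)
    refine ⟨z, hz, ?_⟩
    have hz1 : z < 1 := hz.2.trans hz₁
    have hTz : T * z < 1 := by rwa [lt_div_iff₀ hT, mul_comm] at hzε
    have h1 : weight k₁ k₂ z ≤ z * z := by
      unfold weight
      calc (1 - z) ^ (k₁ + 1) * z ^ (k₂ + 1) ≤ 1 * z ^ 2 := by
            apply mul_le_mul (pow_le_one₀ (by linarith) (by linarith [hz.1]))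
              (pow_le_pow_of_le_one hz.1.le hz1.le (by omega)) (pow_nonneg hz.1.le _) zero_le_one
        _ = z * z := by ring
    unfold polyRadicand
    have h2 : T * weight k₁ k₂ z ≤ (T * z) * z := by nlinarith
    nlinarith [hz.1, mul_nonneg h (sub_pos.2 hz1).le]

theorem exists_isRootPair {k₁ k₂ : ℕ} {c T z₀ : ℝ} (hc : IsConfining k₂ c)
    (hz₀ : z₀ ∈ Set.Ioo (0 : ℝ) 1) (h : 0 < polyRadicand k₁ k₂ c T z₀) :
    ∃ x y, IsRootPair k₁ k₂ c T x y ∧ z₀ ∈ Set.Ioo x y := by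
  have hcont : Continuous fun z => polyRadicand k₁ k₂ c T z :=
    (continuous_polyRadicand k₁ k₂).comp (by fun_prop : Continuous fun z : ℝ => (c, T, z))
  obtain ⟨w, hw, hwneg⟩ := hc.exists_neg (k₁ := k₁) hz₀.1 hz₀.2
    (pos_of_polyRadicand_pos hc.nonneg hz₀ h)
  obtain ⟨x, hx, hx0⟩ := intermediate_value_Icc hw.2.le hcont.continuousOn
    (show (0 : ℝ) ∈ _ from ⟨hwneg.le, h.le⟩)
  obtain ⟨y, hy, hy0⟩ := intermediate_value_Icc' hz₀.2.le hcont.continuousOn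
    (show (0 : ℝ) ∈ _ from ⟨by simp [polyRadicand, weight], h.le⟩)
  have hx0' : polyRadicand k₁ k₂ c T x = 0 := hx0
  have hy0' : polyRadicand k₁ k₂ c T y = 0 := hy0
  have hxz : x < z₀ := lt_of_le_of_ne hx.2 (by rintro rfl; simp [hx0'] at h)
  have hzy : z₀ < y := lt_of_le_of_ne hy.1 (by rintro rfl; simp [hy0'] at h)
  have hy1 : y < 1 := lt_of_le_of_ne hy.2 (by rintro rfl; simp [polyRadicand, weight] at hy0')
  have hxpos : 0 < x := hw.1.trans_le hx.1
  have hxI : x ∈ Set.Ioo (0 : ℝ) 1 := ⟨hxpos, hxz.trans hz₀.2⟩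
  have hyI : y ∈ Set.Ioo (0 : ℝ) 1 := ⟨hz₀.1.trans hzy, hy1⟩
  set Φ := potential k₁ k₂ c with hΦ
  have hconv := convexOn_potential k₁ k₂ hc.nonneg
  have hzero : ∀ u ∈ Set.Ioo (0 : ℝ) 1, polyRadicand k₁ k₂ c T u = 0 → Φ u = T := by
    intro u hu h0
    rw [polyRadicand_eq_weight_mul c T hu] at h0
    have := (mul_eq_zero.1 h0).resolve_left (weight_pos hu).ne'
    linarith
  have hΦx := hzero x hxI hx0'
  have hΦy := hzero y hyI hy0'
  have hΦz : Φ z₀ < T := (polyRadicand_pos_iff hz₀).1 h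
  -- chords
  have left_chord : ∀ u ∈ Set.Icc x z₀, (z₀ - x) * (T - Φ u) ≥ (u - x) * (T - Φ z₀) := by
    intro u hu
    have h := hconv.mul_le_of_mem_Icc hxI hz₀ hxz hu
    rw [← hΦ, hΦx] at h
    linarith
  have right_chord : ∀ u ∈ Set.Icc z₀ y, (y - z₀) * (T - Φ u) ≥ (y - u) * (T - Φ z₀) := by
    intro u hu
    have h := hconv.mul_le_of_mem_Icc hz₀ hyI hzy hu
    rw [← hΦ, hΦy] at h
    linarith
  have hsub : ∀ u ∈ Set.Icc x y, u ∈ Set.Ioo (0 : ℝ) 1 := fun u hu =>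
    ⟨hxpos.trans_le hu.1, hu.2.trans_lt hy1⟩
  have inside : ∀ u ∈ Set.Ioo x y, Φ u < T := by
    intro u hu
    rcases le_total u z₀ with h1 | h1
    · have := left_chord u ⟨hu.1.le, h1⟩
      have h2 : 0 < (z₀ - x) * (T - Φ u) :=
        lt_of_lt_of_le (mul_pos (sub_pos.2 hu.1) (sub_pos.2 hΦz)) this
      exact sub_pos.1 ((pos_iff_pos_of_mul_pos h2).1 (sub_pos.2 hxz))
    · have := right_chord u ⟨h1, hu.2.le⟩
      have h2 : 0 < (y - z₀) * (T - Φ u) :=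
        lt_of_lt_of_le (mul_pos (sub_pos.2 hu.2) (sub_pos.2 hΦz)) this
      exact sub_pos.1 ((pos_iff_pos_of_mul_pos h2).1 (sub_pos.2 hzy))
  have conv_set := hconv.convex_lt T
  have outside : ∀ u ∈ Set.Ioo (0 : ℝ) 1, Φ u < T → u ∈ Set.Ioo x y := by
    intro u hu hlt
    by_contra hnot
    have hoc := conv_set.ordConnected
    rw [Set.mem_Ioo, not_and_or, not_lt, not_lt] at hnot
    rcases hnot with h1 | h1
    · have : x ∈ {z ∈ Set.Ioo (0 : ℝ) 1 | potential k₁ k₂ c z < T} :=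
        hoc.out ⟨hu, hlt⟩ ⟨hz₀, hΦz⟩ ⟨h1, hxz.le⟩
      exact absurd this.2 (by rw [← hΦ, hΦx]; exact lt_irrefl _)
    · have : y ∈ {z ∈ Set.Ioo (0 : ℝ) 1 | potential k₁ k₂ c z < T} :=
        hoc.out ⟨hz₀, hΦz⟩ ⟨hu, hlt⟩ ⟨hzy.le, h1⟩
      exact absurd this.2 (by rw [← hΦ, hΦy]; exact lt_irrefl _)
  have hfac := polyRadicand_eq_mul_kernel (hxz.trans hzy).ne hx0' hy0'
  set Q : ℝ → ℝ := fun z => T * kernel k₁ k₂ (x, y, z) with hQ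
  have hQc : Continuous Q := by
    have := (contDiff_kernel k₁ k₂).continuous
    fun_prop
  have hwc : Continuous (weight k₁ k₂) := by unfold weight; fun_prop
  refine ⟨x, y, ⟨hxpos, hxz.trans hzy, hy1, hx0', hy0', fun u hu => ?_, fun u hu hn => ?_,
    fun z hz => ?_⟩, hxz, hzy⟩
  · rw [polyRadicand_pos_iff hu]
    exact ⟨outside u hu, inside u⟩
  · rw [polyRadicand_eq_weight_mul c T hu]
    refine mul_neg_of_pos_of_neg (weight_pos hu) (sub_neg.2 (not_le.1 fun hle => ?_))
    rw [Set.mem_Icc, not_and_or, not_le, not_le] at hn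
    rcases hn with h1 | h1
    · have h2 := hconv.mul_le_of_mem_Icc hu hz₀ (h1.trans hxz) ⟨h1.le, hxz.le⟩
      rw [← hΦ, hΦx] at h2
      nlinarith [mul_le_mul_of_nonneg_left hle (sub_pos.2 hxz).le]
    · have h2 := hconv.mul_le_of_mem_Icc hz₀ hu (hzy.trans h1) ⟨hzy.le, h1.le⟩
      rw [← hΦ, hΦy] at h2
      nlinarith [mul_le_mul_of_nonneg_left hle (sub_pos.2 hzy).le]
  · change 0 < Q z
    have hδ : 0 < T - Φ z₀ := sub_pos.2 hΦz
    have hval : ∀ u ∈ Set.Icc x y, weight k₁ k₂ u * (T - Φ u) = (u - x) * (y - u) * Q u :=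
      fun u hu => (polyRadicand_eq_weight_mul c T (hsub u hu)).symm.trans (hfac u)
    rcases eq_or_lt_of_le hz.1 with rfl | hz1
    · have hcl : IsClosed {u | weight k₁ k₂ u * (T - Φ z₀) ≤ (z₀ - x) * ((y - u) * Q u)} :=
        isClosed_le (by fun_prop) (by fun_prop)
      have hIoo : Set.Ioo x z₀ ⊆
          {u | weight k₁ k₂ u * (T - Φ z₀) ≤ (z₀ - x) * ((y - u) * Q u)} := by
        intro u hu
        have h1 := left_chord u ⟨hu.1.le, hu.2.le⟩
        have hu' : u ∈ Set.Icc x y := ⟨hu.1.le, (hu.2.trans hzy).le⟩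
        have h2 := mul_le_mul_of_nonneg_left h1 (weight_pos (k₁ := k₁) (k₂ := k₂) (hsub u hu')).le
        refine le_of_mul_le_mul_left ?_ (sub_pos.2 hu.1)
        linarith [hval u hu', congrArg (fun r => (z₀ - x) * r) (hval u hu')]
      have h3 := hcl.closure_subset_iff.2 hIoo (by
        rw [closure_Ioo hxz.ne]; exact ⟨le_rfl, hxz.le⟩ : x ∈ closure (Set.Ioo x z₀))
      have h4 := (mul_pos (weight_pos (k₁ := k₁) (k₂ := k₂) hxI) hδ).trans_le h3
      exact (pos_iff_pos_of_mul_pos ((pos_iff_pos_of_mul_pos h4).1 (sub_pos.2 hxz))).1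
        (sub_pos.2 (hxz.trans hzy))
    rcases eq_or_lt_of_le hz.2 with rfl | hz2
    · have hcl : IsClosed {u | weight k₁ k₂ u * (T - Φ z₀) ≤ (z - z₀) * ((u - x) * Q u)} :=
        isClosed_le (by fun_prop) (by fun_prop)
      have hIoo : Set.Ioo z₀ z ⊆
          {u | weight k₁ k₂ u * (T - Φ z₀) ≤ (z - z₀) * ((u - x) * Q u)} := by
        intro u hu
        have h1 := right_chord u ⟨hu.1.le, hu.2.le⟩
        have hu' : u ∈ Set.Icc x z := ⟨(hxz.trans hu.1).le, hu.2.le⟩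
        have h2 := mul_le_mul_of_nonneg_left h1 (weight_pos (k₁ := k₁) (k₂ := k₂) (hsub u hu')).le
        refine le_of_mul_le_mul_left ?_ (sub_pos.2 hu.2)
        linarith [hval u hu', congrArg (fun r => (z - z₀) * r) (hval u hu')]
      have h3 := hcl.closure_subset_iff.2 hIoo (by
        rw [closure_Ioo hzy.ne]; exact ⟨hzy.le, le_rfl⟩ : z ∈ closure (Set.Ioo z₀ z))
      have h4 := (mul_pos (weight_pos (k₁ := k₁) (k₂ := k₂) hyI) hδ).trans_le h3
      exact (pos_iff_pos_of_mul_pos ((pos_iff_pos_of_mul_pos h4).1 (sub_pos.2 hzy))).1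
        (sub_pos.2 (hxz.trans hzy))
    have h1 : 0 < (z - x) * (y - z) * Q z := by
      rw [← hval z hz]
      exact mul_pos (weight_pos (hsub z hz)) (sub_pos.2 (inside z ⟨hz1, hz2⟩))
    exact (pos_iff_pos_of_mul_pos h1).1 (mul_pos (sub_pos.2 hz1) (sub_pos.2 hz2))

/-! ### The solution curve -/

/-- The motion `u = sin² θ` between the turning points `x` and `y`. -/
def turning (x y t : ℝ) : ℝ := (x + y) / 2 - (y - x) / 2 * Real.cos t

/-- The regular factor of the radicand along the motion. -/
def regularFactor (k₁ k₂ : ℕ) (T x y t : ℝ) : ℝ := T * kernel k₁ k₂ (x, y, turning x y t)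

/-- The derivative of `s₁` along the motion. -/
def rate₁ (k₁ k₂ : ℕ) (T x y t : ℝ) : ℝ :=
  1 / (2 * (1 - turning x y t) * √(regularFactor k₁ k₂ T x y t))

/-- The derivative of `s₂`, up to the factor `C`, along the motion. -/
def rate₂ (k₁ k₂ : ℕ) (T x y t : ℝ) : ℝ :=
  1 / (2 * turning x y t * √(regularFactor k₁ k₂ T x y t))

lemma contDiff_turning (x y : ℝ) : ContDiff ℝ ∞ (turning x y) := by
  unfold turning; fun_prop

lemma hasDerivAt_turning (x y t : ℝ) :
    HasDerivAt (turning x y) ((y - x) / 2 * Real.sin t) t := by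
  have := ((Real.hasDerivAt_cos t).const_mul ((y - x) / 2)).const_sub ((x + y) / 2)
  exact this.congr_deriv (by ring)

lemma turning_mem {x y : ℝ} (h : x ≤ y) (t : ℝ) : turning x y t ∈ Set.Icc x y := by
  unfold turning
  constructor <;> nlinarith [Real.cos_le_one t, Real.neg_one_le_cos t]

lemma turning_add_two_pi (x y t : ℝ) : turning x y (t + 2 * Real.pi) = turning x y t := by
  simp [turning]

lemma turning_sq (x y t : ℝ) : ((y - x) / 2 * Real.sin t) ^ 2
    = (turning x y t - x) * (y - turning x y t) := by
  unfold turning; linear_combination ((y - x) / 2) ^ 2 * Real.sin_sq_add_cos_sq t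

namespace IsRootPair

variable {k₁ k₂ : ℕ} {c T x y : ℝ} (h : IsRootPair k₁ k₂ c T x y)
include h

lemma turning_pos (t : ℝ) : 0 < turning x y t :=
  h.left_pos.trans_le (turning_mem h.lt.le t).1

lemma turning_lt_one (t : ℝ) : turning x y t < 1 :=
  (turning_mem h.lt.le t).2.trans_lt h.right_lt

lemma regularFactor_pos (t : ℝ) : 0 < regularFactor k₁ k₂ T x y t :=
  h.kernel_pos _ (turning_mem h.lt.le t)

lemma contDiff_sqrt_regularFactor : ContDiff ℝ ∞ fun t => √(regularFactor k₁ k₂ T x y t) := by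
  have h1 := contDiff_kernel k₁ k₂
  have h2 := contDiff_turning x y
  refine ContDiff.sqrt (by unfold regularFactor; fun_prop) fun t => (h.regularFactor_pos t).ne'

lemma contDiff_rate₁ : ContDiff ℝ ∞ (rate₁ k₁ k₂ T x y) := by
  have h1 := h.contDiff_sqrt_regularFactor
  have h2 := contDiff_turning x y
  refine ContDiff.div contDiff_const (by fun_prop) fun t => ?_
  have := sub_pos.2 (h.turning_lt_one t)
  have := Real.sqrt_pos.2 (h.regularFactor_pos t)
  positivity

lemma contDiff_rate₂ : ContDiff ℝ ∞ (rate₂ k₁ k₂ T x y) := by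
  have h1 := h.contDiff_sqrt_regularFactor
  have h2 := contDiff_turning x y
  refine ContDiff.div contDiff_const (by fun_prop) fun t => ?_
  have := h.turning_pos t
  have := Real.sqrt_pos.2 (h.regularFactor_pos t)
  positivity

lemma rate₁_pos (t : ℝ) : 0 < rate₁ k₁ k₂ T x y t := by
  have := sub_pos.2 (h.turning_lt_one t)
  have := Real.sqrt_pos.2 (h.regularFactor_pos t)
  unfold rate₁; positivity

lemma rate₂_pos (t : ℝ) : 0 < rate₂ k₁ k₂ T x y t := by
  have := h.turning_pos t
  have := Real.sqrt_pos.2 (h.regularFactor_pos t)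
  unfold rate₂; positivity

end IsRootPair

/-- The polar angle `θ` along the motion. -/
def polarAngle (x y t : ℝ) : ℝ := Real.arcsin √(turning x y t)

/-- The primitive of `f` that vanishes at `0`. -/
def phase (f : ℝ → ℝ) (t : ℝ) : ℝ := ∫ τ in (0 : ℝ)..t, f τ

lemma hasDerivAt_phase {f : ℝ → ℝ} (hf : Continuous f) (t : ℝ) : HasDerivAt (phase f) (f t) t :=
  intervalIntegral.integral_hasDerivAt_right (hf.intervalIntegrable _ _)
    (hf.stronglyMeasurableAtFilter _ _) hf.continuousAt

lemma contDiff_phase {f : ℝ → ℝ} (hf : ContDiff ℝ ∞ f) : ContDiff ℝ ∞ (phase f) := by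
  rw [contDiff_infty_iff_deriv]
  refine ⟨fun t => (hasDerivAt_phase hf.continuous t).differentiableAt, ?_⟩
  rwa [show deriv (phase f) = f from funext fun t => (hasDerivAt_phase hf.continuous t).deriv]

lemma phase_reflect {f : ℝ → ℝ} (hf : Continuous f) {e : ℝ} (he : ∀ t, f (2 * e - t) = f t)
    (t : ℝ) : phase f (2 * e - t) = 2 * phase f e - phase f t := by
  have hd : ∀ t, HasDerivAt (fun t => phase f (2 * e - t) + phase f t) 0 t := by
    intro t
    have h1 := (hasDerivAt_phase hf (2 * e - t)).comp t ((hasDerivAt_id t).const_sub (2 * e))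
    have h2 := h1.add (hasDerivAt_phase hf t)
    rw [he] at h2
    exact h2.congr_deriv (by ring)
  have := is_const_of_deriv_eq_zero (fun t => (hd t).differentiableAt) (fun t => (hd t).deriv) t e
  simp only [show 2 * e - e = e by ring] at this
  linarith

lemma phase_add {f : ℝ → ℝ} (hf : Continuous f) {p : ℝ} (hp : ∀ t, f (t + p) = f t) (t : ℝ) :
    phase f (t + p) = phase f t + phase f p := by
  have hd : ∀ t, HasDerivAt (fun t => phase f (t + p) - phase f t) 0 t := by
    intro t
    have h1 := (hasDerivAt_phase hf (t + p)).comp t ((hasDerivAt_id t).add_const p)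
    have h2 := h1.sub (hasDerivAt_phase hf t)
    rw [hp] at h2
    exact h2.congr_deriv (by ring)
  have := is_const_of_deriv_eq_zero (fun t => (hd t).differentiableAt) (fun t => (hd t).deriv) t 0
  simp only [zero_add] at this
  have h0 : phase f 0 = 0 := by simp [phase]
  linarith

namespace IsRootPair

variable {k₁ k₂ : ℕ} {c T x y : ℝ} (h : IsRootPair k₁ k₂ c T x y)
include h

lemma sqrt_turning_lt_one (t : ℝ) : √(turning x y t) < 1 := by
  rw [Real.sqrt_lt' one_pos]; simpa using h.turning_lt_one t

lemma sin_polarAngle (t : ℝ) : Real.sin (polarAngle x y t) = √(turning x y t) :=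
  Real.sin_arcsin (by linarith [Real.sqrt_nonneg (turning x y t)]) (h.sqrt_turning_lt_one t).le

lemma cos_polarAngle (t : ℝ) : Real.cos (polarAngle x y t) = √(1 - turning x y t) := by
  rw [polarAngle, Real.cos_arcsin, Real.sq_sqrt (h.turning_pos t).le]

lemma polarAngle_mem (t : ℝ) : polarAngle x y t ∈ Set.Ioo 0 (Real.pi / 2) :=
  ⟨Real.arcsin_pos.2 (Real.sqrt_pos.2 (h.turning_pos t)),
    Real.arcsin_lt_pi_div_two.2 (h.sqrt_turning_lt_one t)⟩

lemma contDiff_polarAngle : ContDiff ℝ ∞ (polarAngle x y) := by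
  refine contDiff_iff_contDiffAt.2 fun t => ?_
  refine (Real.contDiffAt_arcsin ?_ (h.sqrt_turning_lt_one t).ne).comp t
    ((contDiff_turning x y).contDiffAt.sqrt (h.turning_pos t).ne')
  linarith [Real.sqrt_nonneg (turning x y t)]

lemma hasDerivAt_polarAngle (t : ℝ) : HasDerivAt (polarAngle x y)
    ((y - x) / 2 * Real.sin t / (2 * √(turning x y t) * √(1 - turning x y t))) t := by
  have h1 := (Real.hasDerivAt_arcsin (x := √(turning x y t))
    (by linarith [Real.sqrt_nonneg (turning x y t)]) (h.sqrt_turning_lt_one t).ne).comp t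
    ((hasDerivAt_turning x y t).sqrt (h.turning_pos t).ne')
  rw [Real.sq_sqrt (h.turning_pos t).le] at h1
  exact h1.congr_deriv (by rw [div_mul_div_comm, one_mul]; ring)

lemma radicand_polarAngle {C : ℝ} (hC : c = C ^ 2) (t : ℝ) :
    radicand k₁ k₂ C T (polarAngle x y t)
      = ((y - x) / 2 * Real.sin t) ^ 2 * regularFactor k₁ k₂ T x y t := by
  rw [radicand_eq_polyRadicand, h.sin_polarAngle, Real.sq_sqrt (h.turning_pos t).le, ← hC,
    polyRadicand_eq_mul_kernel h.lt.ne h.left_zero h.right_zero, turning_sq, regularFactor]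

lemma deriv_turning_pos {t : ℝ} (ht : t ∈ Set.Ioo 0 Real.pi) : 0 < (y - x) / 2 * Real.sin t :=
  mul_pos (by linarith [h.lt]) (Real.sin_pos_of_pos_of_lt_pi ht.1 ht.2)

lemma deriv_polarAngle_pos {t : ℝ} (ht : t ∈ Set.Ioo 0 Real.pi) :
    0 < deriv (polarAngle x y) t := by
  rw [(h.hasDerivAt_polarAngle t).deriv]
  have := h.deriv_turning_pos ht
  have := Real.sqrt_pos.2 (h.turning_pos t)
  have := Real.sqrt_pos.2 (sub_pos.2 (h.turning_lt_one t))
  positivity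

lemma integrand₁_polarAngle {C : ℝ} (hC : c = C ^ 2) {t : ℝ} (ht : t ∈ Set.Ioo 0 Real.pi) :
    integrand₁ k₁ k₂ C T (polarAngle x y t) * deriv (polarAngle x y) t = rate₁ k₁ k₂ T x y t := by
  have h1 := h.deriv_turning_pos ht
  have h2 := Real.sqrt_pos.2 (h.turning_pos t)
  have h3 := Real.sqrt_pos.2 (sub_pos.2 (h.turning_lt_one t))
  have h4 := Real.sqrt_pos.2 (h.regularFactor_pos t)
  rw [(h.hasDerivAt_polarAngle t).deriv, integrand₁, h.radicand_polarAngle hC,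
    Real.sqrt_mul (sq_nonneg _), Real.sqrt_sq h1.le, Real.tan_eq_sin_div_cos, h.sin_polarAngle,
    h.cos_polarAngle, rate₁]
  have h5 := Real.sq_sqrt (sub_pos.2 (h.turning_lt_one t)).le
  rw [← h5, Real.sqrt_sq h3.le]
  have := (sub_pos.2 h.lt).ne'
  have := (Real.sin_pos_of_pos_of_lt_pi ht.1 ht.2).ne'
  field_simp

lemma integrand₂_polarAngle {C : ℝ} (hC : c = C ^ 2) {t : ℝ} (ht : t ∈ Set.Ioo 0 Real.pi) :
    integrand₂ k₁ k₂ C T (polarAngle x y t) * deriv (polarAngle x y) t = rate₂ k₁ k₂ T x y t := by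
  have h1 := h.deriv_turning_pos ht
  have h2 := Real.sqrt_pos.2 (h.turning_pos t)
  have h3 := Real.sqrt_pos.2 (sub_pos.2 (h.turning_lt_one t))
  have h4 := Real.sqrt_pos.2 (h.regularFactor_pos t)
  rw [(h.hasDerivAt_polarAngle t).deriv, integrand₂, h.radicand_polarAngle hC,
    Real.sqrt_mul (sq_nonneg _), Real.sqrt_sq h1.le, Real.cot_eq_cos_div_sin, h.sin_polarAngle,
    h.cos_polarAngle, rate₂]
  have := (sub_pos.2 h.lt).ne'
  have := (Real.sin_pos_of_pos_of_lt_pi ht.1 ht.2).ne'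
  have h5 := Real.sq_sqrt (h.turning_pos t).le
  set r := √(turning x y t) with hr
  rw [show 2 * turning x y t = 2 * r ^ 2 by rw [h5]]
  field_simp

lemma polarAngle_image {C : ℝ} (hC : c = C ^ 2) :
    polarAngle x y '' Set.Ioo 0 Real.pi = basicDomain k₁ k₂ C T := by
  ext s
  constructor
  · rintro ⟨t, ht, rfl⟩
    refine ⟨h.polarAngle_mem t, ?_⟩
    rw [h.radicand_polarAngle hC]
    exact mul_pos (pow_pos (h.deriv_turning_pos ht) 2) (h.regularFactor_pos t)
  · rintro ⟨hs, hpos⟩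
    have hsin : 0 < Real.sin s := Real.sin_pos_of_pos_of_lt_pi hs.1 (by linarith [hs.2, Real.pi_pos])
    have hcos : 0 < Real.cos s := Real.cos_pos_of_mem_Ioo ⟨by linarith [hs.1, Real.pi_pos], hs.2⟩
    rw [radicand_eq_polyRadicand, ← hC, h.pos_iff _ ⟨by positivity, by
      nlinarith [Real.sin_sq_add_cos_sq s]⟩] at hpos
    have hA : 0 < (y - x) / 2 := by linarith [h.lt]
    set w := ((x + y) / 2 - Real.sin s ^ 2) / ((y - x) / 2) with hw
    have hw1 : -1 < w := by rw [hw, lt_div_iff₀ hA]; linarith [hpos.2]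
    have hw2 : w < 1 := by rw [hw, div_lt_iff₀ hA]; linarith [hpos.1]
    refine ⟨Real.arccos w, ⟨Real.arccos_pos.2 hw2, ?_⟩, ?_⟩
    · exact lt_of_le_of_ne (Real.arccos_le_pi w) fun he => by
        rw [Real.arccos_eq_pi] at he; linarith
    · have : turning x y (Real.arccos w) = Real.sin s ^ 2 := by
        rw [turning, Real.cos_arccos hw1.le hw2.le, hw, mul_div_cancel₀ _ hA.ne']; ring
      rw [polarAngle, this, Real.sqrt_sq hsin.le, Real.arcsin_sin (by linarith [hs.1, Real.pi_pos]) hs.2.le]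

lemma polarAngle_strictMonoOn : StrictMonoOn (polarAngle x y) (Set.Ioo 0 Real.pi) :=
  strictMonoOn_of_deriv_pos (convex_Ioo _ _) h.contDiff_polarAngle.continuous.continuousOn
    fun t ht => h.deriv_polarAngle_pos (by simpa using ht)

lemma integral_image {C : ℝ} (hC : c = C ^ 2) {F r : ℝ → ℝ} (hr : Continuous r)
    (hF : ∀ t ∈ Set.Ioo 0 Real.pi, F (polarAngle x y t) * deriv (polarAngle x y) t = r t) :
    IntegrableOn F (basicDomain k₁ k₂ C T) ∧
      ∫ s in basicDomain k₁ k₂ C T, F s = phase r Real.pi := by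
  have hd : ∀ t ∈ Set.Ioo 0 Real.pi, HasDerivWithinAt (polarAngle x y)
      (deriv (polarAngle x y) t) (Set.Ioo 0 Real.pi) t := fun t _ =>
    (h.hasDerivAt_polarAngle t).differentiableAt.hasDerivAt.hasDerivWithinAt
  have he : Set.EqOn (fun t => |deriv (polarAngle x y) t| • F (polarAngle x y t)) r
      (Set.Ioo 0 Real.pi) := fun t ht => by
    simp only [smul_eq_mul]
    rw [abs_of_pos (h.deriv_polarAngle_pos ht), mul_comm, hF t ht]
  rw [← h.polarAngle_image hC]
  constructor
  · rw [integrableOn_image_iff_integrableOn_abs_deriv_smul measurableSet_Ioo hd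
      h.polarAngle_strictMonoOn.injOn, integrableOn_congr_fun he measurableSet_Ioo]
    exact (hr.continuousOn.integrableOn_Icc).mono_set Set.Ioo_subset_Icc_self
  · rw [integral_image_eq_integral_abs_deriv_smul measurableSet_Ioo hd
      h.polarAngle_strictMonoOn.injOn, setIntegral_congr_fun measurableSet_Ioo he, phase,
      intervalIntegral.integral_of_le Real.pi_pos.le, integral_Ioc_eq_integral_Ioo]

lemma integral₁ {C : ℝ} (hC : c = C ^ 2) :
    IntegrableOn (integrand₁ k₁ k₂ C T) (basicDomain k₁ k₂ C T) ∧
      J₁ k₁ k₂ C T = phase (rate₁ k₁ k₂ T x y) Real.pi :=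
  h.integral_image hC h.contDiff_rate₁.continuous fun _ ht => h.integrand₁_polarAngle hC ht

lemma integral₂ {C : ℝ} (hC : c = C ^ 2) :
    IntegrableOn (integrand₂ k₁ k₂ C T) (basicDomain k₁ k₂ C T) ∧
      J₂ k₁ k₂ C T = phase (rate₂ k₁ k₂ T x y) Real.pi :=
  h.integral_image hC h.contDiff_rate₂.continuous fun _ ht => h.integrand₂_polarAngle hC ht

end IsRootPair

lemma exists_isRootPair_of_nonempty {k₁ k₂ : ℕ} {C T : ℝ} (hC : C ≠ 0)
    (h : (basicDomain k₁ k₂ C T).Nonempty) : ∃ x y, IsRootPair k₁ k₂ (C ^ 2) T x y := by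
  obtain ⟨s, hs, hpos⟩ := h
  have hsin : 0 < Real.sin s := Real.sin_pos_of_pos_of_lt_pi hs.1 (by linarith [hs.2, Real.pi_pos])
  have hcos : 0 < Real.cos s := Real.cos_pos_of_mem_Ioo ⟨by linarith [hs.1, Real.pi_pos], hs.2⟩
  rw [radicand_eq_polyRadicand] at hpos
  obtain ⟨x, y, h, -⟩ := exists_isRootPair (Or.inl (by positivity))
    (show Real.sin s ^ 2 ∈ Set.Ioo (0 : ℝ) 1 from
      ⟨by positivity, by nlinarith [Real.sin_sq_add_cos_sq s]⟩) hpos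
  exact ⟨x, y, h⟩

/-! ### The equation of the curve -/

lemma hasDerivAt_polar {m s : ℝ → ℝ} {ρ σ t : ℝ} (hm : HasDerivAt m (m t * ρ) t)
    (hs : HasDerivAt s σ t) :
    HasDerivAt (fun t => (m t : ℂ) * Complex.exp (s t * Complex.I))
      ((m t : ℂ) * Complex.exp (s t * Complex.I) * (ρ + σ * Complex.I)) t := by
  have h1 := hm.ofReal_comp
  have h2 := (hs.ofReal_comp.mul_const Complex.I).cexp
  refine (h1.mul h2).congr_deriv ?_
  push_cast; ring

lemma hasDerivAt_deriv_polar {g : ℝ → ℂ} {ρ σ : ℝ → ℝ} {ρ' σ' t : ℝ}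
    (hg : ∀ t, HasDerivAt g (g t * (ρ t + σ t * Complex.I)) t) (hρ : HasDerivAt ρ ρ' t)
    (hσ : HasDerivAt σ σ' t) :
    deriv (deriv g) t
      = g t * ((ρ t + σ t * Complex.I) ^ 2 + (ρ' + σ' * Complex.I)) := by
  have h1 := (hg t).mul (hρ.ofReal_comp.add (hσ.ofReal_comp.mul_const Complex.I))
  rw [show deriv g = fun t => g t * (ρ t + σ t * Complex.I) from funext fun t => (hg t).deriv]
  exact (h1.congr_deriv (by simp only [Pi.add_apply]; ring)).deriv

lemma energy_identity {u v V r P C : ℝ} (hu : u ≠ 0) (hv : v ≠ 0) (hr : r ≠ 0) (huv : u + v = 1)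
    (h : V ^ 2 * r ^ 2 = P * (v * u) - u - C ^ 2 * v) :
    v * ((-V / (2 * v)) ^ 2 + (1 / (2 * v * r)) ^ 2)
      + u * ((V / (2 * u)) ^ 2 + (C * (1 / (2 * u * r))) ^ 2) = P / (4 * r ^ 2) := by
  have e : v * ((-V / (2 * v)) ^ 2 + (1 / (2 * v * r)) ^ 2)
      + u * ((V / (2 * u)) ^ 2 + (C * (1 / (2 * u * r))) ^ 2)
      = (V ^ 2 * r ^ 2 * (u + v) + u + C ^ 2 * v) / (4 * u * v * r ^ 2) := by
    field_simp; ring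
  rw [e, huv, h]
  field_simp; ring

lemma curvature_identity {u v V W r K P C k₁ k₂ : ℝ} (hu : u ≠ 0) (hv : v ≠ 0) (hr : r ≠ 0)
    (huv : u + v = 1) (h : V ^ 2 * r ^ 2 = P * (v * u) - u - C ^ 2 * v)
    (h' : 2 * W * r ^ 2 + V ^ 2 * K = P * ((k₂ + 1) * v - (k₁ + 1) * u) - 1 + C ^ 2) :
    (-V / (2 * v)) ^ 2 - (1 / (2 * v * r)) ^ 2 + (-W / (2 * v) - V ^ 2 / (2 * v ^ 2))
      - k₁ * (P / (4 * r ^ 2)) / v - -(K * V) / (2 * r ^ 2) * (-V / (2 * v))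
    = (V / (2 * u)) ^ 2 - (C * (1 / (2 * u * r))) ^ 2 + (W / (2 * u) - V ^ 2 / (2 * u ^ 2))
      - k₂ * (P / (4 * r ^ 2)) / u - -(K * V) / (2 * r ^ 2) * (V / (2 * u)) := by
  have e₁ : (-V / (2 * v)) ^ 2 - (1 / (2 * v * r)) ^ 2 + (-W / (2 * v) - V ^ 2 / (2 * v ^ 2))
      - k₁ * (P / (4 * r ^ 2)) / v - -(K * V) / (2 * r ^ 2) * (-V / (2 * v))
      = (-(V ^ 2 * r ^ 2) - 1 - v * (2 * W * r ^ 2 + V ^ 2 * K) - k₁ * P * v)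
        / (4 * v ^ 2 * r ^ 2) := by
    field_simp; ring
  have e₂ : (V / (2 * u)) ^ 2 - (C * (1 / (2 * u * r))) ^ 2 + (W / (2 * u) - V ^ 2 / (2 * u ^ 2))
      - k₂ * (P / (4 * r ^ 2)) / u - -(K * V) / (2 * r ^ 2) * (V / (2 * u))
      = (-(V ^ 2 * r ^ 2) - C ^ 2 + u * (2 * W * r ^ 2 + V ^ 2 * K) - k₂ * P * u)
        / (4 * u ^ 2 * r ^ 2) := by
    field_simp; ring
  rw [e₁, e₂, h, h', div_eq_div_iff (by positivity) (by positivity)]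
  obtain rfl : v = 1 - u := by linarith
  ring

/-- The curve `(g₁, g₂)` lies in the unit sphere, avoids the two axes, and satisfies the equation
which makes its products with `𝒞`-totally real minimal immersions of dimensions `k₁`, `k₂` minimal. -/
structure IsMinimalProfile (k₁ k₂ : ℕ) (g₁ g₂ : ℝ → ℂ) : Prop where
  contDiff₁ : ContDiff ℝ ∞ g₁
  contDiff₂ : ContDiff ℝ ∞ g₂
  ne_zero₁ : ∀ t, g₁ t ≠ 0
  ne_zero₂ : ∀ t, g₂ t ≠ 0
  norm_sq_add : ∀ t, ‖g₁ t‖ ^ 2 + ‖g₂ t‖ ^ 2 = 1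
  speed_pos : ∀ t, 0 < ‖deriv g₁ t‖ ^ 2 + ‖deriv g₂ t‖ ^ 2
  equation : ∀ t, ∃ a b : ℝ,
    deriv (deriv g₁) t = ((k₁ * (‖deriv g₁ t‖ ^ 2 + ‖deriv g₂ t‖ ^ 2) / ‖g₁ t‖ ^ 2 + a : ℝ) : ℂ)
      * g₁ t + (b : ℂ) * deriv g₁ t ∧
    deriv (deriv g₂) t = ((k₂ * (‖deriv g₁ t‖ ^ 2 + ‖deriv g₂ t‖ ^ 2) / ‖g₂ t‖ ^ 2 + a : ℝ) : ℂ)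
      * g₂ t + (b : ℂ) * deriv g₂ t

/-- The curve `(cos θ e^{i s₁}, sin θ e^{i s₂})`. -/
def spiral (k₁ k₂ : ℕ) (C T x y t : ℝ) : ℂ × ℂ :=
  (Real.cos (polarAngle x y t) * Complex.exp (phase (rate₁ k₁ k₂ T x y) t * Complex.I),
    Real.sin (polarAngle x y t)
      * Complex.exp (phase (fun τ => C * rate₂ k₁ k₂ T x y τ) t * Complex.I))

/-- The derivative of the second divided difference along the motion. -/
def kernelDeriv (k₁ k₂ : ℕ) (T x y t : ℝ) : ℝ :=
  T * deriv (fun z => kernel k₁ k₂ (x, y, z)) (turning x y t)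

lemma hasDerivAt_kernel (k₁ k₂ : ℕ) (T x y t : ℝ) :
    HasDerivAt (fun z => T * kernel k₁ k₂ (x, y, z)) (kernelDeriv k₁ k₂ T x y t)
      (turning x y t) := by
  have h1 := contDiff_kernel k₁ k₂
  have h2 : ContDiff ℝ ∞ fun z => kernel k₁ k₂ (x, y, z) := by fun_prop
  exact ((h2.differentiable (by simp)).differentiableAt.hasDerivAt).const_mul T

lemma hasDerivAt_regularFactor (k₁ k₂ : ℕ) (T x y t : ℝ) :
    HasDerivAt (regularFactor k₁ k₂ T x y)
      (kernelDeriv k₁ k₂ T x y t * ((y - x) / 2 * Real.sin t)) t :=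
  (hasDerivAt_kernel k₁ k₂ T x y t).comp t (hasDerivAt_turning x y t)

lemma hasDerivAt_weight (k₁ k₂ : ℕ) (u : ℝ) : HasDerivAt (weight k₁ k₂)
    ((1 - u) ^ k₁ * u ^ k₂ * ((k₂ + 1) * (1 - u) - (k₁ + 1) * u)) u := by
  have h1 := (((hasDerivAt_id u).const_sub 1).pow (k₁ + 1)).mul ((hasDerivAt_id u).pow (k₂ + 1))
  refine h1.congr_deriv ?_
  simp; ring

namespace IsRootPair

variable {k₁ k₂ : ℕ} {c T x y : ℝ} (h : IsRootPair k₁ k₂ c T x y)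
include h

lemma mul_regularFactor (t : ℝ) :
    (turning x y t - x) * (y - turning x y t) * regularFactor k₁ k₂ T x y t
      = T * ((1 - turning x y t) ^ k₁ * turning x y t ^ k₂)
        * ((1 - turning x y t) * turning x y t) - turning x y t - c * (1 - turning x y t) := by
  rw [regularFactor, ← polyRadicand_eq_mul_kernel h.lt.ne h.left_zero h.right_zero, polyRadicand,
    weight]
  ring

lemma mul_kernelDeriv (t : ℝ) :
    (x + y - 2 * turning x y t) * regularFactor k₁ k₂ T x y t
      + (turning x y t - x) * (y - turning x y t) * kernelDeriv k₁ k₂ T x y t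
      = T * ((1 - turning x y t) ^ k₁ * turning x y t ^ k₂)
        * ((k₂ + 1) * (1 - turning x y t) - (k₁ + 1) * turning x y t) - 1 + c := by
  set u := turning x y t with hu
  have h1 : HasDerivAt (polyRadicand k₁ k₂ c T)
      (T * ((1 - u) ^ k₁ * u ^ k₂ * ((k₂ + 1) * (1 - u) - (k₁ + 1) * u)) - 1 - c * (-1)) u :=
    (((hasDerivAt_weight k₁ k₂ u).const_mul T).sub (hasDerivAt_id u)).sub
      (((hasDerivAt_id u).const_sub 1).const_mul c)
  have h2 := (((hasDerivAt_id u).sub_const x).mul ((hasDerivAt_id u).const_sub y)).mul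
    (hasDerivAt_kernel k₁ k₂ T x y t)
  have h3 := h1.unique (h2.congr_of_eventuallyEq (Filter.Eventually.of_forall
    (polyRadicand_eq_mul_kernel h.lt.ne h.left_zero h.right_zero)))
  simp only [id, Pi.mul_apply] at h3
  unfold regularFactor
  rw [← hu]
  linear_combination -h3

theorem isMinimalProfile {C : ℝ} (hC : c = C ^ 2) (hT : 0 < T) :
    IsMinimalProfile k₁ k₂ (fun t => (spiral k₁ k₂ C T x y t).1)
      (fun t => (spiral k₁ k₂ C T x y t).2) := by
  set g₁ : ℝ → ℂ := fun t => (spiral k₁ k₂ C T x y t).1 with hg₁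
  set g₂ : ℝ → ℂ := fun t => (spiral k₁ k₂ C T x y t).2 with hg₂
  set u : ℝ → ℝ := turning x y with hu
  set V : ℝ → ℝ := fun t => (y - x) / 2 * Real.sin t with hV
  set Q : ℝ → ℝ := regularFactor k₁ k₂ T x y with hQ
  set K : ℝ → ℝ := kernelDeriv k₁ k₂ T x y with hK
  set W : ℝ → ℝ := fun t => (x + y) / 2 - u t with hW
  have u0 : ∀ t, 0 < u t := h.turning_pos
  have u1 : ∀ t, 0 < 1 - u t := fun t => sub_pos.2 (h.turning_lt_one t)
  have Q0 : ∀ t, 0 < Q t := h.regularFactor_pos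
  have hr0 : ∀ t, 0 < √(Q t) := fun t => Real.sqrt_pos.2 (Q0 t)
  have du : ∀ t, HasDerivAt u (V t) t := hasDerivAt_turning x y
  have dV : ∀ t, HasDerivAt V (W t) t := fun t => by
    refine ((Real.hasDerivAt_sin t).const_mul ((y - x) / 2)).congr_deriv ?_
    simp only [hW, hu, turning]; ring
  have dQ : ∀ t, HasDerivAt Q (K t * V t) t := hasDerivAt_regularFactor k₁ k₂ T x y
  have dr : ∀ t, HasDerivAt (fun t => √(Q t)) (K t * V t / (2 * √(Q t))) t := fun t =>
    (dQ t).sqrt (Q0 t).ne'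
  have hsq : ∀ t, √(Q t) ^ 2 = Q t := fun t => Real.sq_sqrt (Q0 t).le
  set ρ₁ : ℝ → ℝ := fun t => - V t / (2 * (1 - u t)) with hρ₁
  set ρ₂ : ℝ → ℝ := fun t => V t / (2 * u t) with hρ₂
  set σ₁ : ℝ → ℝ := fun t => 1 / (2 * (1 - u t) * √(Q t)) with hσ₁
  set σ₂ : ℝ → ℝ := fun t => C * (1 / (2 * u t * √(Q t))) with hσ₂
  have dm₁ : ∀ t, HasDerivAt (fun t => Real.cos (polarAngle x y t))
      (Real.cos (polarAngle x y t) * ρ₁ t) t := fun t => by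
    simp only [h.cos_polarAngle]
    refine (((du t).const_sub 1).sqrt (u1 t).ne').congr_deriv ?_
    have e := Real.sq_sqrt (u1 t).le
    have e0 := Real.sqrt_pos.2 (u1 t)
    simp only [hρ₁, ← hu]
    have := u1 t
    rw [mul_div_assoc', div_eq_div_iff (by positivity) (by positivity)]
    linear_combination 2 * V t * e
  have dm₂ : ∀ t, HasDerivAt (fun t => Real.sin (polarAngle x y t))
      (Real.sin (polarAngle x y t) * ρ₂ t) t := fun t => by
    simp only [h.sin_polarAngle]
    refine ((du t).sqrt (u0 t).ne').congr_deriv ?_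
    have e := Real.sq_sqrt (u0 t).le
    have e0 := Real.sqrt_pos.2 (u0 t)
    simp only [hρ₂, ← hu]
    have := u0 t
    rw [mul_div_assoc', div_eq_div_iff (by positivity) (by positivity)]
    linear_combination -2 * V t * e
  have ds₁ : ∀ t, HasDerivAt (phase (rate₁ k₁ k₂ T x y)) (σ₁ t) t :=
    hasDerivAt_phase h.contDiff_rate₁.continuous
  have ds₂ : ∀ t, HasDerivAt (phase (fun τ => C * rate₂ k₁ k₂ T x y τ)) (σ₂ t) t :=
    hasDerivAt_phase (h.contDiff_rate₂.continuous.const_mul C)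
  have dg₁ : ∀ t, HasDerivAt g₁ (g₁ t * (ρ₁ t + σ₁ t * Complex.I)) t := fun t =>
    hasDerivAt_polar (dm₁ t) (ds₁ t)
  have dg₂ : ∀ t, HasDerivAt g₂ (g₂ t * (ρ₂ t + σ₂ t * Complex.I)) t := fun t =>
    hasDerivAt_polar (dm₂ t) (ds₂ t)
  have n₁ : ∀ t, ‖g₁ t‖ ^ 2 = 1 - u t := fun t => by
    simp only [hg₁, spiral, norm_mul, Complex.norm_exp_ofReal_mul_I, mul_one, Complex.norm_real,
      Real.norm_eq_abs, sq_abs, h.cos_polarAngle, Real.sq_sqrt (u1 t).le, ← hu]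
  have n₂ : ∀ t, ‖g₂ t‖ ^ 2 = u t := fun t => by
    simp only [hg₂, spiral, norm_mul, Complex.norm_exp_ofReal_mul_I, mul_one, Complex.norm_real,
      Real.norm_eq_abs, sq_abs, h.sin_polarAngle, Real.sq_sqrt (u0 t).le, ← hu]
  have nC : ∀ a b : ℝ, ‖(a : ℂ) + b * Complex.I‖ ^ 2 = a ^ 2 + b ^ 2 := fun a b => by
    rw [← Complex.normSq_eq_norm_sq, Complex.normSq_add_mul_I]
  have F1 : ∀ t, V t ^ 2 = (u t - x) * (y - u t) := turning_sq x y
  have F2 := h.mul_regularFactor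
  have F3 := h.mul_kernelDeriv
  have F2' : ∀ t, V t ^ 2 * √(Q t) ^ 2 = T * ((1 - u t) ^ k₁ * u t ^ k₂) * ((1 - u t) * u t)
      - u t - C ^ 2 * (1 - u t) := fun t => by
    rw [hsq, F1, ← hC]; exact F2 t
  have F3' : ∀ t, 2 * W t * √(Q t) ^ 2 + V t ^ 2 * K t = T * ((1 - u t) ^ k₁ * u t ^ k₂)
      * ((k₂ + 1) * (1 - u t) - (k₁ + 1) * u t) - 1 + C ^ 2 := fun t => by
    rw [hsq, F1, ← hC, ← F3 t]; simp only [hW, ← hu, ← hQ, ← hK]; ring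
  have hE : ∀ t, ‖deriv g₁ t‖ ^ 2 + ‖deriv g₂ t‖ ^ 2
      = T * ((1 - u t) ^ k₁ * u t ^ k₂) / (4 * Q t) := fun t => by
    rw [(dg₁ t).deriv, (dg₂ t).deriv, norm_mul, norm_mul, mul_pow, mul_pow, n₁, n₂, nC, nC]
    rw [← hsq t]
    exact energy_identity (u0 t).ne' (u1 t).ne' (hr0 t).ne' (by ring) (F2' t)
  refine ⟨?_, ?_, fun t h0 => ?_, fun t h0 => ?_, fun t => by rw [n₁, n₂]; ring, fun t => ?_, ?_⟩
  · have h1 := contDiff_phase h.contDiff_rate₁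
    have h2 := h.contDiff_polarAngle
    simp only [hg₁, spiral]
    exact (Complex.ofRealCLM.contDiff.comp (Real.contDiff_cos.comp h2)).mul
      ((Complex.ofRealCLM.contDiff.comp h1).mul contDiff_const).cexp
  · have h1 := contDiff_phase (contDiff_const.mul h.contDiff_rate₂ : ContDiff ℝ ∞
      fun τ => C * rate₂ k₁ k₂ T x y τ)
    have h2 := h.contDiff_polarAngle
    simp only [hg₂, spiral]
    exact (Complex.ofRealCLM.contDiff.comp (Real.contDiff_sin.comp h2)).mul
      ((Complex.ofRealCLM.contDiff.comp h1).mul contDiff_const).cexp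
  · have := n₁ t; rw [h0] at this; simp at this; linarith [u1 t]
  · have := n₂ t; rw [h0] at this; simp at this; linarith [u0 t]
  · rw [hE]
    have := u0 t; have := u1 t; have := Q0 t
    positivity
  · intro t
    have dρ₁ : HasDerivAt ρ₁ (-W t / (2 * (1 - u t)) - V t ^ 2 / (2 * (1 - u t) ^ 2)) t := by
      refine ((dV t).neg.div (((du t).const_sub 1).const_mul 2)
        (mul_pos two_pos (u1 t)).ne').congr_deriv ?_
      have := (u1 t).ne'
      simp only [Pi.neg_apply]
      field_simp
    have dρ₂ : HasDerivAt ρ₂ (W t / (2 * u t) - V t ^ 2 / (2 * u t ^ 2)) t := by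
      refine ((dV t).div ((du t).const_mul 2) (mul_pos two_pos (u0 t)).ne').congr_deriv ?_
      have := (u0 t).ne'
      field_simp
    have dσ₁ : HasDerivAt σ₁ (σ₁ t * (V t / (1 - u t) - K t * V t / (2 * Q t))) t := by
      have a1 := (u1 t).ne'; have a2 := (hr0 t).ne'
      refine ((hasDerivAt_const t (1 : ℝ)).div ((((du t).const_sub 1).const_mul 2).mul (dr t))
        (mul_pos (mul_pos two_pos (u1 t)) (hr0 t)).ne').congr_deriv ?_
      simp only [hσ₁, Pi.mul_apply]
      rw [show K t * V t / (2 * Q t) = K t * V t / (2 * √(Q t) ^ 2) by rw [hsq]]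
      field_simp; ring
    have dσ₂ : HasDerivAt σ₂ (σ₂ t * (- V t / u t - K t * V t / (2 * Q t))) t := by
      have a1 := (u0 t).ne'; have a2 := (hr0 t).ne'
      refine (((hasDerivAt_const t (1 : ℝ)).div (((du t).const_mul 2).mul (dr t))
        (mul_pos (mul_pos two_pos (u0 t)) (hr0 t)).ne').const_mul C).congr_deriv ?_
      simp only [hσ₂, Pi.mul_apply]
      rw [show K t * V t / (2 * Q t) = K t * V t / (2 * √(Q t) ^ 2) by rw [hsq]]
      field_simp; ring
    set E := ‖deriv g₁ t‖ ^ 2 + ‖deriv g₂ t‖ ^ 2 with hEdef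
    set b : ℝ := - (K t * V t) / (2 * Q t) with hb
    set a : ℝ := ρ₁ t ^ 2 - σ₁ t ^ 2 + (-W t / (2 * (1 - u t)) - V t ^ 2 / (2 * (1 - u t) ^ 2))
      - k₁ * E / (1 - u t) - b * ρ₁ t with ha
    have key : a = ρ₂ t ^ 2 - σ₂ t ^ 2 + (W t / (2 * u t) - V t ^ 2 / (2 * u t ^ 2))
      - k₂ * E / u t - b * ρ₂ t := by
      rw [ha, hb, hEdef, hE t, ← hsq t]
      exact curvature_identity (u0 t).ne' (u1 t).ne' (hr0 t).ne' (by ring) (F2' t) (F3' t)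
    have im₁ : 2 * ρ₁ t * σ₁ t + σ₁ t * (V t / (1 - u t) - K t * V t / (2 * Q t)) = b * σ₁ t := by
      simp only [hρ₁, hb]
      have a1 := (u1 t).ne'; have a2 := (Q0 t).ne'
      field_simp; ring
    have im₂ : 2 * ρ₂ t * σ₂ t + σ₂ t * (-V t / u t - K t * V t / (2 * Q t)) = b * σ₂ t := by
      simp only [hρ₂, hb]
      have a1 := (u0 t).ne'; have a2 := (Q0 t).ne'
      field_simp; ring
    refine ⟨a, b, ?_, ?_⟩
    · rw [hasDerivAt_deriv_polar dg₁ dρ₁ dσ₁, (dg₁ t).deriv, n₁]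
      have re₁ := congrArg (Complex.ofReal) ha
      have im₁' := congrArg (Complex.ofReal) im₁
      push_cast at re₁ im₁' ⊢
      linear_combination g₁ t * (-re₁ + Complex.I * im₁' + σ₁ t ^ 2 * Complex.I_sq)
    · rw [hasDerivAt_deriv_polar dg₂ dρ₂ dσ₂, (dg₂ t).deriv, n₂]
      have re₁ := congrArg (Complex.ofReal) key
      have im₁' := congrArg (Complex.ofReal) im₂
      push_cast at re₁ im₁' ⊢
      linear_combination g₂ t * (-re₁ + Complex.I * im₁' + σ₂ t ^ 2 * Complex.I_sq)

end IsRootPair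

/-! ### Global properties of the solution curve -/

lemma not_hasConstantArgument {m s : ℝ → ℝ} (hm : ∀ t, 0 < m t) {σ : ℝ} (hσ : σ ≠ 0)
    (hs : HasDerivAt s σ 0) :
    ¬ HasConstantArgument fun t => (m t : ℂ) * Complex.exp (s t * Complex.I) := by
  rintro ⟨φ, hφ⟩
  have h1 : ∀ t, Complex.exp (s t * Complex.I) = Complex.exp (φ * Complex.I) := fun t => by
    have h2 := hφ t
    simp only [norm_mul, Complex.norm_exp_ofReal_mul_I, mul_one, Complex.norm_real,
      Real.norm_eq_abs, abs_of_pos (hm t)] at h2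
    exact mul_left_cancel₀ (Complex.ofReal_ne_zero.2 (hm t).ne') h2
  have h3 := ((hs.ofReal_comp.mul_const Complex.I).cexp).deriv
  rw [show (fun t : ℝ => Complex.exp (s t * Complex.I)) = fun _ => Complex.exp (φ * Complex.I)
    from funext h1, deriv_const] at h3
  simp [hσ] at h3

namespace IsMinimalProfile

variable {k₁ k₂ : ℕ} {γ : ℝ → ℂ × ℂ}
  (h : IsMinimalProfile k₁ k₂ (fun t => (γ t).1) (fun t => (γ t).2))
include h

lemma isImmersedCurve : IsImmersedCurve γ := by
  have hγ : ContDiff ℝ ∞ γ := h.contDiff₁.prodMk h.contDiff₂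
  refine ⟨hγ, fun t h0 => ?_, h.norm_sq_add⟩
  have hd := (hγ.differentiable (by simp)).differentiableAt (x := t) |>.hasDerivAt
  have h1 : HasDerivAt (fun t => (γ t).1) (deriv γ t).1 t :=
    (ContinuousLinearMap.fst ℝ ℂ ℂ).hasFDerivAt.comp_hasDerivAt t hd
  have h2 : HasDerivAt (fun t => (γ t).2) (deriv γ t).2 t :=
    (ContinuousLinearMap.snd ℝ ℂ ℂ).hasFDerivAt.comp_hasDerivAt t hd
  have := h.speed_pos t
  rw [h1.deriv, h2.deriv, h0] at this
  simp at this

end IsMinimalProfile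

lemma phase_two_pi {f : ℝ → ℝ} (hf : Continuous f) (he : ∀ t, f (2 * Real.pi - t) = f t) :
    phase f (2 * Real.pi) = 2 * phase f Real.pi := by
  have := phase_reflect hf he 0
  simpa [phase] using this

lemma phase_nat_mul {f : ℝ → ℝ} (hf : Continuous f) {p : ℝ} (hp : ∀ t, f (t + p) = f t) (n : ℕ) :
    phase f (n * p) = n * phase f p := by
  induction n with
  | zero => simp [phase]
  | succ n ih =>
    push_cast
    rw [add_mul, one_mul, phase_add hf hp, ih]; ring

namespace IsRootPair

variable {k₁ k₂ : ℕ} {c T x y : ℝ} (h : IsRootPair k₁ k₂ c T x y)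
include h

lemma isSolutionCurve {C : ℝ} (hC : c = C ^ 2) :
    IsSolutionCurve k₁ k₂ C T (spiral k₁ k₂ C T x y) := by
  have c₁ := h.contDiff_rate₁
  have c₂ : ContDiff ℝ ∞ fun τ => C * rate₂ k₁ k₂ T x y τ := contDiff_const.mul h.contDiff_rate₂
  have hsymm : ∀ e ∈ ({0, Real.pi} : Set ℝ), ∀ t, turning x y (2 * e - t) = turning x y t := by
    rintro e (rfl | rfl) t
    · simp [turning]
    · simp [turning, Real.cos_two_pi_sub]
  refine ⟨polarAngle x y, phase (rate₁ k₁ k₂ T x y), phase fun τ => C * rate₂ k₁ k₂ T x y τ,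
    h.contDiff_polarAngle, contDiff_phase c₁, contDiff_phase c₂, fun t => rfl, 0, Real.pi,
    Real.pi_pos, h.polarAngle_image hC, fun t ht => ⟨h.deriv_polarAngle_pos ht, ?_, ?_⟩,
    fun e he t => ⟨?_, ?_, ?_⟩⟩
  · rw [h.integrand₁_polarAngle hC ht, (hasDerivAt_phase c₁.continuous t).deriv]
  · rw [mul_assoc, h.integrand₂_polarAngle hC ht, (hasDerivAt_phase c₂.continuous t).deriv]
  · simp only [polarAngle, hsymm e he]
  · exact phase_reflect c₁.continuous (fun t => by simp only [rate₁, regularFactor, hsymm e he]) t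
  · exact phase_reflect c₂.continuous (fun t => by simp only [rate₂, regularFactor, hsymm e he]) t

lemma isDoublySpiral {C : ℝ} (hC : C ≠ 0) : IsDoublySpiral (spiral k₁ k₂ C T x y) := by
  have c₂ : ContDiff ℝ ∞ fun τ => C * rate₂ k₁ k₂ T x y τ := contDiff_const.mul h.contDiff_rate₂
  refine ⟨not_hasConstantArgument (fun t => ?_) (h.rate₁_pos 0).ne'
    (hasDerivAt_phase h.contDiff_rate₁.continuous 0), not_hasConstantArgument (fun t => ?_)
    (mul_ne_zero hC (h.rate₂_pos 0).ne') (hasDerivAt_phase c₂.continuous 0)⟩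
  · rw [h.cos_polarAngle]; exact Real.sqrt_pos.2 (sub_pos.2 (h.turning_lt_one t))
  · rw [h.sin_polarAngle]; exact Real.sqrt_pos.2 (h.turning_pos t)

lemma not_hasSteadyMagnitudes (C : ℝ) : ¬ HasSteadyMagnitudes (spiral k₁ k₂ C T x y) := by
  rintro ⟨-, h2⟩
  have h3 : ∀ t, ‖(spiral k₁ k₂ C T x y t).2‖ = √(turning x y t) := fun t => by
    simp only [spiral, norm_mul, Complex.norm_exp_ofReal_mul_I, mul_one, Complex.norm_real,
      Real.norm_eq_abs, h.sin_polarAngle, abs_of_nonneg (Real.sqrt_nonneg _)]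
  have h4 := h2 0 Real.pi
  rw [h3, h3, Real.sqrt_inj (h.turning_pos _).le (h.turning_pos _).le] at h4
  simp [turning] at h4
  linarith [h.lt]

lemma spiral_add (C t p : ℝ) (hp : ∃ n : ℤ, p = n * (2 * Real.pi))
    (h₁ : ∃ n : ℤ, phase (rate₁ k₁ k₂ T x y) p = n * (2 * Real.pi))
    (h₂ : ∃ n : ℤ, phase (fun τ => C * rate₂ k₁ k₂ T x y τ) p = n * (2 * Real.pi)) :
    spiral k₁ k₂ C T x y (t + p) = spiral k₁ k₂ C T x y t := by
  obtain ⟨n, rfl⟩ := hp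
  have hu : ∀ t, turning x y (t + n * (2 * Real.pi)) = turning x y t := fun t => by
    simp only [turning, Real.cos_add_int_mul_two_pi]
  have c₁ := h.contDiff_rate₁
  have c₂ : ContDiff ℝ ∞ fun τ => C * rate₂ k₁ k₂ T x y τ := contDiff_const.mul h.contDiff_rate₂
  have e₁ := phase_add c₁.continuous (p := n * (2 * Real.pi))
    (fun t => by simp only [rate₁, regularFactor, hu]) t
  have e₂ := phase_add c₂.continuous (p := n * (2 * Real.pi))
    (fun t => by simp only [rate₂, regularFactor, hu]) t
  have hexp : ∀ (a : ℝ) (n : ℤ), Complex.exp ((a + n * (2 * Real.pi) : ℝ) * Complex.I)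
      = Complex.exp (a * Complex.I) := fun a n => by
    rw [Complex.exp_eq_exp_iff_exists_int]
    exact ⟨n, by push_cast; ring⟩
  obtain ⟨n₁, h₁⟩ := h₁
  obtain ⟨n₂, h₂⟩ := h₂
  simp only [spiral, polarAngle, hu, e₁, e₂, h₁, h₂, hexp]

/-- If the two period integrals are rational multiples of `π` then the curve is periodic. -/
theorem exists_period {C : ℝ} (hC : c = C ^ 2) (h₁ : J₁ k₁ k₂ C T ∈ piRat)
    (h₂ : C * J₂ k₁ k₂ C T ∈ piRat) :
    ∃ p > 0, ∀ t, spiral k₁ k₂ C T x y (t + p) = spiral k₁ k₂ C T x y t := by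
  obtain ⟨q₁, h₁⟩ := h₁
  obtain ⟨q₂, h₂⟩ := h₂
  have c₁ := h.contDiff_rate₁
  have c₂ : ContDiff ℝ ∞ fun τ => C * rate₂ k₁ k₂ T x y τ := contDiff_const.mul h.contDiff_rate₂
  have hsymm : ∀ t, turning x y (2 * Real.pi - t) = turning x y t := fun t => by
    simp [turning, Real.cos_two_pi_sub]
  have hper := turning_add_two_pi x y
  rw [(h.integral₁ hC).2] at h₁
  rw [(h.integral₂ hC).2] at h₂
  have h₂' : phase (fun τ => C * rate₂ k₁ k₂ T x y τ) Real.pi = Real.pi * q₂ := by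
    rw [← h₂, phase, phase, intervalIntegral.integral_const_mul]
  refine ⟨((q₁.den * q₂.den : ℕ) : ℝ) * (2 * Real.pi), ?_, fun t => h.spiral_add C t _
    ⟨(q₁.den * q₂.den : ℕ), by simp⟩ ⟨q₁.num * q₂.den, ?_⟩ ⟨q₂.num * q₁.den, ?_⟩⟩
  · have := q₁.pos; have := q₂.pos; have := Real.pi_pos
    positivity
  · rw [phase_nat_mul c₁.continuous (fun t => by simp only [rate₁, regularFactor, hper]),
      phase_two_pi c₁.continuous (fun t => by simp only [rate₁, regularFactor, hsymm]), h₁]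
    have : (q₁ : ℝ) * q₁.den = q₁.num := by exact_mod_cast Rat.mul_den_eq_num q₁
    push_cast
    linear_combination 2 * Real.pi * q₂.den * this
  · rw [phase_nat_mul c₂.continuous (fun t => by simp only [rate₂, regularFactor, hper]),
      phase_two_pi c₂.continuous (fun t => by simp only [rate₂, regularFactor, hsymm]), h₂']
    have : (q₂ : ℝ) * q₂.den = q₂.num := by exact_mod_cast Rat.mul_den_eq_num q₂
    push_cast
    linear_combination 2 * Real.pi * q₁.den * this

end IsRootPair

/-! ### Continuity of the period integrals -/

/-- The data `(x, y, T)` for which the rates are regular. -/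
def regularSet (k₁ k₂ : ℕ) : Set (ℝ × ℝ × ℝ) :=
  {z | ∀ t, 0 < 1 - turning z.1 z.2.1 t ∧ 0 < turning z.1 z.2.1 t ∧
    0 < regularFactor k₁ k₂ z.2.2 z.1 z.2.1 t}

lemma continuous_turning_uncurry : Continuous fun p : (ℝ × ℝ × ℝ) × ℝ =>
    turning p.1.1 p.1.2.1 p.2 := by
  unfold turning; fun_prop

lemma continuous_regularFactor_uncurry (k₁ k₂ : ℕ) : Continuous fun p : (ℝ × ℝ × ℝ) × ℝ =>
    regularFactor k₁ k₂ p.1.2.2 p.1.1 p.1.2.1 p.2 := by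
  have h1 := (contDiff_kernel k₁ k₂).continuous
  have h2 := continuous_turning_uncurry
  unfold regularFactor; fun_prop

lemma continuousOn_integral_of_subtype {X : Type*} [TopologicalSpace X] {s : Set X}
    {f : X → ℝ → ℝ} (a b : ℝ) (hf : Continuous fun p : s × ℝ => f p.1 p.2) :
    ContinuousOn (fun z => ∫ t in a..b, f z t) s := by
  rw [continuousOn_iff_continuous_domRestrict]
  exact intervalIntegral.continuous_parametric_intervalIntegral_of_continuous' (f := fun z : s => f z) hf a b

lemma continuousOn_integral_rate₁ (k₁ k₂ : ℕ) : ContinuousOn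
    (fun z : ℝ × ℝ × ℝ => phase (rate₁ k₁ k₂ z.2.2 z.1 z.2.1) Real.pi) (regularSet k₁ k₂) := by
  refine continuousOn_integral_of_subtype (f := fun z : ℝ × ℝ × ℝ => rate₁ k₁ k₂ z.2.2 z.1 z.2.1)
    0 Real.pi ?_
  have e : Continuous fun p : regularSet k₁ k₂ × ℝ => ((p.1 : ℝ × ℝ × ℝ), p.2) := by fun_prop
  have h1 := continuous_turning_uncurry.comp e
  have h2 := ((continuous_regularFactor_uncurry k₁ k₂).comp e).sqrt
  refine Continuous.div continuous_const ((continuous_const.mul (continuous_const.sub h1)).mul h2)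
    fun p => ?_
  obtain ⟨a1, a2, a3⟩ := p.1.2 p.2
  exact (mul_pos (mul_pos two_pos a1) (Real.sqrt_pos.2 a3)).ne'

lemma continuousOn_integral_rate₂ (k₁ k₂ : ℕ) : ContinuousOn
    (fun z : ℝ × ℝ × ℝ => phase (rate₂ k₁ k₂ z.2.2 z.1 z.2.1) Real.pi) (regularSet k₁ k₂) := by
  refine continuousOn_integral_of_subtype (f := fun z : ℝ × ℝ × ℝ => rate₂ k₁ k₂ z.2.2 z.1 z.2.1)
    0 Real.pi ?_
  have e : Continuous fun p : regularSet k₁ k₂ × ℝ => ((p.1 : ℝ × ℝ × ℝ), p.2) := by fun_prop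
  have h1 := continuous_turning_uncurry.comp e
  have h2 := ((continuous_regularFactor_uncurry k₁ k₂).comp e).sqrt
  refine Continuous.div continuous_const ((continuous_const.mul h1).mul h2)
    fun p => ?_
  obtain ⟨a1, a2, a3⟩ := p.1.2 p.2
  exact (mul_pos (mul_pos two_pos a2) (Real.sqrt_pos.2 a3)).ne'

/-- The parameters `(c, T)` of the nonempty basic domains. -/
def admissible (k₁ k₂ : ℕ) : Set (ℝ × ℝ) :=
  {p | IsConfining k₂ p.1 ∧ ∃ u ∈ Set.Ioo (0 : ℝ) 1, 0 < polyRadicand k₁ k₂ p.1 p.2 u}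

/-- The end points of the basic domain in the variable `u`. -/
def roots (k₁ k₂ : ℕ) (p : ℝ × ℝ) : ℝ × ℝ :=
  Classical.epsilon fun z => IsRootPair k₁ k₂ p.1 p.2 z.1 z.2

lemma isRootPair_roots {k₁ k₂ : ℕ} {p : ℝ × ℝ} (hp : p ∈ admissible k₁ k₂) :
    IsRootPair k₁ k₂ p.1 p.2 (roots k₁ k₂ p).1 (roots k₁ k₂ p).2 := by
  obtain ⟨h, u, hu, hpos⟩ := hp
  obtain ⟨x, y, hxy, -⟩ := exists_isRootPair h hu hpos
  exact Classical.epsilon_spec (p := fun z : ℝ × ℝ => IsRootPair k₁ k₂ p.1 p.2 z.1 z.2)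
    ⟨(x, y), hxy⟩

lemma IsRootPair.left_bounds {k₁ k₂ : ℕ} {c T x y a w : ℝ} (h : IsRootPair k₁ k₂ c T x y)
    (ha : 0 < a) (haw : a < w) (hw : w < 1) (hna : polyRadicand k₁ k₂ c T a < 0)
    (hpw : 0 < polyRadicand k₁ k₂ c T w) : a ≤ x ∧ x < w := by
  have h1 := (h.pos_iff w ⟨ha.trans haw, hw⟩).1 hpw
  refine ⟨not_lt.1 fun h2 => ?_, h1.1⟩
  exact hna.not_gt ((h.pos_iff a ⟨ha, haw.trans hw⟩).2 ⟨h2, haw.trans h1.2⟩)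

lemma IsRootPair.right_bounds {k₁ k₂ : ℕ} {c T x y b w : ℝ} (h : IsRootPair k₁ k₂ c T x y)
    (hw : 0 < w) (hwb : w < b) (hb : b < 1) (hnb : polyRadicand k₁ k₂ c T b < 0)
    (hpw : 0 < polyRadicand k₁ k₂ c T w) : w < y ∧ y ≤ b := by
  have h1 := (h.pos_iff w ⟨hw, hwb.trans hb⟩).1 hpw
  refine ⟨h1.2, not_lt.1 fun h2 => ?_⟩
  exact hnb.not_gt ((h.pos_iff b ⟨hw.trans hwb, hb⟩).2 ⟨h1.1.trans hwb, h2⟩)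

lemma continuous_polyRadicand_param (k₁ k₂ : ℕ) (u : ℝ) :
    Continuous fun p : ℝ × ℝ => polyRadicand k₁ k₂ p.1 p.2 u :=
  (continuous_polyRadicand k₁ k₂).comp (by fun_prop : Continuous fun p : ℝ × ℝ => (p.1, p.2, u))

lemma continuousOn_roots (k₁ k₂ : ℕ) : ContinuousOn (roots k₁ k₂) (admissible k₁ k₂) := by
  intro p hp
  have h := isRootPair_roots hp
  set x := (roots k₁ k₂ p).1 with hx
  set y := (roots k₁ k₂ p).2 with hy
  have hadm : ∀ᶠ q in nhdsWithin p (admissible k₁ k₂), q ∈ admissible k₁ k₂ :=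
    eventually_mem_nhdsWithin
  have hpos : ∀ u ∈ Set.Ioo x y, ∀ᶠ q in nhdsWithin p (admissible k₁ k₂),
      0 < polyRadicand k₁ k₂ q.1 q.2 u := fun u hu =>
    ((continuous_polyRadicand_param k₁ k₂ u).tendsto p).eventually_const_lt
      ((h.pos_iff u ⟨h.left_pos.trans hu.1, hu.2.trans h.right_lt⟩).2 hu) |>.filter_mono
      nhdsWithin_le_nhds
  have hneg : ∀ u ∈ Set.Ioo (0 : ℝ) 1, u ∉ Set.Icc x y →
      ∀ᶠ q in nhdsWithin p (admissible k₁ k₂), polyRadicand k₁ k₂ q.1 q.2 u < 0 := fun u hu hn =>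
    ((continuous_polyRadicand_param k₁ k₂ u).tendsto p).eventually_lt_const
      (h.neg_of_notMem u hu hn) |>.filter_mono nhdsWithin_le_nhds
  have key₁ : Filter.Tendsto (fun q => (roots k₁ k₂ q).1) (nhdsWithin p (admissible k₁ k₂))
      (nhds x) := by
    refine tendsto_order.2 ⟨fun a ha => ?_, fun b hb => ?_⟩
    · obtain ⟨a', ha', ha''⟩ := exists_between (max_lt ha h.left_pos)
      obtain ⟨w, hw, hw'⟩ := exists_between h.lt
      filter_upwards [hadm, hpos w ⟨hw, hw'⟩, hneg a' ⟨(le_max_right _ _).trans_lt ha',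
        (ha''.trans h.lt).trans h.right_lt⟩ fun h0 => h0.1.not_gt ha''] with q hq h1 h2
      exact ((le_max_left _ _).trans_lt ha').trans_le ((isRootPair_roots hq).left_bounds
        ((le_max_right _ _).trans_lt ha') (ha''.trans hw) (hw'.trans h.right_lt) h2 h1).1
    · obtain ⟨w, hw, hw'⟩ := exists_between (lt_min hb h.lt)
      have hw1 := hw'.trans_le (min_le_right _ _)
      filter_upwards [hadm, hpos w ⟨hw, hw1⟩] with q hq h1
      exact (((isRootPair_roots hq).pos_iff w ⟨h.left_pos.trans hw, hw1.trans h.right_lt⟩).1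
        h1).1.trans (hw'.trans_le (min_le_left _ _))
  have key₂ : Filter.Tendsto (fun q => (roots k₁ k₂ q).2) (nhdsWithin p (admissible k₁ k₂))
      (nhds y) := by
    refine tendsto_order.2 ⟨fun a ha => ?_, fun b hb => ?_⟩
    · obtain ⟨w, hw, hw'⟩ := exists_between (max_lt ha h.lt)
      have hw1 := (le_max_right _ _).trans_lt hw
      filter_upwards [hadm, hpos w ⟨hw1, hw'⟩] with q hq h1
      exact ((le_max_left _ _).trans_lt hw).trans (((isRootPair_roots hq).pos_iff w
        ⟨h.left_pos.trans hw1, hw'.trans h.right_lt⟩).1 h1).2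
    · obtain ⟨b', hb', hb''⟩ := exists_between (lt_min hb h.right_lt)
      obtain ⟨w, hw, hw'⟩ := exists_between h.lt
      have hb1 := hb''.trans_le (min_le_right _ _)
      filter_upwards [hadm, hpos w ⟨hw, hw'⟩, hneg b' ⟨(h.left_pos.trans h.lt).trans hb', hb1⟩
        fun h0 => h0.2.not_gt hb'] with q hq h1 h2
      exact ((isRootPair_roots hq).right_bounds (h.left_pos.trans hw) (hw'.trans hb') hb1 h2
        h1).2.trans_lt (hb''.trans_le (min_le_left _ _))
  exact key₁.prodMk_nhds key₂

/-- `J₁` as a function of `c = C²` and `T = C̃`. -/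
def period₁ (k₁ k₂ : ℕ) (p : ℝ × ℝ) : ℝ :=
  phase (rate₁ k₁ k₂ p.2 (roots k₁ k₂ p).1 (roots k₁ k₂ p).2) Real.pi

/-- `C J₂` as a function of `c = C²` and `T = C̃`, for `C ≥ 0`. -/
def period₂ (k₁ k₂ : ℕ) (p : ℝ × ℝ) : ℝ :=
  √p.1 * phase (rate₂ k₁ k₂ p.2 (roots k₁ k₂ p).1 (roots k₁ k₂ p).2) Real.pi

lemma roots_mapsTo (k₁ k₂ : ℕ) : Set.MapsTo
    (fun p : ℝ × ℝ => ((roots k₁ k₂ p).1, (roots k₁ k₂ p).2, p.2)) (admissible k₁ k₂)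
    (regularSet k₁ k₂) := fun _ hp t =>
  have h := isRootPair_roots hp
  ⟨sub_pos.2 (h.turning_lt_one t), h.turning_pos t, h.regularFactor_pos t⟩

lemma continuousOn_roots_prod (k₁ k₂ : ℕ) : ContinuousOn
    (fun p : ℝ × ℝ => ((roots k₁ k₂ p).1, (roots k₁ k₂ p).2, p.2)) (admissible k₁ k₂) := by
  have := continuousOn_roots k₁ k₂
  fun_prop

lemma continuousOn_period₁ (k₁ k₂ : ℕ) : ContinuousOn (period₁ k₁ k₂) (admissible k₁ k₂) := by
  have h := (continuousOn_integral_rate₁ k₁ k₂).comp (continuousOn_roots_prod k₁ k₂)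
    (roots_mapsTo k₁ k₂)
  simp only [Function.comp_def] at h
  exact h

lemma continuousOn_period₂ (k₁ k₂ : ℕ) : ContinuousOn (period₂ k₁ k₂) (admissible k₁ k₂) := by
  have h := (continuousOn_integral_rate₂ k₁ k₂).comp (continuousOn_roots_prod k₁ k₂)
    (roots_mapsTo k₁ k₂)
  simp only [Function.comp_def] at h
  exact (continuous_fst.sqrt.continuousOn).mul h

lemma phase_pos {f : ℝ → ℝ} (hf : Continuous f) (hpos : ∀ t, 0 < f t) {a : ℝ} (ha : 0 < a) :
    0 < phase f a :=
  intervalIntegral.intervalIntegral_pos_of_pos (hf.intervalIntegrable _ _) hpos ha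

lemma period₂_pos {k₁ k₂ : ℕ} {p : ℝ × ℝ} (hp : p ∈ admissible k₁ k₂) (h : 0 < p.1) :
    0 < period₂ k₁ k₂ p :=
  mul_pos (Real.sqrt_pos.2 h) (phase_pos (isRootPair_roots hp).contDiff_rate₂.continuous
    (isRootPair_roots hp).rate₂_pos Real.pi_pos)

/-! ### The degenerate limit -/

/-- The bottom of the potential for `c = 0`. -/
def bottom (k₁ k₂ : ℕ) : ℝ := k₂ / (k₁ + 1 + k₂)

lemma bottom_mem {k₁ k₂ : ℕ} (hk : 1 ≤ k₂) : bottom k₁ k₂ ∈ Set.Ioo (0 : ℝ) 1 := by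
  have : (1 : ℝ) ≤ k₂ := by exact_mod_cast hk
  have : (0 : ℝ) ≤ k₁ := Nat.cast_nonneg _
  unfold bottom
  exact ⟨by positivity, by rw [div_lt_one (by positivity)]; linarith⟩

lemma potential_bottom_lt {k₁ k₂ : ℕ} (hk : 1 ≤ k₂) {u : ℝ} (hu : u ∈ Set.Ioo (0 : ℝ) 1)
    (hne : u ≠ bottom k₁ k₂) : potential k₁ k₂ 0 (bottom k₁ k₂) < potential k₁ k₂ 0 u := by
  have hb := bottom_mem (k₁ := k₁) hk
  have hk' : (1 : ℝ) ≤ k₂ := by exact_mod_cast hk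
  have hk1 : (0 : ℝ) ≤ k₁ := Nat.cast_nonneg _
  set w := bottom k₁ k₂ with hw
  have hwdef : w = k₂ / (k₁ + 1 + k₂) := rfl
  have hw1 : 1 - w = (k₁ + 1) / (k₁ + 1 + k₂) := by rw [hwdef]; field_simp; ring
  simp only [potential, zero_mul, add_zero, invWeight]
  rw [Real.exp_lt_exp]
  have a1 := Real.log_lt_sub_one_of_pos (div_pos hu.1 hb.1) (by
    rw [Ne, div_eq_one_iff_eq hb.1.ne']; exact hne)
  have a2 := Real.log_le_sub_one_of_pos (div_pos (sub_pos.2 hu.2) (sub_pos.2 hb.2))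
  rw [Real.log_div hu.1.ne' hb.1.ne'] at a1
  rw [Real.log_div (sub_pos.2 hu.2).ne' (sub_pos.2 hb.2).ne'] at a2
  have b1 := mul_lt_mul_of_pos_left a1 (by linarith : (0 : ℝ) < k₂)
  have b2 := mul_le_mul_of_nonneg_left a2 (by linarith : (0 : ℝ) ≤ k₁ + 1)
  have e1 : (k₂ : ℝ) * (u / w) = (k₁ + 1 + k₂) * u := by rw [hwdef]; field_simp
  have e2 : ((k₁ : ℝ) + 1) * ((1 - u) / (1 - w)) = (k₁ + 1 + k₂) * (1 - u) := by
    rw [hw1]; field_simp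
  push_cast
  nlinarith

/-- The least admissible `T` for `c = 0`. -/
def leastT (k₁ k₂ : ℕ) : ℝ := potential k₁ k₂ 0 (bottom k₁ k₂)

lemma mem_admissible_of_leastT_lt {k₁ k₂ : ℕ} (hk : 1 ≤ k₂) {T : ℝ} (hT : leastT k₁ k₂ < T) :
    ((0 : ℝ), T) ∈ admissible k₁ k₂ :=
  ⟨Or.inr ⟨le_rfl, hk⟩, bottom k₁ k₂, bottom_mem hk, (polyRadicand_pos_iff (bottom_mem hk)).2 hT⟩

lemma tendsto_roots_leastT {k₁ k₂ : ℕ} (hk : 1 ≤ k₂) :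
    Filter.Tendsto (fun T => roots k₁ k₂ (0, T)) (nhdsWithin (leastT k₁ k₂) (Set.Ioi (leastT k₁ k₂)))
      (nhds (bottom k₁ k₂, bottom k₁ k₂)) := by
  have hb := bottom_mem (k₁ := k₁) hk
  set w := bottom k₁ k₂ with hw
  have hmem : ∀ᶠ T in nhdsWithin (leastT k₁ k₂) (Set.Ioi (leastT k₁ k₂)), leastT k₁ k₂ < T :=
    eventually_mem_nhdsWithin
  have hneg : ∀ u ∈ Set.Ioo (0 : ℝ) 1, u ≠ w →
      ∀ᶠ T in nhdsWithin (leastT k₁ k₂) (Set.Ioi (leastT k₁ k₂)),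
        polyRadicand k₁ k₂ 0 T u < 0 := fun u hu hne => by
    have : ∀ᶠ T in nhds (leastT k₁ k₂), T < potential k₁ k₂ 0 u :=
      eventually_lt_nhds (potential_bottom_lt hk hu hne)
    filter_upwards [this.filter_mono nhdsWithin_le_nhds] with T hT
    rw [polyRadicand_eq_weight_mul _ _ hu]
    exact mul_neg_of_pos_of_neg (weight_pos hu) (sub_neg.2 hT)
  refine Filter.Tendsto.prodMk_nhds (tendsto_order.2 ⟨fun a ha => ?_, fun b hb' => ?_⟩)
    (tendsto_order.2 ⟨fun a ha => ?_, fun b hb' => ?_⟩)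
  · obtain ⟨a', ha', ha''⟩ := exists_between (max_lt ha hb.1)
    have h0 := (le_max_right _ _).trans_lt ha'
    filter_upwards [hmem, hneg a' ⟨h0, ha''.trans hb.2⟩ ha''.ne] with T hT h1
    exact ((le_max_left _ _).trans_lt ha').trans_le
      ((isRootPair_roots (mem_admissible_of_leastT_lt hk hT)).left_bounds h0 ha'' hb.2 h1
        ((polyRadicand_pos_iff hb).2 hT)).1
  · filter_upwards [hmem] with T hT
    exact (((isRootPair_roots (mem_admissible_of_leastT_lt hk hT)).pos_iff w hb).1
      ((polyRadicand_pos_iff hb).2 hT)).1.trans hb'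
  · filter_upwards [hmem] with T hT
    exact ha.trans (((isRootPair_roots (mem_admissible_of_leastT_lt hk hT)).pos_iff w hb).1
      ((polyRadicand_pos_iff hb).2 hT)).2
  · obtain ⟨b', hb1, hb2⟩ := exists_between (lt_min hb' hb.2)
    have h0 := hb2.trans_le (min_le_right _ _)
    filter_upwards [hmem, hneg b' ⟨hb.1.trans hb1, h0⟩ hb1.ne'] with T hT h1
    exact ((isRootPair_roots (mem_admissible_of_leastT_lt hk hT)).right_bounds hb.1 hb1 h0 h1
        ((polyRadicand_pos_iff hb).2 hT)).2.trans_lt (hb2.trans_le (min_le_left _ _))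

lemma leastT_mul_kernel {k₁ k₂ : ℕ} (hk : 1 ≤ k₂) :
    leastT k₁ k₂ * kernel k₁ k₂ (bottom k₁ k₂, bottom k₁ k₂, bottom k₁ k₂)
      = (k₁ + 1 + k₂) ^ 2 / (2 * (k₁ + 1)) := by
  have hb := bottom_mem (k₁ := k₁) hk
  have hk' : (1 : ℝ) ≤ k₂ := by exact_mod_cast hk
  have hk1 : (0 : ℝ) ≤ k₁ := Nat.cast_nonneg _
  have h1 := two_mul_kernel_diagonal k₁ k₂ (bottom k₁ k₂)
  have h2 := polyRadicand_eq_weight_mul (k₁ := k₁) (k₂ := k₂) 0 (leastT k₁ k₂) hb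
  rw [leastT, sub_self, mul_zero, polyRadicand, ← leastT, zero_mul, sub_zero] at h2
  set w := bottom k₁ k₂ with hw
  have hwdef : w = k₂ / (k₁ + 1 + k₂) := rfl
  have hw1 : 1 - w = (k₁ + 1) / (k₁ + 1 + k₂) := by rw [hwdef]; field_simp; ring
  set L := leastT k₁ k₂
  set κ := kernel k₁ k₂ (w, w, w)
  have p1 : (k₁ : ℝ) * (1 - w) ^ (k₁ - 1) * (1 - w) = k₁ * (1 - w) ^ k₁ := by
    rcases k₁ with _ | n
    · simp
    · simp only [Nat.add_sub_cancel]; ring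
  have p2 : (k₂ : ℝ) * w ^ (k₂ - 1) * w = k₂ * w ^ k₂ := by
    obtain ⟨n, rfl⟩ : ∃ n, k₂ = n + 1 := ⟨k₂ - 1, by omega⟩
    simp only [Nat.add_sub_cancel]; ring
  have h3 : 2 * κ * (w ^ 2 * (1 - w) ^ 2) = - (((k₁ + 1) * k₁ * w ^ 2
      - 2 * ((k₁ + 1) * (k₂ + 1) * (w * (1 - w))) + (k₂ + 1) * k₂ * (1 - w) ^ 2)
      * weight k₁ k₂ w) := by
    rw [h1, weight]
    linear_combination (-(k₁ + 1) * w ^ (k₂ + 1) * w ^ 2 * (1 - w)) * p1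
      - ((k₂ + 1) * (1 - w) ^ (k₁ + 1) * (1 - w) ^ 2 * w) * p2
  have h4 : 2 * (L * κ) * (w ^ 2 * (1 - w) ^ 2) = - (((k₁ + 1) * k₁ * w ^ 2
      - 2 * ((k₁ + 1) * (k₂ + 1) * (w * (1 - w))) + (k₂ + 1) * k₂ * (1 - w) ^ 2) * w) := by
    linear_combination L * h3 - ((k₁ + 1) * k₁ * w ^ 2
      - 2 * ((k₁ + 1) * (k₂ + 1) * (w * (1 - w))) + (k₂ + 1) * k₂ * (1 - w) ^ 2) * h2
  have hne : w ^ 2 * (1 - w) ^ 2 ≠ 0 := by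
    have := hb.1; have := sub_pos.2 hb.2; positivity
  have h5 : L * κ = - (((k₁ + 1) * k₁ * w ^ 2
      - 2 * ((k₁ + 1) * (k₂ + 1) * (w * (1 - w))) + (k₂ + 1) * k₂ * (1 - w) ^ 2) * w)
      / (2 * (w ^ 2 * (1 - w) ^ 2)) := by
    rw [eq_div_iff (mul_ne_zero two_ne_zero hne)]; linarith
  rw [h5, hw1, hwdef]
  field_simp
  ring

lemma tendsto_period₁_leastT {k₁ k₂ : ℕ} (hk : 1 ≤ k₂) :
    Filter.Tendsto (fun T => period₁ k₁ k₂ (0, T))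
      (nhdsWithin (leastT k₁ k₂) (Set.Ioi (leastT k₁ k₂)))
      (nhds (Real.pi / √(2 * (k₁ + 1)))) := by
  have hb := bottom_mem (k₁ := k₁) hk
  have hk' : (1 : ℝ) ≤ k₂ := by exact_mod_cast hk
  have hk1 : (0 : ℝ) ≤ k₁ := Nat.cast_nonneg _
  have hturn : ∀ t, turning (bottom k₁ k₂) (bottom k₁ k₂) t = bottom k₁ k₂ := fun t => by
    simp [turning]
  have hreg : ∀ t, regularFactor k₁ k₂ (leastT k₁ k₂) (bottom k₁ k₂) (bottom k₁ k₂) t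
      = (k₁ + 1 + k₂) ^ 2 / (2 * (k₁ + 1)) := fun t => by
    rw [regularFactor, hturn, leastT_mul_kernel hk]
  have hmem : (bottom k₁ k₂, bottom k₁ k₂, leastT k₁ k₂) ∈ regularSet k₁ k₂ := fun t => by
    simp only [hturn, hreg]
    exact ⟨sub_pos.2 hb.2, hb.1, by positivity⟩
  have hval : phase (rate₁ k₁ k₂ (leastT k₁ k₂) (bottom k₁ k₂) (bottom k₁ k₂)) Real.pi
      = Real.pi / √(2 * (k₁ + 1)) := by
    simp only [phase, rate₁, hturn, hreg, intervalIntegral.integral_const, smul_eq_mul, sub_zero]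
    rw [Real.sqrt_div (sq_nonneg _), Real.sqrt_sq (by positivity)]
    have hw1 : 1 - bottom k₁ k₂ = (k₁ + 1) / (k₁ + 1 + k₂) := by
      rw [bottom]; field_simp; ring
    have hs := Real.sq_sqrt (show (0 : ℝ) ≤ 2 * (k₁ + 1) by positivity)
    have hs0 : 0 < √(2 * ((k₁ : ℝ) + 1)) := Real.sqrt_pos.2 (by positivity)
    rw [hw1]
    field_simp
    linear_combination hs
  rw [← hval]
  refine Filter.Tendsto.comp (continuousOn_integral_rate₁ k₁ k₂ _ hmem)
    (tendsto_nhdsWithin_iff.2 ⟨?_, ?_⟩) (f := fun T =>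
      ((roots k₁ k₂ (0, T)).1, (roots k₁ k₂ (0, T)).2, T))
  · have h1 := tendsto_roots_leastT (k₁ := k₁) hk
    exact ((continuous_fst.tendsto _).comp h1).prodMk_nhds
      (((continuous_snd.tendsto _).comp h1).prodMk_nhds
        (Filter.tendsto_id.mono_left nhdsWithin_le_nhds))
  · filter_upwards [eventually_mem_nhdsWithin] with T hT
    exact roots_mapsTo k₁ k₂ (mem_admissible_of_leastT_lt hk hT)

/-! ### An upper bound for the first period integral at `c = 0` -/

lemma integral_le_pi_div {f Y Y' : ℝ → ℝ} {a b κ ε : ℝ} (hab : a ≤ b) (hf : Continuous f)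
    (hY : ContinuousOn Y (Set.Icc a b)) (hYpos : ∀ t ∈ Set.Ioo a b, 0 < Y t)
    (dY : ∀ t ∈ Set.Ioo a b, HasDerivAt Y (Y' t) t) (hκ : 0 < κ) (hε : ε = 1 ∨ ε = -1)
    (hle : ∀ t ∈ Set.Ioo a b, f t ≤ ε * Y' t / (κ * √(Real.exp (Y t) - 1))) :
    ∫ t in a..b, f t ≤ Real.pi / κ := by
  have h1 := intervalIntegral.integral_le_sub_of_hasDeriv_right_of_le hab
    (g := fun t => ε * (2 / κ) * Real.arctan √(Real.exp (Y t) - 1))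
    (g' := fun t => ε * Y' t / (κ * √(Real.exp (Y t) - 1))) (φ := f)
    (continuousOn_const.mul (Real.continuous_arctan.comp_continuousOn
      ((Real.continuous_exp.comp_continuousOn hY).sub continuousOn_const).sqrt))
    (fun t ht => by
      have hpos : 0 < Real.exp (Y t) - 1 := by
        have := Real.add_one_lt_exp (hYpos t ht).ne'
        linarith [hYpos t ht]
      have hr := Real.sqrt_pos.2 hpos
      have hsq := Real.sq_sqrt hpos.le
      refine HasDerivAt.hasDerivWithinAt ((((((dY t ht).exp).sub_const 1).sqrt
        hpos.ne').arctan.const_mul (ε * (2 / κ))).congr_deriv ?_)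
      rw [hsq, show 1 + (Real.exp (Y t) - 1) = Real.exp (Y t) by ring]
      have := Real.exp_pos (Y t)
      field_simp)
    (hf.continuousOn.integrableOn_Icc) hle
  refine h1.trans ?_
  have b1 := Real.arctan_lt_pi_div_two √(Real.exp (Y b) - 1)
  have b2 := Real.arctan_lt_pi_div_two √(Real.exp (Y a) - 1)
  have b3 : 0 ≤ Real.arctan √(Real.exp (Y b) - 1) := Real.arctan_nonneg.2 (Real.sqrt_nonneg _)
  have b4 : 0 ≤ Real.arctan √(Real.exp (Y a) - 1) := Real.arctan_nonneg.2 (Real.sqrt_nonneg _)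
  have hp : 0 < 2 / κ := by positivity
  rw [show Real.pi / κ = 2 / κ * (Real.pi / 2) by field_simp]
  rcases hε with rfl | rfl <;> nlinarith

lemma hasDerivAt_artanh {s : ℝ} (hs : s ∈ Set.Ioo (-1 : ℝ) 1) :
    HasDerivAt Real.artanh (1 / (1 - s ^ 2)) s := by
  have h1 : 0 < 1 + s := by linarith [hs.1]
  have h2 : 0 < 1 - s := by linarith [hs.2]
  have h3 : HasDerivAt (fun s => 1 / 2 * Real.log ((1 + s) / (1 - s))) (1 / (1 - s ^ 2)) s := by
    refine ((((hasDerivAt_id s).const_add 1).div ((hasDerivAt_id s).const_sub 1)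
      h2.ne').log (div_pos h1 h2).ne' |>.const_mul (1 / 2)).congr_deriv ?_
    have : 1 - s ^ 2 = (1 + s) * (1 - s) := by ring
    simp only [id, this, Pi.div_apply]
    field_simp
    ring
  refine h3.congr_of_eventuallyEq ?_
  filter_upwards [isOpen_Ioo.mem_nhds hs] with z hz
  exact Real.artanh_eq_half_log (Set.Ioo_subset_Icc_self hz)

/-- Minus the logarithm of `tanh^(2 k₂) X / cosh^(2 (k₁ + 1)) X`. -/
def logPotential (k₁ k₂ : ℕ) (X : ℝ) : ℝ :=
  2 * (k₁ + 1 + k₂) * Real.log (Real.cosh X) - 2 * k₂ * Real.log (Real.sinh X)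

lemma convexOn_logPotential (k₁ k₂ : ℕ) : ConvexOn ℝ (Set.Ioi 0) (logPotential k₁ k₂) := by
  have hs : ∀ X ∈ Set.Ioi (0 : ℝ), 0 < Real.sinh X := fun X hX => Real.sinh_pos_iff.2 hX
  have d1 : ∀ X ∈ Set.Ioi (0 : ℝ), HasDerivAt (logPotential k₁ k₂)
      (2 * (k₁ + 1 + k₂) * (Real.sinh X / Real.cosh X)
        - 2 * k₂ * (Real.cosh X / Real.sinh X)) X := fun X hX =>
    (((Real.hasDerivAt_cosh X).log (Real.cosh_pos X).ne').const_mul _).sub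
      (((Real.hasDerivAt_sinh X).log (hs X hX).ne').const_mul _)
  have d2 : ∀ X ∈ Set.Ioi (0 : ℝ), HasDerivAt (fun X =>
      2 * (k₁ + 1 + k₂) * (Real.sinh X / Real.cosh X) - 2 * k₂ * (Real.cosh X / Real.sinh X))
      (2 * (k₁ + 1 + k₂) / Real.cosh X ^ 2 + 2 * k₂ / Real.sinh X ^ 2) X := fun X hX => by
    refine ((((Real.hasDerivAt_sinh X).div (Real.hasDerivAt_cosh X)
      (Real.cosh_pos X).ne').const_mul _).sub (((Real.hasDerivAt_cosh X).div
        (Real.hasDerivAt_sinh X) (hs X hX).ne').const_mul _)).congr_deriv ?_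
    have := hs X hX
    have := Real.cosh_pos X
    have e := Real.cosh_sq_sub_sinh_sq X
    rw [show Real.cosh X * Real.cosh X - Real.sinh X * Real.sinh X = 1 by linarith,
      show Real.sinh X * Real.sinh X - Real.cosh X * Real.cosh X = -1 by linarith]
    ring
  refine convexOn_of_hasDerivWithinAt2_nonneg (convex_Ioi 0)
    (fun X hX => (d1 X hX).continuousAt.continuousWithinAt)
    (f' := fun X => 2 * (k₁ + 1 + k₂) * (Real.sinh X / Real.cosh X)
      - 2 * k₂ * (Real.cosh X / Real.sinh X))
    (f'' := fun X => 2 * (k₁ + 1 + k₂) / Real.cosh X ^ 2 + 2 * k₂ / Real.sinh X ^ 2)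
    (fun X hX => (d1 X (interior_subset hX)).hasDerivWithinAt)
    (fun X hX => (d2 X (interior_subset hX)).hasDerivWithinAt) fun X _ => by positivity

lemma sqrt_mem_Ioo {u : ℝ} (hu : u ∈ Set.Ioo (0 : ℝ) 1) : √u ∈ Set.Ioo (0 : ℝ) 1 :=
  ⟨Real.sqrt_pos.2 hu.1, by rw [Real.sqrt_lt' one_pos]; simpa using hu.2⟩

lemma logPotential_artanh (k₁ k₂ : ℕ) {u : ℝ} (hu : u ∈ Set.Ioo (0 : ℝ) 1) :
    logPotential k₁ k₂ (Real.artanh √u) = Real.log (potential k₁ k₂ 0 u) := by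
  have hr := sqrt_mem_Ioo hu
  have hr' : √u ∈ Set.Ioo (-1 : ℝ) 1 := ⟨by linarith [hr.1], hr.2⟩
  have h1 := sub_pos.2 hu.2
  rw [logPotential, Real.cosh_artanh hr', Real.sinh_artanh hr', Real.sq_sqrt hu.1.le,
    Real.log_div one_ne_zero (Real.sqrt_pos.2 h1).ne', Real.log_div hr.1.ne'
    (Real.sqrt_pos.2 h1).ne', Real.log_one, Real.log_sqrt h1.le, Real.log_sqrt hu.1.le,
    potential, zero_mul, add_zero, invWeight, Real.log_exp]
  push_cast; ring

lemma hasDerivAt_artanh_turning {x y t : ℝ} (hu : turning x y t ∈ Set.Ioo (0 : ℝ) 1) :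
    HasDerivAt (fun t => Real.artanh √(turning x y t))
      ((y - x) / 2 * Real.sin t / (2 * √(turning x y t) * (1 - turning x y t))) t := by
  have hr := sqrt_mem_Ioo hu
  refine ((hasDerivAt_artanh ⟨by linarith [hr.1], hr.2⟩).comp t
    ((hasDerivAt_turning x y t).sqrt hu.1.ne')).congr_deriv ?_
  rw [Real.sq_sqrt hu.1.le, div_mul_div_comm, one_mul]
  ring

lemma turning_strictMonoOn {x y : ℝ} (h : x < y) :
    StrictMonoOn (turning x y) (Set.Icc 0 Real.pi) := fun a ha b hb hab => by
  have := Real.strictAntiOn_cos ha hb hab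
  unfold turning
  nlinarith

namespace IsRootPair

variable {k₁ k₂ : ℕ} {T x y : ℝ} (h : IsRootPair k₁ k₂ 0 T x y)
include h

lemma rate₁_le (hT : 0 < T) {t Y : ℝ} (ht : t ∈ Set.Ioo 0 Real.pi) (hY : 0 < Y)
    (hle : Y ≤ Real.log T - logPotential k₁ k₂ (Real.artanh √(turning x y t))) :
    rate₁ k₁ k₂ T x y t ≤ (y - x) / 2 * Real.sin t
      / (2 * √(turning x y t) * (1 - turning x y t)) / √(Real.exp Y - 1) := by
  have hu : turning x y t ∈ Set.Ioo (0 : ℝ) 1 := ⟨h.turning_pos t, h.turning_lt_one t⟩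
  have hV := h.deriv_turning_pos ht
  have hQ := h.regularFactor_pos t
  set u := turning x y t with hudef
  set V := (y - x) / 2 * Real.sin t with hVdef
  have h1 : V ^ 2 * regularFactor k₁ k₂ T x y t = u * (T / potential k₁ k₂ 0 u - 1) := by
    rw [hVdef, turning_sq, regularFactor,
      ← polyRadicand_eq_mul_kernel h.lt.ne h.left_zero h.right_zero, ← hudef, polyRadicand,
      weight, potential]
    simp only [zero_mul, add_zero, sub_zero]
    have e := invWeight_mul (n := k₂) (m := k₁ + 1) hu
    have e0 : invWeight k₂ (k₁ + 1) u ≠ 0 := (Real.exp_pos _).ne'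
    field_simp
    linear_combination u * T * e
  have hpot : 0 < potential k₁ k₂ 0 u := by
    rw [potential, zero_mul, add_zero]; exact Real.exp_pos _
  have h2 : Real.exp Y - 1 ≤ T / potential k₁ k₂ 0 u - 1 := by
    rw [logPotential_artanh k₁ k₂ hu] at hle
    have := Real.exp_le_exp.2 hle
    rw [Real.exp_sub, Real.exp_log hT, Real.exp_log hpot] at this
    linarith
  have h3 : 0 < Real.exp Y - 1 := by
    have := Real.add_one_lt_exp hY.ne'
    linarith
  have hr := (sqrt_mem_Ioo hu).1
  have h4 : √u * √(Real.exp Y - 1) ≤ V * √(regularFactor k₁ k₂ T x y t) := by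
    rw [← Real.sqrt_mul hu.1.le, ← Real.sqrt_sq hV.le, ← Real.sqrt_mul (sq_nonneg _), h1]
    exact Real.sqrt_le_sqrt (mul_le_mul_of_nonneg_left h2 hu.1.le)
  have h5 := Real.sqrt_pos.2 h3
  have h6 := Real.sqrt_pos.2 hQ
  have h7 := sub_pos.2 hu.2
  rw [rate₁, ← hudef, div_div, div_le_div_iff₀ (by positivity) (by positivity)]
  nlinarith [mul_le_mul_of_nonneg_left h4 (mul_pos two_pos h7).le]

theorem phase_rate₁_le (hT : 0 < T) {w : ℝ} (hw : w ∈ Set.Ioo x y) :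
    phase (rate₁ k₁ k₂ T x y) Real.pi
      ≤ Real.pi * Real.artanh √y / (Real.log T - Real.log (potential k₁ k₂ 0 w)) := by
  have hmem : ∀ u ∈ Set.Icc x y, u ∈ Set.Ioo (0 : ℝ) 1 := fun u hu =>
    ⟨h.left_pos.trans_le hu.1, hu.2.trans_lt h.right_lt⟩
  have hx := hmem x ⟨le_rfl, h.lt.le⟩
  have hy := hmem y ⟨h.lt.le, le_rfl⟩
  have hw' := hmem w (Set.Ioo_subset_Icc_self hw)
  have hpot : ∀ u, 0 < potential k₁ k₂ 0 u := fun u => by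
    rw [potential, zero_mul, add_zero]; exact Real.exp_pos _
  have hend : ∀ u ∈ Set.Ioo (0 : ℝ) 1, polyRadicand k₁ k₂ 0 T u = 0 →
      logPotential k₁ k₂ (Real.artanh √u) = Real.log T := fun u hu h0 => by
    rw [logPotential_artanh k₁ k₂ hu]
    rw [polyRadicand_eq_weight_mul _ _ hu] at h0
    rw [sub_eq_zero.1 ((mul_eq_zero.1 h0).resolve_left (weight_pos hu).ne')]
  have hlt : ∀ u ∈ Set.Ioo (0 : ℝ) 1, ∀ v ∈ Set.Ioo (0 : ℝ) 1, u < v →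
      Real.artanh √u < Real.artanh √v := fun u hu v hv huv =>
    Real.artanh_lt_artanh (by linarith [Real.sqrt_nonneg u]) (sqrt_mem_Ioo hv).2
      (Real.sqrt_lt_sqrt hu.1.le huv)
  have hpos : ∀ u ∈ Set.Ioo (0 : ℝ) 1, 0 < Real.artanh √u := fun u hu =>
    Real.artanh_pos (sqrt_mem_Ioo hu)
  set Λ := Real.log T - Real.log (potential k₁ k₂ 0 w) with hΛ
  have hΛ0 : 0 < Λ := sub_pos.2 (Real.log_lt_log (hpot w)
    ((polyRadicand_pos_iff hw').1 ((h.pos_iff w hw').2 hw)))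
  set X₁ := Real.artanh √x with hX₁
  set X₀ := Real.artanh √w with hX₀
  set X₂ := Real.artanh √y with hX₂
  have h10 : X₁ < X₀ := hlt x hx w hw' hw.1
  have h02 : X₀ < X₂ := hlt w hw' y hy hw.2
  have hc := convexOn_logPotential k₁ k₂
  have e1 := hend x hx h.left_zero
  have e2 := hend y hy h.right_zero
  have e0 : logPotential k₁ k₂ X₀ = Real.log T - Λ := by
    rw [hX₀, logPotential_artanh k₁ k₂ hw', hΛ]; ring
  rw [← hX₁] at e1
  rw [← hX₂] at e2
  set X : ℝ → ℝ := fun t => Real.artanh √(turning x y t) with hX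
  have hu : ∀ t, turning x y t ∈ Set.Ioo (0 : ℝ) 1 := fun t => hmem _ (turning_mem h.lt.le t)
  have dX := fun t => hasDerivAt_artanh_turning (hu t)
  have cX : Continuous X := continuous_iff_continuousAt.2 fun t => (dX t).continuousAt
  obtain ⟨τ, hτ, hτw⟩ := intermediate_value_Ioo Real.pi_pos.le
    ((contDiff_turning x y).continuous.continuousOn) (show w ∈ Set.Ioo (turning x y 0)
      (turning x y Real.pi) by
        simp only [turning, Real.cos_zero, Real.cos_pi]
        constructor <;> [convert hw.1 using 1; convert hw.2 using 1] <;> ring)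
  have t0 : turning x y 0 = x := by simp [turning]; ring
  have tpi : turning x y Real.pi = y := by simp [turning]; ring
  have hmono := turning_strictMonoOn h.lt
  have hτI : τ ∈ Set.Icc 0 Real.pi := Set.Ioo_subset_Icc_self hτ
  have hcont := h.contDiff_rate₁.continuous
  have left : ∫ t in (0 : ℝ)..τ, rate₁ k₁ k₂ T x y t ≤ Real.pi / (Λ / (X₀ - X₁)) := by
    have hκ : 0 < Λ / (X₀ - X₁) := div_pos hΛ0 (sub_pos.2 h10)
    have hin : ∀ t ∈ Set.Ioo 0 τ, X₁ < X t ∧ X t < X₀ := fun t ht => by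
      have ht' : t ∈ Set.Icc 0 Real.pi := ⟨ht.1.le, (ht.2.trans hτ.2).le⟩
      refine ⟨hlt x hx _ (hu t) ?_, hlt _ (hu t) w hw' ?_⟩
      · have := hmono ⟨le_rfl, Real.pi_pos.le⟩ ht' ht.1
        rwa [t0] at this
      · have := hmono ht' hτI ht.2
        rwa [hτw] at this
    refine integral_le_pi_div hτ.1.le hcont (Y := fun t => Λ / (X₀ - X₁) * (X t - X₁)) (ε := 1)
      (by fun_prop) (fun t ht => mul_pos hκ (sub_pos.2 (hin t ht).1))
      (fun t _ => ((dX t).sub_const X₁).const_mul _) hκ (Or.inl rfl) fun t ht => ?_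
    have hY := mul_pos hκ (sub_pos.2 (hin t ht).1)
    refine (h.rate₁_le hT ⟨ht.1, ht.2.trans hτ.2⟩ hY ?_).trans_eq ?_
    · have := hc.mul_le_of_mem_Icc (hpos x hx) (hpos w hw') h10
        ⟨(hin t ht).1.le, (hin t ht).2.le⟩
      rw [← hX₀, ← hX₁, e1, e0] at this
      rw [div_mul_eq_mul_div, div_le_iff₀ (sub_pos.2 h10)]
      change Λ * (X t - X₁) ≤ (Real.log T - logPotential k₁ k₂ (X t)) * (X₀ - X₁)
      linarith
    · rw [one_mul, mul_div_mul_left _ _ hκ.ne']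
  have right : ∫ t in τ..Real.pi, rate₁ k₁ k₂ T x y t ≤ Real.pi / (Λ / (X₂ - X₀)) := by
    have hκ : 0 < Λ / (X₂ - X₀) := div_pos hΛ0 (sub_pos.2 h02)
    have hin : ∀ t ∈ Set.Ioo τ Real.pi, X₀ < X t ∧ X t < X₂ := fun t ht => by
      have ht' : t ∈ Set.Icc 0 Real.pi := ⟨(hτ.1.trans ht.1).le, ht.2.le⟩
      refine ⟨hlt w hw' _ (hu t) ?_, hlt _ (hu t) y hy ?_⟩
      · have := hmono hτI ht' ht.1
        rwa [hτw] at this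
      · have := hmono ht' ⟨Real.pi_pos.le, le_rfl⟩ ht.2
        rwa [tpi] at this
    refine integral_le_pi_div hτ.2.le hcont (Y := fun t => Λ / (X₂ - X₀) * (X₂ - X t)) (ε := -1)
      (by fun_prop) (fun t ht => mul_pos hκ (sub_pos.2 (hin t ht).2))
      (fun t _ => ((dX t).const_sub X₂).const_mul _) hκ (Or.inr rfl) fun t ht => ?_
    have hY := mul_pos hκ (sub_pos.2 (hin t ht).2)
    refine (h.rate₁_le hT ⟨hτ.1.trans ht.1, ht.2⟩ hY ?_).trans_eq ?_
    · have := hc.mul_le_of_mem_Icc (hpos w hw') (hpos y hy) h02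
        ⟨(hin t ht).1.le, (hin t ht).2.le⟩
      rw [← hX₀, ← hX₂, e2, e0] at this
      rw [div_mul_eq_mul_div, div_le_iff₀ (sub_pos.2 h02)]
      change Λ * (X₂ - X t) ≤ (Real.log T - logPotential k₁ k₂ (X t)) * (X₂ - X₀)
      linarith
    · rw [mul_neg, neg_one_mul, neg_neg, mul_div_mul_left _ _ hκ.ne']
  have hsum := intervalIntegral.integral_add_adjacent_intervals
    (hcont.intervalIntegrable (μ := volume) 0 τ) (hcont.intervalIntegrable (μ := volume) τ Real.pi)
  have hX1 : 0 < X₁ := hpos x hx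
  have hfin : Real.pi / (Λ / (X₀ - X₁)) + Real.pi / (Λ / (X₂ - X₀)) ≤ Real.pi * X₂ / Λ := by
    rw [div_div_eq_mul_div, div_div_eq_mul_div, ← add_div]
    exact div_le_div_of_nonneg_right (by nlinarith [Real.pi_pos]) hΛ0.le
  unfold phase
  linarith

/-- The right end point is not too close to `1`. -/
lemma artanh_right_le (hT : 0 < T) :
    Real.artanh √y ≤ (Real.log 4 + Real.log T / (k₁ + 1)) / 2 := by
  have hy : y ∈ Set.Ioo (0 : ℝ) 1 := ⟨h.left_pos.trans h.lt, h.right_lt⟩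
  have hr := sqrt_mem_Ioo hy
  have h1 := sub_pos.2 hy.2
  have hzero := h.right_zero
  have hsq := Real.sq_sqrt hy.1.le
  have h2 : 1 ≤ T * (1 - y) ^ (k₁ + 1) := by
    unfold polyRadicand weight at hzero
    have e : T * (1 - y) ^ (k₁ + 1) * y ^ k₂ = 1 := by
      have : y * (T * (1 - y) ^ (k₁ + 1) * y ^ k₂ - 1) = 0 := by
        linear_combination hzero
      linarith [(mul_eq_zero.1 this).resolve_left hy.1.ne']
    exact e.symm.trans_le <| mul_le_of_le_one_right (by positivity) 
      (pow_le_one₀ hy.1.le hy.2.le)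
  have h3 : 0 ≤ Real.log T + (k₁ + 1) * Real.log (1 - y) := by
    have := Real.log_nonneg h2
    rw [Real.log_mul hT.ne' (by positivity), Real.log_pow] at this
    push_cast at this; exact this
  have h4 : -Real.log (1 - y) ≤ Real.log T / (k₁ + 1) := by
    rw [le_div_iff₀ (by positivity)]; linarith
  rw [Real.artanh_eq_half_log ⟨by linarith [hr.1], hr.2.le⟩]
  have h5 : Real.log ((1 + √y) / (1 - √y)) ≤ Real.log 4 - Real.log (1 - y) := by
    rw [← Real.log_div (by norm_num) h1.ne']
    have h6 := sub_pos.2 hr.2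
    refine Real.log_le_log (by have := hr.1; positivity) ?_
    rw [div_le_div_iff₀ h6 h1]
    have e : 1 - y = (1 + √y) * (1 - √y) := by linear_combination hsq
    rw [e]
    nlinarith [hr.1, hr.2, mul_pos hr.1 h6]
  linarith

end IsRootPair

lemma exists_period₁_lt {k₁ k₂ : ℕ} (hk : 1 ≤ k₂) : ∃ T, leastT k₁ k₂ < T ∧
    period₁ k₁ k₂ (0, T) < Real.pi / √(2 * (k₁ + 1)) := by
  have hk1 : (0 : ℝ) ≤ k₁ := Nat.cast_nonneg _
  set s := √(2 * ((k₁ : ℝ) + 1)) with hs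
  have hs2 : s ^ 2 = 2 * (k₁ + 1) := Real.sq_sqrt (by positivity)
  have hs0 : 0 < s := Real.sqrt_pos.2 (by positivity)
  have hs1 : 1 < s := by nlinarith
  set g := Real.log (leastT k₁ k₂) with hg
  have hleast : 0 < leastT k₁ k₂ := by
    rw [leastT, potential, zero_mul, add_zero]; exact Real.exp_pos _
  -- `L = log T` large
  set L := max (g + 1) ((Real.log 4 * s + 2 * g) / (2 - 2 / s) + 1) with hL
  have hgL : g < L := lt_of_lt_of_le (by linarith) (le_max_left _ _)
  have hden : 0 < 2 - 2 / s := by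
    rw [sub_pos, div_lt_iff₀ hs0]; linarith
  have hLs : (Real.log 4 * s + 2 * g) < (2 - 2 / s) * L := by
    have : (Real.log 4 * s + 2 * g) / (2 - 2 / s) < L :=
      lt_of_lt_of_le (by linarith) (le_max_right _ _)
    rw [div_lt_iff₀ hden] at this
    linarith
  have hT : leastT k₁ k₂ < Real.exp L := by
    rwa [← Real.log_lt_iff_lt_exp hleast]
  refine ⟨Real.exp L, hT, ?_⟩
  have hadm := mem_admissible_of_leastT_lt hk hT
  have h := isRootPair_roots hadm
  have hw := (h.pos_iff _ (bottom_mem hk)).1 ((polyRadicand_pos_iff (bottom_mem hk)).2 hT)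
  have b1 := h.phase_rate₁_le (Real.exp_pos _) hw
  have b2 := h.artanh_right_le (Real.exp_pos _)
  rw [Real.log_exp] at b1 b2
  change _ ≤ Real.pi * _ / (L - g) at b1
  refine b1.trans_lt ?_
  rw [div_lt_div_iff₀ (sub_pos.2 hgL) hs0, mul_assoc]
  refine mul_lt_mul_of_pos_left ?_ Real.pi_pos
  refine (mul_le_mul_of_nonneg_right b2 hs0.le).trans_lt ?_
  have e : L / (k₁ + 1) * s = 2 / s * L := by
    rw [show (k₁ : ℝ) + 1 = s ^ 2 / 2 by rw [hs2]; ring]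
    field_simp
  nlinarith

/-! ### Infinitely many closing pairs -/

lemma period_eq {k₁ k₂ : ℕ} {c T : ℝ} (hc : 0 ≤ c) (h : (c, T) ∈ admissible k₁ k₂) :
    (basicDomain k₁ k₂ √c T).Nonempty ∧ J₁ k₁ k₂ √c T = period₁ k₁ k₂ (c, T) ∧
      √c * J₂ k₁ k₂ √c T = period₂ k₁ k₂ (c, T) := by
  have hr := isRootPair_roots h
  have hC : c = √c ^ 2 := (Real.sq_sqrt hc).symm
  refine ⟨?_, (hr.integral₁ hC).2, ?_⟩
  · have := hr.polarAngle_image hC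
    simp only at this
    rw [← this]
    exact (Set.nonempty_Ioo.2 Real.pi_pos).image _
  · rw [(hr.integral₂ hC).2, period₂]

theorem exists_solutions {k₁ k₂ : ℕ} (hk : 1 ≤ k₂) :
    ∃ q : ℚ, ∃ η > 0, ∀ r : ℝ, 0 < r → r < η → ∃ C T, 0 < C ∧
      (basicDomain k₁ k₂ C T).Nonempty ∧ J₁ k₁ k₂ C T = Real.pi * q ∧ C * J₂ k₁ k₂ C T = r := by
  obtain ⟨T₂, hT₂, hlt⟩ := exists_period₁_lt (k₁ := k₁) hk
  obtain ⟨T₁, hT₁₂, hgt, hT₁⟩ : ∃ T₁, T₁ < T₂ ∧ period₁ k₁ k₂ (0, T₂) < period₁ k₁ k₂ (0, T₁) ∧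
      leastT k₁ k₂ < T₁ := by
    have h1 := (tendsto_period₁_leastT (k₁ := k₁) hk).eventually_const_lt hlt
    have h2 : ∀ᶠ T in nhdsWithin (leastT k₁ k₂) (Set.Ioi (leastT k₁ k₂)), T < T₂ :=
      (eventually_lt_nhds hT₂).filter_mono nhdsWithin_le_nhds
    obtain ⟨T₁, a, b, c⟩ := (h2.and (h1.and eventually_mem_nhdsWithin)).exists
    exact ⟨T₁, a, b, c⟩
  obtain ⟨q, hq₂, hq₁⟩ : ∃ q : ℚ, period₁ k₁ k₂ (0, T₂) < Real.pi * q ∧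
      Real.pi * q < period₁ k₁ k₂ (0, T₁) := by
    obtain ⟨q, h1, h2⟩ := exists_rat_btwn (div_lt_div_of_pos_right hgt Real.pi_pos)
    rw [div_lt_iff₀ Real.pi_pos] at h1
    rw [lt_div_iff₀ Real.pi_pos] at h2
    exact ⟨q, by linarith, by linarith⟩
  have hb := bottom_mem (k₁ := k₁) hk
  set d := polyRadicand k₁ k₂ 0 T₁ (bottom k₁ k₂) with hd
  have hd0 : 0 < d := (polyRadicand_pos_iff hb).2 hT₁
  have hadm : ∀ c T, 0 ≤ c → c < d → T₁ ≤ T → (c, T) ∈ admissible k₁ k₂ := by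
    intro c T hc hcd hT
    refine ⟨Or.inr ⟨hc, hk⟩, bottom k₁ k₂, hb, ?_⟩
    have h1 : d ≤ polyRadicand k₁ k₂ 0 T (bottom k₁ k₂) := by
      rw [hd]; unfold polyRadicand
      have := mul_le_mul_of_nonneg_right hT (weight_pos (k₁ := k₁) (k₂ := k₂) hb).le
      linarith
    have h2 : polyRadicand k₁ k₂ c T (bottom k₁ k₂)
        = polyRadicand k₁ k₂ 0 T (bottom k₁ k₂) - c * (1 - bottom k₁ k₂) := by
      unfold polyRadicand; ring
    rw [h2]
    nlinarith [hb.1, hb.2]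
  have hside : ∀ T, T₁ ≤ T → Filter.Tendsto (fun c => period₁ k₁ k₂ (c, T))
      (nhdsWithin 0 (Set.Ici 0)) (nhds (period₁ k₁ k₂ (0, T))) := by
    intro T hT
    refine Filter.Tendsto.comp (continuousOn_period₁ k₁ k₂ _ (hadm 0 T le_rfl hd0 hT))
      (tendsto_nhdsWithin_iff.2 ⟨?_, ?_⟩) (f := fun c => (c, T))
    · exact (Continuous.tendsto (by fun_prop) (0 : ℝ)).mono_left nhdsWithin_le_nhds
    · filter_upwards [eventually_mem_nhdsWithin,
        (eventually_lt_nhds hd0).filter_mono nhdsWithin_le_nhds] with c h1 h2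
      exact hadm c T h1 h2 hT
  obtain ⟨ε, hε, hεd⟩ : ∃ ε > 0, ∀ c, 0 ≤ c → c < ε → c < d ∧
      period₁ k₁ k₂ (c, T₂) < Real.pi * q ∧ Real.pi * q < period₁ k₁ k₂ (c, T₁) := by
    have h1 := ((hside T₂ hT₁₂.le).eventually_lt_const hq₂).and
      ((hside T₁ le_rfl).eventually_const_lt hq₁)
    have h2 := ((eventually_lt_nhds hd0).filter_mono
      (nhdsWithin_le_nhds (s := Set.Ici (0 : ℝ)))).and h1
    obtain ⟨ε, hε, h3⟩ := Metric.mem_nhdsWithin_iff.1 h2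
    exact ⟨ε, hε, fun c hc hcε => h3 ⟨by simpa [abs_of_nonneg hc] using hcε, hc⟩⟩
  set c₂ := ε / 2 with hc₂
  have hc₂0 : 0 < c₂ := by positivity
  have hin : ∀ c ∈ Set.Icc 0 c₂, c < d ∧
      period₁ k₁ k₂ (c, T₂) < Real.pi * q ∧ Real.pi * q < period₁ k₁ k₂ (c, T₁) :=
    fun c hc => hεd c hc.1 (hc.2.trans_lt (by rw [hc₂]; linarith))
  have hsub : Set.Icc 0 c₂ ×ˢ Set.Icc T₁ T₂ ⊆ admissible k₁ k₂ := fun p hp =>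
    hadm p.1 p.2 hp.1.1 (hin p.1 hp.1).1 hp.2.1
  have hcont₁ := (continuousOn_period₁ k₁ k₂).mono hsub
  have hcont₂ := (continuousOn_period₂ k₁ k₂).mono hsub
  obtain ⟨Tm, hTm, hmin⟩ := isCompact_Icc.exists_isMinOn (Set.nonempty_Icc.2 hT₁₂.le)
    (hcont₂.comp (f := fun T => (c₂, T)) (by fun_prop)
      fun T hT => ⟨⟨hc₂0.le, le_rfl⟩, hT⟩)
  refine ⟨q, period₂ k₁ k₂ (c₂, Tm), period₂_pos (hsub ⟨⟨hc₂0.le, le_rfl⟩, hTm⟩) hc₂0,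
    fun r hr hrη => ?_⟩
  obtain ⟨c, hc, T, hT, e1, e2⟩ := exists_zero_of_rectangle hc₂0.le hT₁₂.le
    (f := fun c T => period₂ k₁ k₂ (c, T) - r) (g := fun c T => Real.pi * q - period₁ k₁ k₂ (c, T))
    (hcont₂.sub continuousOn_const) (continuousOn_const.sub hcont₁)
    (fun T _ => by simp [period₂, hr]) (fun T hT => sub_pos.2 (hrη.trans_le (hmin hT)))
    (fun c hc => sub_neg.2 (hin c hc).2.2) (fun c hc => sub_pos.2 (hin c hc).2.1)
  have hc0 : 0 < c := by
    refine lt_of_le_of_ne hc.1 fun h0 => ?_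
    simp only [← h0, period₂, Real.sqrt_zero, zero_mul] at e1
    linarith
  obtain ⟨h1, h2, h3⟩ := period_eq hc.1 (hsub ⟨hc, hT⟩)
  exact ⟨√c, T, Real.sqrt_pos.2 hc0, h1, by rw [h2]; linarith, by rw [h3]; linarith⟩

/-- The set of closing pairs. -/
def closingPairs (k₁ k₂ : ℕ) : Set (ℝ × ℝ) := {p | 0 < p.1 ∧ IsClosingPair k₁ k₂ p.1 p.2}

theorem infinite_closingPairs_of_one_le {k₁ k₂ : ℕ} (hk : 1 ≤ k₂) :
    (closingPairs k₁ k₂).Infinite := by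
  obtain ⟨q, η, hη, h⟩ := exists_solutions (k₁ := k₁) hk
  obtain ⟨n₀, hn₀⟩ := exists_nat_gt (Real.pi / η)
  have hr : ∀ n : ℕ, 0 < Real.pi / (n₀ + n + 1) ∧ Real.pi / (n₀ + n + 1) < η := fun n => by
    refine ⟨by positivity, ?_⟩
    rw [div_lt_iff₀ hη] at hn₀
    rw [div_lt_iff₀ (by positivity)]
    nlinarith [(Nat.cast_nonneg n : (0 : ℝ) ≤ n)]
  choose C T hC hne h₁ h₂ using fun n : ℕ => h _ (hr n).1 (hr n).2
  refine Set.infinite_of_injective_forall_mem (f := fun n => (C n, T n)) (fun m n hmn => ?_)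
    fun n => ⟨hC n, hne n, ⟨q, h₁ n⟩, ⟨1 / (n₀ + n + 1), ?_⟩⟩
  · have e1 := h₂ m
    obtain ⟨hCmn, hTmn⟩ := Prod.mk.inj hmn
    rw [hCmn, hTmn, h₂ n] at e1
    rw [div_eq_div_iff (by positivity) (by positivity)] at e1
    have := mul_left_cancel₀ Real.pi_pos.ne' e1
    have e2 : (m : ℝ) = n := by linarith
    exact_mod_cast e2
  · rw [h₂ n]; push_cast; ring

/-- Exchanging the two factors. -/
lemma radicand_swap (k₁ k₂ : ℕ) {C : ℝ} (hC : C ≠ 0) (T s : ℝ) :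
    radicand k₁ k₂ C T (Real.pi / 2 - s) = C ^ 2 * radicand k₂ k₁ C⁻¹ (T / C ^ 2) s := by
  unfold radicand
  rw [Real.cos_pi_div_two_sub, Real.sin_pi_div_two_sub, Real.sin_sq]
  field_simp
  ring

lemma basicDomain_swap (k₁ k₂ : ℕ) {C : ℝ} (hC : C ≠ 0) (T : ℝ) :
    (fun s => Real.pi / 2 - s) ⁻¹' basicDomain k₁ k₂ C T = basicDomain k₂ k₁ C⁻¹ (T / C ^ 2) := by
  ext s
  have hpos : 0 < C ^ 2 := by positivity
  simp only [basicDomain, Set.mem_preimage, Set.mem_ofPred_eq, Set.mem_Ioo, radicand_swap k₁ k₂ hC,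
    mul_pos_iff_of_pos_left hpos]
  constructor <;> rintro ⟨⟨h1, h2⟩, h3⟩ <;> exact ⟨⟨by linarith, by linarith⟩, h3⟩

lemma measurePreserving_pi_div_two_sub :
    MeasurePreserving (fun s : ℝ => Real.pi / 2 - s) volume volume :=
  Measure.measurePreserving_sub_left volume (Real.pi / 2)

lemma setIntegral_swap (k₁ k₂ : ℕ) {C : ℝ} (hC : C ≠ 0) (T : ℝ) (F : ℝ → ℝ) :
    ∫ s in basicDomain k₂ k₁ C⁻¹ (T / C ^ 2), F (Real.pi / 2 - s)
      = ∫ s in basicDomain k₁ k₂ C T, F s := by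
  rw [← basicDomain_swap k₁ k₂ hC T]
  exact measurePreserving_pi_div_two_sub.setIntegral_preimage_emb
    (MeasurableEquiv.subLeft (Real.pi / 2)).measurableEmbedding F _

lemma J₁_swap (k₁ k₂ : ℕ) {C : ℝ} (hC : 0 < C) (T : ℝ) :
    J₁ k₁ k₂ C T = C⁻¹ * J₂ k₂ k₁ C⁻¹ (T / C ^ 2) := by
  rw [J₁, ← setIntegral_swap k₁ k₂ hC.ne', J₂, ← integral_const_mul]
  congr 1
  ext s
  rw [integrand₁, integrand₂, radicand_swap k₁ k₂ hC.ne', Real.sqrt_mul (by positivity),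
    Real.sqrt_sq hC.le, Real.tan_pi_div_two_sub, Real.cot_eq_cos_div_sin, Real.tan_eq_sin_div_cos,
    inv_div]
  ring

lemma J₂_swap (k₁ k₂ : ℕ) {C : ℝ} (hC : 0 < C) (T : ℝ) :
    C * J₂ k₁ k₂ C T = J₁ k₂ k₁ C⁻¹ (T / C ^ 2) := by
  rw [J₂, ← setIntegral_swap k₁ k₂ hC.ne', J₁, ← integral_const_mul]
  congr 1
  ext s
  rw [integrand₁, integrand₂, radicand_swap k₁ k₂ hC.ne', Real.sqrt_mul (by positivity),
    Real.sqrt_sq hC.le, Real.cot_eq_cos_div_sin, Real.tan_eq_sin_div_cos,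
    Real.cos_pi_div_two_sub, Real.sin_pi_div_two_sub]
  field_simp

theorem infinite_closingPairs {k₁ k₂ : ℕ} (hk : 1 ≤ k₁ + k₂) : (closingPairs k₁ k₂).Infinite := by
  rcases Nat.eq_zero_or_pos k₂ with rfl | h2
  · have h1 : 1 ≤ k₁ := by omega
    have hinf := infinite_closingPairs_of_one_le (k₁ := 0) h1
    refine Set.infinite_of_injOn_mapsTo (f := fun p : ℝ × ℝ => (p.1⁻¹, p.2 / p.1 ^ 2))
      (fun p hp p' hp' he => ?_) (fun p hp => ?_) hinf
    · obtain ⟨e1, e2⟩ := Prod.mk.inj he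
      have e3 : p.1 = p'.1 := inv_injective e1
      rw [e3] at e2
      have : p'.1 ^ 2 ≠ 0 := (pow_pos hp'.1 2).ne'
      exact Prod.ext e3 ((div_left_inj' this).1 e2)
    · obtain ⟨hC, hne, hJ₁, hJ₂⟩ := hp
      rw [J₁_swap 0 k₁ hC] at hJ₁
      rw [J₂_swap 0 k₁ hC] at hJ₂
      refine ⟨inv_pos.2 hC, ?_, hJ₂, hJ₁⟩
      rw [← basicDomain_swap 0 k₁ hC.ne']
      obtain ⟨s, hs⟩ := hne
      exact ⟨Real.pi / 2 - s, by simpa using hs⟩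
  · exact infinite_closingPairs_of_one_le h2

theorem card_closingPairs {k₁ k₂ : ℕ} (hk : 1 ≤ k₁ + k₂) :
    Cardinal.mk (ℚ × ℚ) ≤
      Cardinal.mk {p : ℝ × ℝ | 0 < p.1 ∧ IsClosingPair k₁ k₂ p.1 p.2} := by
  rw [Cardinal.mk_eq_aleph0 (ℚ × ℚ), Cardinal.aleph0_le_mk_iff]
  exact (infinite_closingPairs hk).to_subtype

/-! ### The mean curvature in an orthogonal frame -/

section Frame

variable {E : Type*} [NormedAddCommGroup E] [NormedSpace ℝ E]
  {V : Type*} [NormedAddCommGroup V] [InnerProductSpace ℝ V]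

/-- The trace of a bilinear map with respect to a metric, in an arbitrary basis and in an
orthogonal one. -/
lemma sum_inv_gram_smul {ι ι' : Type*} [Fintype ι] [DecidableEq ι] [Fintype ι'] [DecidableEq ι']
    (b : Module.Basis ι ℝ E) (b' : Module.Basis ι' ℝ E) (A : E →ₗ[ℝ] V) (B : E →ₗ[ℝ] E →ₗ[ℝ] V)
    {d : ι' → ℝ} (hd : ∀ i, d i ≠ 0)
    (h : ∀ i j, inner ℝ (A (b' i)) (A (b' j)) = if i = j then d i else 0) :
    ∑ i, ∑ j, (Matrix.of fun i j => inner ℝ (A (b i)) (A (b j)))⁻¹ i j • B (b i) (b j)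
      = ∑ i, (d i)⁻¹ • B (b' i) (b' i) := by
  set g : Matrix ι ι ℝ := Matrix.of fun i j => inner ℝ (A (b i)) (A (b j)) with hg
  set P := b.toMatrix b' with hP
  set P' := b'.toMatrix b with hP'
  have hPP' : P * P' = 1 := b.toMatrix_mul_toMatrix_flip b'
  have hexp : ∀ i, b' i = ∑ j, P j i • b j := fun i => (b.sum_toMatrix_smul_self b' i).symm
  have hgram : P.transpose * g * P = Matrix.diagonal d := by
    ext i j
    rw [Matrix.diagonal_apply, ← h i j, hexp i, hexp j]
    simp only [map_sum, map_smul, sum_inner, inner_sum, inner_smul_left, inner_smul_right,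
      Matrix.mul_apply, Matrix.transpose_apply, hg, Matrix.of_apply, Finset.sum_mul,
      RCLike.conj_to_real, Finset.mul_sum]
    refine Finset.sum_congr rfl fun x _ => Finset.sum_congr rfl fun y _ => by ring
  have hdd : Matrix.diagonal (fun i => (d i)⁻¹) * Matrix.diagonal d = 1 := by
    rw [Matrix.diagonal_mul_diagonal]
    simp [hd]
  have hinv : g⁻¹ = P * Matrix.diagonal (fun i => (d i)⁻¹) * P.transpose := by
    refine Matrix.inv_eq_left_inv ?_
    calc P * Matrix.diagonal (fun i => (d i)⁻¹) * P.transpose * g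
        = P * Matrix.diagonal (fun i => (d i)⁻¹) * (P.transpose * g * P) * P' := by
          simp only [Matrix.mul_assoc, hPP', Matrix.mul_one]
      _ = 1 := by rw [hgram, Matrix.mul_assoc P, hdd, Matrix.mul_one, hPP']
  rw [hinv]
  have hrhs : ∀ i, (d i)⁻¹ • B (b' i) (b' i)
      = ∑ j, ∑ l, ((d i)⁻¹ * P j i * P l i) • B (b j) (b l) := fun i => by
    rw [hexp i]
    simp only [map_sum, map_smul, LinearMap.sum_apply, LinearMap.smul_apply, Finset.smul_sum,
      smul_smul]
    rw [Finset.sum_comm]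
    refine Finset.sum_congr rfl fun x _ => Finset.sum_congr rfl fun y _ => ?_
    congr 1; ring
  simp only [hrhs]
  rw [Finset.sum_comm (s := (Finset.univ : Finset ι'))]
  refine Finset.sum_congr rfl fun j _ => ?_
  rw [Finset.sum_comm (s := (Finset.univ : Finset ι'))]
  refine Finset.sum_congr rfl fun l _ => ?_
  rw [← Finset.sum_smul, Matrix.mul_apply]
  congr 1
  refine Finset.sum_congr rfl fun i _ => ?_
  rw [Matrix.mul_diagonal, Matrix.transpose_apply]
  ring

/-- An injective linear map into an inner product space has an orthonormal frame. -/
lemma exists_orthonormal_frame [FiniteDimensional ℝ E] (A : E →ₗ[ℝ] V) (hA : Function.Injective A) :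
    ∃ b : Module.Basis (Fin (Module.finrank ℝ E)) ℝ E,
      ∀ i j, inner ℝ (A (b i)) (A (b j)) = if i = j then (1 : ℝ) else 0 := by
  set e := LinearEquiv.ofInjective A hA with he
  have : FiniteDimensional ℝ (LinearMap.range A) := e.finiteDimensional
  have hfr : Module.finrank ℝ (LinearMap.range A) = Module.finrank ℝ E := e.finrank_eq.symm
  let o := (stdOrthonormalBasis ℝ (LinearMap.range A)).reindex (finCongr hfr)
  refine ⟨o.toBasis.map e.symm, fun i j => ?_⟩
  have h1 : ∀ i, A (o.toBasis.map e.symm i) = o i := fun i => by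
    have : (e (o.toBasis.map e.symm i) : V) = o i := by simp
    rw [← this, he, LinearEquiv.ofInjective_apply]
  rw [h1, h1, ← Submodule.coe_inner]
  exact orthonormal_iff_ite.1 o.orthonormal i j

end Frame

section Local

variable {E : Type*} [NormedAddCommGroup E] [NormedSpace ℝ E] [FiniteDimensional ℝ E]
  {H : Type*} [TopologicalSpace H] {I : ModelWithCorners ℝ E H}
  {M : Type*} [TopologicalSpace M] [ChartedSpace H M]
  {V : Type*} [NormedAddCommGroup V] [InnerProductSpace ℝ V]

lemma mem_radialTangentSpan {f : M → V} {x : M} {v : V} :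
    v ∈ radialTangentSpan I f x ↔ ∃ (a : ℝ) (e : E),
      v = a • f x + fderiv ℝ (localRep I f x) (extChartAt I x x) e := by
  set A := fderiv ℝ (localRep I f x) (extChartAt I x x) with hA
  have hspan : Submodule.span ℝ (Set.range (coordTangent I f x))
      = LinearMap.range (A : E →ₗ[ℝ] V) := by
    have h1 : Set.range (coordTangent I f x)
        = (A : E →ₗ[ℝ] V) '' Set.range (Module.finBasis ℝ E) := by
      rw [← Set.range_comp]; rfl
    rw [h1, Submodule.span_image, (Module.finBasis ℝ E).span_eq, Submodule.map_top]
  rw [radialTangentSpan, Submodule.mem_span_insert, hspan]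
  constructor
  · rintro ⟨a, w, ⟨e, rfl⟩, rfl⟩
    exact ⟨a, e, rfl⟩
  · rintro ⟨a, e, rfl⟩
    exact ⟨a, _, ⟨e, rfl⟩, rfl⟩

/-- The mean curvature vanishes if and only if the trace of the Hessian is a combination of the
position vector and a tangent vector. -/
lemma meanCurvature_eq_zero_iff {f : M → V} {x : M} {ι : Type*} [Fintype ι] [DecidableEq ι]
    (b : Module.Basis ι ℝ E) {d : ι → ℝ} (hd : ∀ i, d i ≠ 0)
    (h : ∀ i j, inner ℝ (fderiv ℝ (localRep I f x) (extChartAt I x x) (b i))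
      (fderiv ℝ (localRep I f x) (extChartAt I x x) (b j)) = if i = j then d i else 0) :
    meanCurvature I f x = 0 ↔
      ∑ i, (d i)⁻¹ • fderiv ℝ (fderiv ℝ (localRep I f x)) (extChartAt I x x) (b i) (b i)
        ∈ radialTangentSpan I f x := by
  have h1 := sum_inv_gram_smul (Module.finBasis ℝ E) b
    (fderiv ℝ (localRep I f x) (extChartAt I x x) : E →ₗ[ℝ] V)
    ((ContinuousLinearMap.coeLM ℝ).comp
      (fderiv ℝ (fderiv ℝ (localRep I f x)) (extChartAt I x x) : E →ₗ[ℝ] E →L[ℝ] V)) hd h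
  have h2 : meanCurvature I f x = (radialTangentSpan I f x)ᗮ.starProjection
      (∑ i, (d i)⁻¹ • fderiv ℝ (fderiv ℝ (localRep I f x)) (extChartAt I x x) (b i) (b i)) := by
    refine Eq.trans ?_ (congrArg _ h1)
    simp only [map_sum, map_smul]
    rfl
  rw [h2, Submodule.starProjection_apply_eq_zero_iff, Submodule.orthogonal_orthogonal]

end Local

section LocalRep

variable {E : Type*} [NormedAddCommGroup E] [NormedSpace ℝ E]
  {H : Type*} [TopologicalSpace H] {I : ModelWithCorners ℝ E H}
  {M : Type*} [TopologicalSpace M] [ChartedSpace H M]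

lemma localRep_self {V : Type*} (f : M → V) (x : M) :
    localRep I f x (extChartAt I x x) = f x := by
  simp [localRep]

lemma norm_localRep {V : Type*} [NormedAddCommGroup V] {f : M → V} (hf : ∀ x, ‖f x‖ = 1) (x : M)
    (e : E) : ‖localRep I f x e‖ = 1 := hf _

variable {V : Type*} [NormedAddCommGroup V] [InnerProductSpace ℝ V]

lemma contDiffAt_localRep [I.Boundaryless] {f : M → V} (hf : ContMDiff I 𝓘(ℝ, V) ∞ f) (x : M) :
    ContDiffAt ℝ ∞ (localRep I f x) (extChartAt I x x) := by
  have h := (contMDiffAt_iff.1 (hf x)).2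
  rw [I.range_eq_univ, contDiffWithinAt_univ] at h
  exact h

lemma mfderiv_eq_fderiv_localRep [I.Boundaryless] {f : M → V} (hf : ContMDiff I 𝓘(ℝ, V) ∞ f)
    (x : M) : mfderiv I 𝓘(ℝ, V) f x = fderiv ℝ (localRep I f x) (extChartAt I x x) := by
  refine (hf.mdifferentiable (by simp) x).mfderiv.trans ?_
  have h : fderivWithin ℝ (writtenInExtChartAt I 𝓘(ℝ, V) x f) (Set.range I) (extChartAt I x x)
      = fderiv ℝ (localRep I f x) (extChartAt I x x) := by
    rw [I.range_eq_univ, fderivWithin_univ]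
    rfl
  exact h

end LocalRep


section Sphere

variable {E : Type*} [NormedAddCommGroup E] [NormedSpace ℝ E]
  {V : Type*} [NormedAddCommGroup V] [InnerProductSpace ℝ V]

lemma inner_fderiv_eq_zero {φ : E → V} (hφ : ∀ e, ‖φ e‖ = 1) {z : E}
    (hd : DifferentiableAt ℝ φ z) (v : E) : inner ℝ (φ z) (fderiv ℝ φ z v) = 0 := by
  have h1 : HasFDerivAt (fun e => inner ℝ (φ e) (φ e)) _ z :=
    hd.hasFDerivAt.inner ℝ hd.hasFDerivAt
  have h2 : (fun e => (inner ℝ (φ e) (φ e) : ℝ)) = fun _ => 1 := by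
    ext e; rw [real_inner_self_eq_norm_sq, hφ, one_pow]
  rw [h2] at h1
  have h3 := congrArg (fun L : E →L[ℝ] ℝ => L v) (h1.unique (hasFDerivAt_const 1 z))
  simpa [fderivInnerCLM_apply, real_inner_comm] using h3

lemma fderiv_fderiv_apply {φ : E → V} {z : E} (hφ : ContDiffAt ℝ ∞ φ z) (v w : E) :
    fderiv ℝ (fderiv ℝ φ) z v w = fderiv ℝ (fun e => fderiv ℝ φ e w) z v := by
  have h : DifferentiableAt ℝ (fderiv ℝ φ) z :=
    (hφ.fderiv_right (m := 1) (WithTop.coe_le_coe.2 le_top)).differentiableAt one_ne_zero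
  rw [fderiv_clm_apply h (differentiableAt_const w)]
  simp

lemma inner_fderiv_fderiv {φ : E → V} (hφ : ∀ e, ‖φ e‖ = 1) {z : E} (hc : ContDiffAt ℝ ∞ φ z)
    (v : E) : inner ℝ (φ z) (fderiv ℝ (fderiv ℝ φ) z v v)
      = - inner ℝ (fderiv ℝ φ z v) (fderiv ℝ φ z v) := by
  have hev : ∀ᶠ e in nhds z, DifferentiableAt ℝ φ e :=
    ((hc.of_le (m := 1) (by exact_mod_cast le_top)).eventually (by simp)).mono
      fun e he => he.differentiableAt one_ne_zero
  have hz : (fun e => (inner ℝ (φ e) (fderiv ℝ φ e v) : ℝ)) =ᶠ[nhds z] fun _ => 0 :=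
    hev.mono fun e he => inner_fderiv_eq_zero hφ he v
  have hd := hev.self_of_nhds
  have hd2 : DifferentiableAt ℝ (fun e => fderiv ℝ φ e v) z :=
    ((hc.fderiv_right (m := 1) (WithTop.coe_le_coe.2 le_top)).differentiableAt one_ne_zero).clm_apply
      (differentiableAt_const v)
  have h1 := hd.hasFDerivAt.inner ℝ hd2.hasFDerivAt
  have h3 := congrArg (fun L : E →L[ℝ] ℝ => L v)
    ((h1.congr_of_eventuallyEq hz.symm).unique (hasFDerivAt_const 0 z))
  simp only [ContinuousLinearMap.comp_apply, fderivInnerCLM_apply,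
    ContinuousLinearMap.prod_apply, zero_apply] at h3
  rw [fderiv_fderiv_apply hc]
  linarith

end Sphere

/-! ### Minimality of the product map -/

section Germ

variable {E : Type*} [NormedAddCommGroup E] [NormedSpace ℝ E]
  {V : Type*} [NormedAddCommGroup V] [InnerProductSpace ℝ V]

/-- `φ` maps into the unit sphere, and is a minimal immersion at `z`: in an orthonormal frame, the
trace of its Hessian is `-dim E • φ z`, up to a tangent vector. -/
structure IsMinimalGerm (φ : E → V) (z : E) : Prop where
  norm_eq_one : ∀ e, ‖φ e‖ = 1
  contDiffAt : ContDiffAt ℝ ∞ φ z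
  injective : Function.Injective (fderiv ℝ φ z)
  trace_eq : ∃ b : Module.Basis (Fin (Module.finrank ℝ E)) ℝ E,
    (∀ i j, inner ℝ (fderiv ℝ φ z (b i)) (fderiv ℝ φ z (b j)) = if i = j then (1 : ℝ) else 0) ∧
    ∃ w, ∑ i, fderiv ℝ (fderiv ℝ φ) z (b i) (b i)
      = -(Module.finrank ℝ E : ℝ) • φ z + fderiv ℝ φ z w

lemma IsSphericalMinimalImmersion.isMinimalGerm [FiniteDimensional ℝ E]
    {H : Type*} [TopologicalSpace H] {I : ModelWithCorners ℝ E H} [I.Boundaryless]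
    {M : Type*} [TopologicalSpace M] [ChartedSpace H M] {f : M → V}
    (hf : IsSphericalMinimalImmersion I f) (x : M) :
    IsMinimalGerm (localRep I f x) (extChartAt I x x) := by
  have hn := fun e => norm_localRep (I := I) hf.1.2.2 x e
  have hc := contDiffAt_localRep hf.1.1 x
  have hinj : Function.Injective (fderiv ℝ (localRep I f x) (extChartAt I x x)) := by
    have := hf.1.2.1 x
    rwa [mfderiv_eq_fderiv_localRep hf.1.1 x] at this
  refine ⟨hn, hc, hinj, ?_⟩
  obtain ⟨b, hb⟩ := exists_orthonormal_frame
    (fderiv ℝ (localRep I f x) (extChartAt I x x) : E →ₗ[ℝ] V) hinj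
  refine ⟨b, hb, ?_⟩
  obtain ⟨a, w, h⟩ := mem_radialTangentSpan.1
    ((meanCurvature_eq_zero_iff b (d := fun _ => 1) (fun _ => one_ne_zero) hb).1 (hf.2 x))
  simp only [inv_one, one_smul] at h
  have hd := hc.differentiableAt (by simp)
  have h1 := congrArg (fun v => inner ℝ (localRep I f x (extChartAt I x x)) v) h
  simp only [inner_sum, inner_fderiv_fderiv hn hc, inner_add_right, inner_smul_right,
    inner_fderiv_eq_zero hn hd, ← localRep_self (I := I) f x, real_inner_self_eq_norm_sq, hn] at h1
  have h2 : ∀ i, ‖fderiv ℝ (localRep I f x) (extChartAt I x x) (b i)‖ ^ 2 = 1 := fun i => by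
    rw [← real_inner_self_eq_norm_sq]; exact (hb i i).trans (if_pos rfl)
  simp only [h2] at h1
  refine ⟨w, h.trans ?_⟩
  rw [localRep_self]
  congr 2
  simpa using h1.symm

end Germ

section Component

variable {P : Type*} [NormedAddCommGroup P] [NormedSpace ℝ P]
  {E : Type*} [NormedAddCommGroup E] [NormedSpace ℝ E]
  {V : Type*} [NormedAddCommGroup V] [InnerProductSpace ℂ V] [InnerProductSpace ℝ V]
  [IsScalarTower ℝ ℂ V]

lemma hasFDerivAt_smul_comp {g : ℝ → ℂ} {φ : E → V} (τ : P →L[ℝ] ℝ) (π : P →L[ℝ] E) {p : P}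
    (hg : DifferentiableAt ℝ g (τ p)) (hφ : DifferentiableAt ℝ φ (π p)) :
    HasFDerivAt (fun q => g (τ q) • φ (π q))
      (g (τ p) • (fderiv ℝ φ (π p)).comp π +
        (τ.smulRight (deriv g (τ p))).smulRight (φ (π p))) p := by
  have h1 : HasFDerivAt (fun q => g (τ q)) (τ.smulRight (deriv g (τ p))) p := by
    have := hg.hasDerivAt.hasFDerivAt.comp p τ.hasFDerivAt
    refine this.congr_fderiv ?_
    ext v
    simp
  exact h1.smul (hφ.hasFDerivAt.comp p π.hasFDerivAt)

lemma fderiv_smul_comp_apply {g : ℝ → ℂ} {φ : E → V} (τ : P →L[ℝ] ℝ) (π : P →L[ℝ] E) {p : P}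
    (hg : DifferentiableAt ℝ g (τ p)) (hφ : DifferentiableAt ℝ φ (π p)) (v : P) :
    fderiv ℝ (fun q => g (τ q) • φ (π q)) p v
      = g (τ p) • fderiv ℝ φ (π p) (π v) + ((τ v : ℂ) * deriv g (τ p)) • φ (π p) := by
  rw [(hasFDerivAt_smul_comp τ π hg hφ).fderiv]
  simp

lemma contDiffAt_smul_comp {g : ℝ → ℂ} {φ : E → V} (τ : P →L[ℝ] ℝ) (π : P →L[ℝ] E) {p : P}
    (hg : ContDiff ℝ ∞ g) (hφ : ContDiffAt ℝ ∞ φ (π p)) :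
    ContDiffAt ℝ ∞ (fun q => g (τ q) • φ (π q)) p :=
  (hg.contDiffAt.comp p τ.contDiff.contDiffAt).smul (hφ.comp p π.contDiff.contDiffAt)

lemma fderiv_fderiv_smul_comp_apply {g : ℝ → ℂ} {φ : E → V} (τ : P →L[ℝ] ℝ) (π : P →L[ℝ] E)
    {p : P} (hg : ContDiff ℝ ∞ g) (hφ : ContDiffAt ℝ ∞ φ (π p)) (v : P) :
    fderiv ℝ (fderiv ℝ fun q => g (τ q) • φ (π q)) p v v
      = g (τ p) • fderiv ℝ (fderiv ℝ φ) (π p) (π v) (π v)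
        + (2 * (τ v : ℂ) * deriv g (τ p)) • fderiv ℝ φ (π p) (π v)
        + ((τ v : ℂ) ^ 2 * deriv (deriv g) (τ p)) • φ (π p) := by
  have hg' : ContDiff ℝ ∞ (deriv g) := (contDiff_infty_iff_deriv.1 hg).2
  have hgd : Differentiable ℝ g := hg.differentiable (by simp)
  have hev : ∀ᶠ e in nhds (π p), DifferentiableAt ℝ φ e :=
    ((hφ.of_le (m := 1) (by exact_mod_cast le_top)).eventually (by simp)).mono
      fun e he => he.differentiableAt one_ne_zero
  have hD : DifferentiableAt ℝ (fun e => fderiv ℝ φ e (π v)) (π p) :=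
    ((hφ.fderiv_right (m := 1) (WithTop.coe_le_coe.2 le_top)).differentiableAt
      one_ne_zero).clm_apply (differentiableAt_const _)
  have hφd := hev.self_of_nhds
  rw [fderiv_fderiv_apply (contDiffAt_smul_comp τ π hg hφ)]
  have h1 : (fun q => fderiv ℝ (fun q => g (τ q) • φ (π q)) q v) =ᶠ[nhds p]
      fun q => g (τ q) • fderiv ℝ φ (π q) (π v) + (τ v : ℂ) • deriv g (τ q) • φ (π q) := by
    filter_upwards [π.continuous.continuousAt.eventually hev] with q hq
    rw [fderiv_smul_comp_apply τ π (hgd _) hq, mul_smul]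
  rw [h1.fderiv_eq]
  have h2 := (hasFDerivAt_smul_comp τ π (hgd (τ p)) hD)
  have h3 := hasFDerivAt_smul_comp τ π ((hg'.differentiable (by simp)) (τ p)) hφd
  refine (congrArg (fun L : P →L[ℝ] V => L v)
    (h2.add (h3.const_smul (τ v : ℂ))).fderiv).trans ?_
  simp only [add_apply, smul_apply, ContinuousLinearMap.comp_apply,
    ContinuousLinearMap.smulRight_apply, fderiv_fderiv_apply hφ, Complex.real_smul]
  module

end Component

section ToLp

variable {P : Type*} [NormedAddCommGroup P] [NormedSpace ℝ P]
  {V₁ V₂ : Type*} [NormedAddCommGroup V₁] [InnerProductSpace ℝ V₁]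
  [NormedAddCommGroup V₂] [InnerProductSpace ℝ V₂]

lemma contDiffAt_toLp {c₁ : P → V₁} {c₂ : P → V₂} {p : P} (h₁ : ContDiffAt ℝ ∞ c₁ p)
    (h₂ : ContDiffAt ℝ ∞ c₂ p) : ContDiffAt ℝ ∞ (fun q => WithLp.toLp 2 (c₁ q, c₂ q)) p :=
  (WithLp.prodContinuousLinearEquiv 2 ℝ V₁ V₂).symm.contDiff.contDiffAt.comp p (h₁.prodMk h₂)

lemma fderiv_toLp_apply {c₁ : P → V₁} {c₂ : P → V₂} {p : P} (h₁ : DifferentiableAt ℝ c₁ p)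
    (h₂ : DifferentiableAt ℝ c₂ p) (v : P) :
    fderiv ℝ (fun q => WithLp.toLp 2 (c₁ q, c₂ q)) p v
      = WithLp.toLp 2 (fderiv ℝ c₁ p v, fderiv ℝ c₂ p v) := by
  have h := ((WithLp.prodContinuousLinearEquiv 2 ℝ V₁ V₂).symm.hasFDerivAt).comp p
    (h₁.hasFDerivAt.prodMk h₂.hasFDerivAt)
  exact congrArg (fun L : P →L[ℝ] WithLp 2 (V₁ × V₂) => L v) h.fderiv

lemma fderiv_fderiv_toLp_apply {c₁ : P → V₁} {c₂ : P → V₂} {p : P} (h₁ : ContDiffAt ℝ ∞ c₁ p)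
    (h₂ : ContDiffAt ℝ ∞ c₂ p) (v : P) :
    fderiv ℝ (fderiv ℝ fun q => WithLp.toLp 2 (c₁ q, c₂ q)) p v v
      = WithLp.toLp 2 (fderiv ℝ (fderiv ℝ c₁) p v v, fderiv ℝ (fderiv ℝ c₂) p v v) := by
  rw [fderiv_fderiv_apply (contDiffAt_toLp h₁ h₂), fderiv_fderiv_apply h₁, fderiv_fderiv_apply h₂]
  have hev : ∀ᶠ q in nhds p, DifferentiableAt ℝ c₁ q ∧ DifferentiableAt ℝ c₂ q :=
    (((h₁.of_le (m := 1) (by exact_mod_cast le_top)).eventually (by simp)).and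
      ((h₂.of_le (m := 1) (by exact_mod_cast le_top)).eventually (by simp))).mono
      fun e he => ⟨he.1.differentiableAt one_ne_zero, he.2.differentiableAt one_ne_zero⟩
  have h : (fun q => fderiv ℝ (fun q => WithLp.toLp 2 (c₁ q, c₂ q)) q v) =ᶠ[nhds p]
      fun q => WithLp.toLp 2 (fderiv ℝ c₁ q v, fderiv ℝ c₂ q v) :=
    hev.mono fun q hq => fderiv_toLp_apply hq.1 hq.2 v
  rw [h.fderiv_eq, fderiv_toLp_apply]
  · exact ((h₁.fderiv_right (m := 1) (WithTop.coe_le_coe.2 le_top)).differentiableAt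
      one_ne_zero).clm_apply (differentiableAt_const _)
  · exact ((h₂.fderiv_right (m := 1) (WithTop.coe_le_coe.2 le_top)).differentiableAt
      one_ne_zero).clm_apply (differentiableAt_const _)

end ToLp

section Product

variable {E₁ : Type*} [NormedAddCommGroup E₁] [NormedSpace ℝ E₁]
  {E₂ : Type*} [NormedAddCommGroup E₂] [NormedSpace ℝ E₂]
  {V₁ : Type*} [NormedAddCommGroup V₁] [InnerProductSpace ℂ V₁] [InnerProductSpace ℝ V₁]
  [IsScalarTower ℝ ℂ V₁]
  {V₂ : Type*} [NormedAddCommGroup V₂] [InnerProductSpace ℂ V₂] [InnerProductSpace ℝ V₂]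
  [IsScalarTower ℝ ℂ V₂]

lemma contDiffAt_gammaProduct {γ : ℝ → ℂ × ℂ} {φ₁ : E₁ → V₁} {φ₂ : E₂ → V₂}
    {p : ℝ × E₁ × E₂} (hg₁ : ContDiff ℝ ∞ fun t => (γ t).1) (hg₂ : ContDiff ℝ ∞ fun t => (γ t).2)
    (h₁ : ContDiffAt ℝ ∞ φ₁ p.2.1) (h₂ : ContDiffAt ℝ ∞ φ₂ p.2.2) :
    ContDiffAt ℝ ∞ (gammaProduct γ φ₁ φ₂) p :=
  contDiffAt_toLp
    (contDiffAt_smul_comp (p := p) (ContinuousLinearMap.fst ℝ ℝ (E₁ × E₂))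
      ((ContinuousLinearMap.fst ℝ E₁ E₂).comp (ContinuousLinearMap.snd ℝ ℝ (E₁ × E₂))) hg₁ h₁)
    (contDiffAt_smul_comp (p := p) (ContinuousLinearMap.fst ℝ ℝ (E₁ × E₂))
      ((ContinuousLinearMap.snd ℝ E₁ E₂).comp (ContinuousLinearMap.snd ℝ ℝ (E₁ × E₂))) hg₂ h₂)

lemma fderiv_gammaProduct_apply {γ : ℝ → ℂ × ℂ} {φ₁ : E₁ → V₁} {φ₂ : E₂ → V₂} {p : ℝ × E₁ × E₂}
    (hg₁ : DifferentiableAt ℝ (fun t => (γ t).1) p.1)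
    (hg₂ : DifferentiableAt ℝ (fun t => (γ t).2) p.1)
    (h₁ : DifferentiableAt ℝ φ₁ p.2.1) (h₂ : DifferentiableAt ℝ φ₂ p.2.2) (v : ℝ × E₁ × E₂) :
    fderiv ℝ (gammaProduct γ φ₁ φ₂) p v = WithLp.toLp 2
      ((γ p.1).1 • fderiv ℝ φ₁ p.2.1 v.2.1 + ((v.1 : ℂ) * deriv (fun t => (γ t).1) p.1) • φ₁ p.2.1,
      (γ p.1).2 • fderiv ℝ φ₂ p.2.2 v.2.2
        + ((v.1 : ℂ) * deriv (fun t => (γ t).2) p.1) • φ₂ p.2.2) := by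
  have e₁ := hasFDerivAt_smul_comp (ContinuousLinearMap.fst ℝ ℝ (E₁ × E₂))
    ((ContinuousLinearMap.fst ℝ E₁ E₂).comp (ContinuousLinearMap.snd ℝ ℝ (E₁ × E₂))) hg₁ h₁
  have e₂ := hasFDerivAt_smul_comp (ContinuousLinearMap.fst ℝ ℝ (E₁ × E₂))
    ((ContinuousLinearMap.snd ℝ E₁ E₂).comp (ContinuousLinearMap.snd ℝ ℝ (E₁ × E₂))) hg₂ h₂
  refine (fderiv_toLp_apply e₁.differentiableAt e₂.differentiableAt v).trans ?_
  have d₁ := fderiv_smul_comp_apply (g := fun t => (γ t).1) (p := p) (ContinuousLinearMap.fst ℝ ℝ (E₁ × E₂))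
    ((ContinuousLinearMap.fst ℝ E₁ E₂).comp (ContinuousLinearMap.snd ℝ ℝ (E₁ × E₂))) hg₁ h₁ v
  have d₂ := fderiv_smul_comp_apply (g := fun t => (γ t).2) (p := p) (ContinuousLinearMap.fst ℝ ℝ (E₁ × E₂))
    ((ContinuousLinearMap.snd ℝ E₁ E₂).comp (ContinuousLinearMap.snd ℝ ℝ (E₁ × E₂))) hg₂ h₂ v
  exact congrArg (WithLp.toLp 2) (Prod.ext d₁ d₂)

lemma fderiv_fderiv_gammaProduct_apply {γ : ℝ → ℂ × ℂ} {φ₁ : E₁ → V₁} {φ₂ : E₂ → V₂}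
    {p : ℝ × E₁ × E₂} (hg₁ : ContDiff ℝ ∞ fun t => (γ t).1) (hg₂ : ContDiff ℝ ∞ fun t => (γ t).2)
    (h₁ : ContDiffAt ℝ ∞ φ₁ p.2.1) (h₂ : ContDiffAt ℝ ∞ φ₂ p.2.2) (v : ℝ × E₁ × E₂) :
    fderiv ℝ (fderiv ℝ (gammaProduct γ φ₁ φ₂)) p v v = WithLp.toLp 2
      ((γ p.1).1 • fderiv ℝ (fderiv ℝ φ₁) p.2.1 v.2.1 v.2.1
        + (2 * (v.1 : ℂ) * deriv (fun t => (γ t).1) p.1) • fderiv ℝ φ₁ p.2.1 v.2.1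
        + ((v.1 : ℂ) ^ 2 * deriv (deriv fun t => (γ t).1) p.1) • φ₁ p.2.1,
      (γ p.1).2 • fderiv ℝ (fderiv ℝ φ₂) p.2.2 v.2.2 v.2.2
        + (2 * (v.1 : ℂ) * deriv (fun t => (γ t).2) p.1) • fderiv ℝ φ₂ p.2.2 v.2.2
        + ((v.1 : ℂ) ^ 2 * deriv (deriv fun t => (γ t).2) p.1) • φ₂ p.2.2) := by
  have e₁ := contDiffAt_smul_comp (p := p) (ContinuousLinearMap.fst ℝ ℝ (E₁ × E₂))
    ((ContinuousLinearMap.fst ℝ E₁ E₂).comp (ContinuousLinearMap.snd ℝ ℝ (E₁ × E₂))) hg₁ h₁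
  have e₂ := contDiffAt_smul_comp (p := p) (ContinuousLinearMap.fst ℝ ℝ (E₁ × E₂))
    ((ContinuousLinearMap.snd ℝ E₁ E₂).comp (ContinuousLinearMap.snd ℝ ℝ (E₁ × E₂))) hg₂ h₂
  refine (fderiv_fderiv_toLp_apply e₁ e₂ v).trans ?_
  have d₁ := fderiv_fderiv_smul_comp_apply (g := fun t => (γ t).1) (p := p) (ContinuousLinearMap.fst ℝ ℝ (E₁ × E₂))
    ((ContinuousLinearMap.fst ℝ E₁ E₂).comp (ContinuousLinearMap.snd ℝ ℝ (E₁ × E₂))) hg₁ h₁ v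
  have d₂ := fderiv_fderiv_smul_comp_apply (g := fun t => (γ t).2) (p := p) (ContinuousLinearMap.fst ℝ ℝ (E₁ × E₂))
    ((ContinuousLinearMap.snd ℝ E₁ E₂).comp (ContinuousLinearMap.snd ℝ ℝ (E₁ × E₂))) hg₂ h₂ v
  exact congrArg (WithLp.toLp 2) (Prod.ext d₁ d₂)

lemma real_inner_smul_add_smul {V : Type*} [NormedAddCommGroup V] [InnerProductSpace ℂ V]
    [InnerProductSpace ℝ V] (hV : ∀ x y : V, inner ℝ x y = (inner ℂ x y).re) {g g' : ℂ}
    {u w w' : V} (hu : ‖u‖ = 1) (hw : inner ℂ u w = 0) (hw' : inner ℂ u w' = 0) (s s' : ℝ) :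
    inner ℝ (g • w + ((s : ℂ) * g') • u) (g • w' + ((s' : ℂ) * g') • u)
      = ‖g‖ ^ 2 * inner ℝ w w' + s * s' * ‖g'‖ ^ 2 := by
  have hw2 : inner ℂ w u = 0 := by rw [← inner_conj_symm, hw, map_zero]
  have e1 : g * (starRingEnd ℂ g * inner ℂ w w') = ((‖g‖ ^ 2 : ℝ) : ℂ) * inner ℂ w w' := by
    rw [← mul_assoc, Complex.mul_conj, Complex.normSq_eq_norm_sq]
  have e2 : (s' : ℂ) * g' * (s * starRingEnd ℂ g') = ((s * s' * ‖g'‖ ^ 2 : ℝ) : ℂ) := by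
    push_cast
    rw [show (s' : ℂ) * g' * (s * starRingEnd ℂ g') = s * s' * (g' * starRingEnd ℂ g') by ring,
      Complex.mul_conj, Complex.normSq_eq_norm_sq]
    push_cast
    ring
  rw [hV, hV]
  simp only [inner_add_left, inner_add_right, inner_smul_left, inner_smul_right, hw', hw2,
    inner_self_eq_norm_sq_to_K, hu, map_mul, Complex.conj_ofReal, mul_zero, add_zero, zero_add]
  have e3 : (s' : ℂ) * g' * (↑s * (starRingEnd ℂ) g' * ((1 : ℝ) : ℂ) ^ 2)
    = ((s * s' * ‖g'‖ ^ 2 : ℝ) : ℂ) := by rw [← e2]; push_cast; ring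
  erw [e1, e3]
  rw [Complex.add_re, Complex.re_ofReal_mul, Complex.ofReal_re]

lemma inner_fderiv_gammaProduct (hV₁ : ∀ x y : V₁, inner ℝ x y = (inner ℂ x y).re)
    (hV₂ : ∀ x y : V₂, inner ℝ x y = (inner ℂ x y).re)
    {γ : ℝ → ℂ × ℂ} {φ₁ : E₁ → V₁} {φ₂ : E₂ → V₂} {p : ℝ × E₁ × E₂}
    (hg₁ : DifferentiableAt ℝ (fun t => (γ t).1) p.1)
    (hg₂ : DifferentiableAt ℝ (fun t => (γ t).2) p.1)
    (h₁ : DifferentiableAt ℝ φ₁ p.2.1) (h₂ : DifferentiableAt ℝ φ₂ p.2.2)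
    (n₁ : ‖φ₁ p.2.1‖ = 1) (n₂ : ‖φ₂ p.2.2‖ = 1)
    (r₁ : ∀ w, inner ℂ (φ₁ p.2.1) (fderiv ℝ φ₁ p.2.1 w) = 0)
    (r₂ : ∀ w, inner ℂ (φ₂ p.2.2) (fderiv ℝ φ₂ p.2.2 w) = 0) (v w : ℝ × E₁ × E₂) :
    inner ℝ (fderiv ℝ (gammaProduct γ φ₁ φ₂) p v) (fderiv ℝ (gammaProduct γ φ₁ φ₂) p w)
      = v.1 * w.1 * (‖deriv (fun t => (γ t).1) p.1‖ ^ 2 + ‖deriv (fun t => (γ t).2) p.1‖ ^ 2)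
        + ‖(γ p.1).1‖ ^ 2 * inner ℝ (fderiv ℝ φ₁ p.2.1 v.2.1) (fderiv ℝ φ₁ p.2.1 w.2.1)
        + ‖(γ p.1).2‖ ^ 2 * inner ℝ (fderiv ℝ φ₂ p.2.2 v.2.2) (fderiv ℝ φ₂ p.2.2 w.2.2) := by
  rw [fderiv_gammaProduct_apply hg₁ hg₂ h₁ h₂, fderiv_gammaProduct_apply hg₁ hg₂ h₁ h₂,
    WithLp.prod_inner_apply, real_inner_smul_add_smul hV₁ n₁ (r₁ _) (r₁ _),
    real_inner_smul_add_smul hV₂ n₂ (r₂ _) (r₂ _)]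
  ring

end Product

section ProductGerm

lemma smul_add_smul_trace {V : Type*} [NormedAddCommGroup V] [InnerProductSpace ℂ V]
    [InnerProductSpace ℝ V] [IsScalarTower ℝ ℂ V] {g g' g'' : ℂ} {u v w : V} {k e a b : ℝ}
    (hg : ‖g‖ ≠ 0) (he : e ≠ 0)
    (h : g'' = ((k * e / ‖g‖ ^ 2 + a : ℝ) : ℂ) * g + b * g') (hv : v = -k • u + w) :
    e⁻¹ • g'' • u + (‖g‖ ^ 2)⁻¹ • g • v
      = (a / e) • g • u + (g • (‖g‖ ^ 2)⁻¹ • w + ((b : ℂ) / e * g') • u) := by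
  have hs : ∀ (r : ℝ) (z : V), r • z = (r : ℂ) • z := fun r z => (algebraMap_smul ℂ r z).symm
  have hg' : (‖g‖ : ℂ) ≠ 0 := by exact_mod_cast hg
  have he' : (e : ℂ) ≠ 0 := by exact_mod_cast he
  rw [h, hv]
  simp only [hs]
  push_cast
  match_scalars
  · field_simp
    ring
  · ring

variable {E₁ : Type*} [NormedAddCommGroup E₁] [NormedSpace ℝ E₁]
  {E₂ : Type*} [NormedAddCommGroup E₂] [NormedSpace ℝ E₂]
  {V₁ : Type*} [NormedAddCommGroup V₁] [InnerProductSpace ℂ V₁] [InnerProductSpace ℝ V₁]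
  [IsScalarTower ℝ ℂ V₁]
  {V₂ : Type*} [NormedAddCommGroup V₂] [InnerProductSpace ℂ V₂] [InnerProductSpace ℝ V₂]
  [IsScalarTower ℝ ℂ V₂]
  {γ : ℝ → ℂ × ℂ} {φ₁ : E₁ → V₁} {φ₂ : E₂ → V₂} {z₁ : E₁} {z₂ : E₂}

lemma injective_fderiv_gammaProduct (hV₁ : ∀ x y : V₁, inner ℝ x y = (inner ℂ x y).re)
    (hV₂ : ∀ x y : V₂, inner ℝ x y = (inner ℂ x y).re) {k₁ k₂ : ℕ}
    (hγ : IsMinimalProfile k₁ k₂ (fun t => (γ t).1) (fun t => (γ t).2))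
    (h₁ : IsMinimalGerm φ₁ z₁) (h₂ : IsMinimalGerm φ₂ z₂)
    (r₁ : ∀ w, inner ℂ (φ₁ z₁) (fderiv ℝ φ₁ z₁ w) = 0)
    (r₂ : ∀ w, inner ℂ (φ₂ z₂) (fderiv ℝ φ₂ z₂ w) = 0) (t : ℝ) :
    Function.Injective (fderiv ℝ (gammaProduct γ φ₁ φ₂) (t, z₁, z₂)) := by
  rw [injective_iff_map_eq_zero]
  rintro ⟨s, v₁, v₂⟩ h
  have h0 := inner_fderiv_gammaProduct hV₁ hV₂ (p := (t, z₁, z₂))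
    ((hγ.contDiff₁.differentiable (by simp)) t) ((hγ.contDiff₂.differentiable (by simp)) t)
    (h₁.contDiffAt.differentiableAt (by simp)) (h₂.contDiffAt.differentiableAt (by simp))
    (h₁.norm_eq_one _) (h₂.norm_eq_one _) r₁ r₂ (s, v₁, v₂) (s, v₁, v₂)
  rw [h, inner_zero_left] at h0
  simp only [real_inner_self_eq_norm_sq] at h0
  have hE := hγ.speed_pos t
  have n₁ : 0 < ‖(γ t).1‖ := norm_pos_iff.2 (hγ.ne_zero₁ t)
  have n₂ : 0 < ‖(γ t).2‖ := norm_pos_iff.2 (hγ.ne_zero₂ t)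
  have p0 := mul_nonneg (mul_self_nonneg s) hE.le
  have p1 := mul_nonneg (sq_nonneg ‖(γ t).1‖) (sq_nonneg ‖fderiv ℝ φ₁ z₁ v₁‖)
  have p2 := mul_nonneg (sq_nonneg ‖(γ t).2‖) (sq_nonneg ‖fderiv ℝ φ₂ z₂ v₂‖)
  have q0 : s * s * (‖deriv (fun t => (γ t).1) t‖ ^ 2 + ‖deriv (fun t => (γ t).2) t‖ ^ 2) = 0 := by
    linarith
  have q1 : ‖(γ t).1‖ ^ 2 * ‖fderiv ℝ φ₁ z₁ v₁‖ ^ 2 = 0 := by linarith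
  have q2 : ‖(γ t).2‖ ^ 2 * ‖fderiv ℝ φ₂ z₂ v₂‖ ^ 2 = 0 := by linarith
  have w1 : fderiv ℝ φ₁ z₁ v₁ = 0 := by simpa [n₁.ne'] using q1
  have w2 : fderiv ℝ φ₂ z₂ v₂ = 0 := by simpa [n₂.ne'] using q2
  have s0 : s = 0 := by simpa [hE.ne'] using q0
  rw [s0, (map_eq_zero_iff _ h₁.injective).1 w1, (map_eq_zero_iff _ h₂.injective).1 w2]
  rfl

lemma exists_frame_gammaProduct (hV₁ : ∀ x y : V₁, inner ℝ x y = (inner ℂ x y).re)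
    (hV₂ : ∀ x y : V₂, inner ℝ x y = (inner ℂ x y).re)
    (hγ : IsMinimalProfile (Module.finrank ℝ E₁) (Module.finrank ℝ E₂)
      (fun t => (γ t).1) (fun t => (γ t).2))
    (h₁ : IsMinimalGerm φ₁ z₁) (h₂ : IsMinimalGerm φ₂ z₂)
    (r₁ : ∀ w, inner ℂ (φ₁ z₁) (fderiv ℝ φ₁ z₁ w) = 0)
    (r₂ : ∀ w, inner ℂ (φ₂ z₂) (fderiv ℝ φ₂ z₂ w) = 0) (t : ℝ) :
    ∃ (b : Module.Basis (Unit ⊕ Fin (Module.finrank ℝ E₁) ⊕ Fin (Module.finrank ℝ E₂)) ℝ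
        (ℝ × E₁ × E₂)) (d : Unit ⊕ Fin (Module.finrank ℝ E₁) ⊕ Fin (Module.finrank ℝ E₂) → ℝ),
      (∀ i, d i ≠ 0) ∧
      (∀ i j, inner ℝ (fderiv ℝ (gammaProduct γ φ₁ φ₂) (t, z₁, z₂) (b i))
        (fderiv ℝ (gammaProduct γ φ₁ φ₂) (t, z₁, z₂) (b j)) = if i = j then d i else 0) ∧
      ∃ (a : ℝ) (w : ℝ × E₁ × E₂),
        ∑ i, (d i)⁻¹ • fderiv ℝ (fderiv ℝ (gammaProduct γ φ₁ φ₂)) (t, z₁, z₂) (b i) (b i)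
          = a • gammaProduct γ φ₁ φ₂ (t, z₁, z₂)
            + fderiv ℝ (gammaProduct γ φ₁ φ₂) (t, z₁, z₂) w := by
  obtain ⟨b₁, ho₁, w₁, ht₁⟩ := h₁.trace_eq
  obtain ⟨b₂, ho₂, w₂, ht₂⟩ := h₂.trace_eq
  obtain ⟨a, b, he₁, he₂⟩ := hγ.equation t
  have hin := inner_fderiv_gammaProduct hV₁ hV₂ (p := (t, z₁, z₂))
    ((hγ.contDiff₁.differentiable (by simp)) t) ((hγ.contDiff₂.differentiable (by simp)) t)
    (h₁.contDiffAt.differentiableAt (by simp)) (h₂.contDiffAt.differentiableAt (by simp))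
    (h₁.norm_eq_one _) (h₂.norm_eq_one _) r₁ r₂
  have hder := fderiv_gammaProduct_apply (p := (t, z₁, z₂))
    ((hγ.contDiff₁.differentiable (by simp)) t) ((hγ.contDiff₂.differentiable (by simp)) t)
    (h₁.contDiffAt.differentiableAt (by simp)) (h₂.contDiffAt.differentiableAt (by simp))
  have hder2 := fderiv_fderiv_gammaProduct_apply (p := (t, z₁, z₂)) hγ.contDiff₁ hγ.contDiff₂
    h₁.contDiffAt h₂.contDiffAt
  have hE := hγ.speed_pos t
  have n₁ : 0 < ‖(γ t).1‖ := norm_pos_iff.2 (hγ.ne_zero₁ t)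
  have n₂ : 0 < ‖(γ t).2‖ := norm_pos_iff.2 (hγ.ne_zero₂ t)
  set e : ℝ := ‖deriv (fun t => (γ t).1) t‖ ^ 2 + ‖deriv (fun t => (γ t).2) t‖ ^ 2 with hedef
  refine ⟨(Module.Basis.singleton Unit ℝ).prod (b₁.prod b₂),
    Sum.elim (fun _ => e) (Sum.elim (fun _ => ‖(γ t).1‖ ^ 2) fun _ => ‖(γ t).2‖ ^ 2), ?_, ?_,
    a / e, (b / e, (‖(γ t).1‖ ^ 2)⁻¹ • w₁, (‖(γ t).2‖ ^ 2)⁻¹ • w₂), ?_⟩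
  · rintro (i | i | i) <;> simp [hE.ne', n₁.ne', n₂.ne']
  · rintro (i | i | i) (j | j | j) <;> rw [hin] <;> simp [-inner_self_eq_norm_sq_to_K, ho₁, ho₂]
  · simp only [Fintype.sum_sum_type, hder2, hder]
    refine WithLp.ofLp_injective 2 (Prod.ext ?_ ?_)
    · simpa [gammaProduct, WithLp.ofLp_sum, Prod.fst_sum, ← Finset.smul_sum]
        using smul_add_smul_trace n₁.ne' hE.ne' he₁ ht₁
    · simpa [gammaProduct, WithLp.ofLp_sum, Prod.snd_sum, ← Finset.smul_sum]
        using smul_add_smul_trace n₂.ne' hE.ne' he₂ ht₂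

end ProductGerm

section LocalCriterion

variable {E : Type*} [NormedAddCommGroup E] [NormedSpace ℝ E]
  {H : Type*} [TopologicalSpace H] {I : ModelWithCorners ℝ E H} [I.Boundaryless]
  {M : Type*} [TopologicalSpace M] [ChartedSpace H M]
  {H' : Type*} [TopologicalSpace H'] {I' : ModelWithCorners ℝ E H'} [I'.Boundaryless]
  {M' : Type*} [TopologicalSpace M'] [ChartedSpace H' M']
  {V : Type*} [NormedAddCommGroup V] [InnerProductSpace ℝ V]

lemma contMDiffAt_of_localRep {f : M → V} {x : M}
    (h : ContDiffAt ℝ ∞ (localRep I f x) (extChartAt I x x)) : ContMDiffAt I 𝓘(ℝ, V) ∞ f x := by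
  refine contMDiffAt_iff.2 ⟨?_, ?_⟩
  · have h1 : ContinuousAt (localRep I f x ∘ extChartAt I x) x :=
      h.continuousAt.comp (continuousAt_extChartAt x)
    refine h1.congr ?_
    filter_upwards [extChartAt_source_mem_nhds (I := I) x] with y hy
    simp only [localRep, Function.comp_apply]
    rw [(extChartAt I x).left_inv hy]
  · rw [I.range_eq_univ, contDiffWithinAt_univ]
    exact h

/-- Being a minimal immersion only depends on the local representations at the base points. -/
lemma IsSphericalMinimalImmersion.of_localRep [FiniteDimensional ℝ E] {f : M → V}
    (hf : IsSphericalMinimalImmersion I f) {F : M' → V}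
    (h : ∀ n, ∃ x, localRep I' F n = localRep I f x ∧ extChartAt I' n n = extChartAt I x x) :
    IsSphericalMinimalImmersion I' F := by
  have hF : ContMDiff I' 𝓘(ℝ, V) ∞ F := fun n => by
    obtain ⟨x, h1, h2⟩ := h n
    refine contMDiffAt_of_localRep ?_
    rw [h1, h2]
    exact contDiffAt_localRep hf.1.1 x
  refine ⟨⟨hF, fun n => ?_, fun n => ?_⟩, fun n => ?_⟩
  · obtain ⟨x, h1, h2⟩ := h n
    have h3 := hf.1.2.1 x
    rw [mfderiv_eq_fderiv_localRep hf.1.1 x] at h3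
    rw [mfderiv_eq_fderiv_localRep hF n, h1, h2]
    exact h3
  · obtain ⟨x, h1, h2⟩ := h n
    rw [← localRep_self (I := I') F n, h1, h2, localRep_self]
    exact hf.1.2.2 x
  · obtain ⟨x, h1, h2⟩ := h n
    have h3 : F n = f x := by
      rw [← localRep_self (I := I') F n, h1, h2, localRep_self]
    rw [← hf.2 x]
    unfold meanCurvature secondFundamentalForm inducedMetric radialTangentSpan coordHessian
      coordTangent
    simp only [h1, h2, h3]

end LocalCriterion

section Immersion

variable {E₁ : Type*} [NormedAddCommGroup E₁] [NormedSpace ℝ E₁] [FiniteDimensional ℝ E₁]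
  {H₁ : Type*} [TopologicalSpace H₁] {I₁ : ModelWithCorners ℝ E₁ H₁} [I₁.Boundaryless]
  {M₁ : Type*} [TopologicalSpace M₁] [ChartedSpace H₁ M₁]
  {E₂ : Type*} [NormedAddCommGroup E₂] [NormedSpace ℝ E₂] [FiniteDimensional ℝ E₂]
  {H₂ : Type*} [TopologicalSpace H₂] {I₂ : ModelWithCorners ℝ E₂ H₂} [I₂.Boundaryless]
  {M₂ : Type*} [TopologicalSpace M₂] [ChartedSpace H₂ M₂]
  {V₁ : Type*} [NormedAddCommGroup V₁] [InnerProductSpace ℂ V₁] [InnerProductSpace ℝ V₁]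
  [IsScalarTower ℝ ℂ V₁]
  {V₂ : Type*} [NormedAddCommGroup V₂] [InnerProductSpace ℂ V₂] [InnerProductSpace ℝ V₂]
  [IsScalarTower ℝ ℂ V₂]

/-- The `γ`-product of minimal `𝒞`-totally real immersions, along a profile curve. -/
theorem isSphericalMinimalImmersion_gammaProduct
    (hV₁ : ∀ x y : V₁, inner ℝ x y = (inner ℂ x y).re)
    (hV₂ : ∀ x y : V₂, inner ℝ x y = (inner ℂ x y).re) {γ : ℝ → ℂ × ℂ}
    (hγ : IsMinimalProfile (Module.finrank ℝ E₁) (Module.finrank ℝ E₂)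
      (fun t => (γ t).1) (fun t => (γ t).2))
    {f₁ : M₁ → V₁} {f₂ : M₂ → V₂} (h₁ : IsSphericalMinimalImmersion I₁ f₁)
    (h₂ : IsSphericalMinimalImmersion I₂ f₂)
    (r₁ : ∀ x w, inner ℂ (f₁ x) (mfderiv I₁ 𝓘(ℝ, V₁) f₁ x w : V₁) = 0)
    (r₂ : ∀ x w, inner ℂ (f₂ x) (mfderiv I₂ 𝓘(ℝ, V₂) f₂ x w : V₂) = 0) :
    IsSphericalMinimalImmersion (𝓘(ℝ, ℝ).prod (I₁.prod I₂)) (gammaProduct γ f₁ f₂) := by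
  have hloc : ∀ p : ℝ × M₁ × M₂,
      localRep (𝓘(ℝ, ℝ).prod (I₁.prod I₂)) (gammaProduct γ f₁ f₂) p
        = gammaProduct γ (localRep I₁ f₁ p.2.1) (localRep I₂ f₂ p.2.2) := fun p => rfl
  have hchart : ∀ p : ℝ × M₁ × M₂, extChartAt (𝓘(ℝ, ℝ).prod (I₁.prod I₂)) p p
      = (p.1, extChartAt I₁ p.2.1 p.2.1, extChartAt I₂ p.2.2 p.2.2) := fun p => rfl
  have g₁ := fun x => h₁.isMinimalGerm x
  have g₂ := fun x => h₂.isMinimalGerm x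
  have s₁ : ∀ x w, inner ℂ (localRep I₁ f₁ x (extChartAt I₁ x x))
      (fderiv ℝ (localRep I₁ f₁ x) (extChartAt I₁ x x) w) = 0 := fun x w => by
    have := r₁ x w
    rwa [mfderiv_eq_fderiv_localRep h₁.1.1 x, ← localRep_self (I := I₁) f₁ x] at this
  have s₂ : ∀ x w, inner ℂ (localRep I₂ f₂ x (extChartAt I₂ x x))
      (fderiv ℝ (localRep I₂ f₂ x) (extChartAt I₂ x x) w) = 0 := fun x w => by
    have := r₂ x w
    rwa [mfderiv_eq_fderiv_localRep h₂.1.1 x, ← localRep_self (I := I₂) f₂ x] at this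
  have hG : ContMDiff (𝓘(ℝ, ℝ).prod (I₁.prod I₂)) 𝓘(ℝ, WithLp 2 (V₁ × V₂)) ∞
      (gammaProduct γ f₁ f₂) := fun p => by
    refine contMDiffAt_of_localRep ?_
    rw [hloc, hchart]
    exact contDiffAt_gammaProduct hγ.contDiff₁ hγ.contDiff₂ (g₁ p.2.1).contDiffAt
      (g₂ p.2.2).contDiffAt
  refine ⟨⟨hG, fun p => ?_, fun p => ?_⟩, fun p => ?_⟩
  · rw [mfderiv_eq_fderiv_localRep hG p, hloc, hchart]
    exact injective_fderiv_gammaProduct hV₁ hV₂ hγ (g₁ _) (g₂ _) (s₁ _) (s₂ _) p.1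
  · have := hγ.norm_sq_add p.1
    rw [← sq_eq_sq₀ (norm_nonneg _) zero_le_one, WithLp.prod_norm_sq_eq_of_L2]
    simpa [gammaProduct, norm_smul, h₁.1.2.2, h₂.1.2.2] using this
  · obtain ⟨b, d, hd, ho, a, w, h⟩ := exists_frame_gammaProduct hV₁ hV₂ hγ (g₁ p.2.1) (g₂ p.2.2)
      (s₁ _) (s₂ _) p.1
    refine (meanCurvature_eq_zero_iff b hd ?_).2 ?_
    · rw [hloc, hchart]
      exact ho
    · refine mem_radialTangentSpan.2 ⟨a, w, ?_⟩
      rw [← localRep_self (I := 𝓘(ℝ, ℝ).prod (I₁.prod I₂)) (gammaProduct γ f₁ f₂) p, hloc, hchart]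
      exact h

end Immersion

/-! ### The quotient manifold -/

section Circle

variable {p : ℝ} [hp : Fact (0 < p)]

/-- The real representative of a point of the circle at which its chart is centred. -/
def circleLift (n : AddCircle p) : ℝ := AddCircle.equivIco p 0 n

lemma coe_circleLift (n : AddCircle p) : (circleLift n : AddCircle p) = n :=
  (AddCircle.equivIco p 0).symm_apply_apply n

/-- The charts of the circle are the local inverses of the covering map. -/
instance circleChartedSpace : ChartedSpace ℝ (AddCircle p) where
  atlas := Set.range fun a : ℝ => (AddCircle.openPartialHomeomorphCoe p a).symm
  chartAt n := (AddCircle.openPartialHomeomorphCoe p (circleLift n - p / 2)).symm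
  mem_chart_source n := by
    have h := (AddCircle.openPartialHomeomorphCoe p (circleLift n - p / 2)).map_source
      (x := circleLift n) ⟨by linarith [hp.out], by linarith [hp.out]⟩
    rw [AddCircle.openPartialHomeomorphCoe_apply, coe_circleLift] at h
    exact h
  chart_mem_atlas n := ⟨_, rfl⟩

lemma chartAt_circle_self (n : AddCircle p) : chartAt ℝ n n = circleLift n := by
  have h := (AddCircle.openPartialHomeomorphCoe p (circleLift n - p / 2)).left_inv
    (x := circleLift n) ⟨by linarith [hp.out], by linarith [hp.out]⟩
  rwa [AddCircle.openPartialHomeomorphCoe_apply, coe_circleLift] at h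

/-- Read in a chart of the circle, the covering map is locally a translation. -/
lemma contDiffAt_openPartialHomeomorphCoe_symm {a t : ℝ}
    (ht : (t : AddCircle p) ∈ (AddCircle.openPartialHomeomorphCoe p a).target) :
    ContDiffAt ℝ ∞ (fun s : ℝ => (AddCircle.openPartialHomeomorphCoe p a).symm (s : AddCircle p))
      t := by
  set e := AddCircle.openPartialHomeomorphCoe p a with he
  have h1 : e.symm t ∈ Set.Ioo a (a + p) := e.map_target ht
  have h2 : ((e.symm t : ℝ) : AddCircle p) = t := e.right_inv ht
  obtain ⟨n, hn⟩ := (QuotientAddGroup.eq_iff_sub_mem.1 h2 : e.symm t - t ∈ AddSubgroup.zmultiples p)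
  have hn' : t + n • p = e.symm t := by simp only at hn; rw [hn]; ring
  have h3 : (fun s : ℝ => e.symm (s : AddCircle p)) =ᶠ[nhds t] fun s => s + n • p := by
    have hc : ContinuousAt (fun s : ℝ => s + n • p) t := by fun_prop
    filter_upwards [hc.eventually (isOpen_Ioo.mem_nhds (hn' ▸ h1))] with s hs
    have h4 : e.symm ((s + n • p : ℝ) : AddCircle p) = s + n • p := e.left_inv hs
    rw [← h4]
    congr 1
    rw [AddCircle.coe_add, AddCircle.coe_zsmul, AddCircle.coe_period, smul_zero, add_zero]
  exact (contDiffAt_id.add contDiffAt_const).congr_of_eventuallyEq h3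

instance circle_isManifold : IsManifold 𝓘(ℝ, ℝ) ∞ (AddCircle p) := by
  refine isManifold_of_contDiffOn _ _ _ ?_
  rintro _ _ ⟨a, rfl⟩ ⟨b, rfl⟩ t ht
  exact (contDiffAt_openPartialHomeomorphCoe_symm ht.1.2).contDiffWithinAt

lemma contMDiff_coe_circle : ContMDiff 𝓘(ℝ, ℝ) 𝓘(ℝ, ℝ) ∞ ((↑) : ℝ → AddCircle p) := fun t => by
  refine contMDiffAt_iff.2 ⟨(AddCircle.continuous_mk' p).continuousAt, ?_⟩
  exact (contDiffAt_openPartialHomeomorphCoe_symm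
    (mem_chart_source ℝ (t : AddCircle p))).contDiffWithinAt

end Circle

section Quotient

variable {E₁ : Type} [NormedAddCommGroup E₁] [NormedSpace ℝ E₁] [FiniteDimensional ℝ E₁]
  {M₁ : Type u} [TopologicalSpace M₁] [ChartedSpace E₁ M₁] [IsManifold 𝓘(ℝ, E₁) ∞ M₁]
  [CompactSpace M₁] [T2Space M₁]
  {E₂ : Type} [NormedAddCommGroup E₂] [NormedSpace ℝ E₂] [FiniteDimensional ℝ E₂]
  {M₂ : Type v} [TopologicalSpace M₂] [ChartedSpace E₂ M₂] [IsManifold 𝓘(ℝ, E₂) ∞ M₂]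
  [CompactSpace M₂] [T2Space M₂]
  {V₁ : Type*} [NormedAddCommGroup V₁] [InnerProductSpace ℂ V₁] [InnerProductSpace ℝ V₁]
  {V₂ : Type*} [NormedAddCommGroup V₂] [InnerProductSpace ℂ V₂] [InnerProductSpace ℝ V₂]

/-- A `γ`-product over a periodic curve factors through a product with a circle. -/
theorem factorsThroughClosedMinimal_gammaProduct {γ : ℝ → ℂ × ℂ} {p : ℝ} (hp : 0 < p)
    (hγ : ∀ t, γ (t + p) = γ t) {f₁ : M₁ → V₁} {f₂ : M₂ → V₂}
    (h : IsSphericalMinimalImmersion (𝓘(ℝ, ℝ).prod (𝓘(ℝ, E₁).prod 𝓘(ℝ, E₂)))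
      (gammaProduct γ f₁ f₂)) :
    FactorsThroughClosedMinimal (𝓘(ℝ, ℝ).prod (𝓘(ℝ, E₁).prod 𝓘(ℝ, E₂)))
      (Module.finrank ℝ E₁ + Module.finrank ℝ E₂ + 1) (gammaProduct γ f₁ f₂) := by
  have : Fact (0 < p) := ⟨hp⟩
  have hper : Function.Periodic γ p := hγ
  have hI : 𝓘(ℝ, ℝ × E₁ × E₂) = 𝓘(ℝ, ℝ).prod (𝓘(ℝ, E₁).prod 𝓘(ℝ, E₂)) := by
    rw [modelWithCornersSelf_prod, modelWithCornersSelf_prod]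
  let F : AddCircle p × M₁ × M₂ → WithLp 2 (V₁ × V₂) := fun n =>
    WithLp.toLp 2 ((hper.lift n.1).1 • f₁ n.2.1, (hper.lift n.1).2 • f₂ n.2.2)
  let q : ℝ × M₁ × M₂ → AddCircle p × M₁ × M₂ := Prod.map (↑) id
  have hFq : ∀ x, gammaProduct γ f₁ f₂ x = F (q x) := fun x => rfl
  have hq : ContMDiff (𝓘(ℝ, ℝ).prod (𝓘(ℝ, E₁).prod 𝓘(ℝ, E₂)))
      (𝓘(ℝ, ℝ).prod (𝓘(ℝ, E₁).prod 𝓘(ℝ, E₂))) ∞ q := contMDiff_coe_circle.prodMap contMDiff_id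
  have hF : IsSphericalMinimalImmersion (𝓘(ℝ, ℝ).prod (𝓘(ℝ, E₁).prod 𝓘(ℝ, E₂))) F := by
    refine h.of_localRep fun n => ⟨(circleLift n.1, n.2), rfl, ?_⟩
    exact Prod.ext (chartAt_circle_self n.1) rfl
  refine ⟨ℝ × E₁ × E₂, inferInstance, inferInstance, inferInstance, AddCircle p × M₁ × M₂,
    inferInstance, (inferInstance : ChartedSpace (ModelProd ℝ (ModelProd E₁ E₂)) _), ?_, ?_,
    inferInstance, inferInstance, F, q, ?_, ?_, ?_, hFq⟩
  · simp only [Module.finrank_prod, Module.finrank_self]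
    ring
  · rw [hI]
    exact (inferInstance : IsManifold (𝓘(ℝ, ℝ).prod (𝓘(ℝ, E₁).prod 𝓘(ℝ, E₂))) ∞
      (AddCircle p × M₁ × M₂))
  · rw [hI]
    exact hF
  · rw [hI]
    exact hq
  · exact (QuotientAddGroup.mk_surjective).prodMap Function.surjective_id

end Quotient

/-! ### The unit sphere of `ℂⁿ` -/

section Euclidean

variable {n : ℕ}

lemma real_inner_euclideanSpace (x y : EuclideanSpace ℂ (Fin n)) :
    inner ℝ x y = (inner ℂ x y).re := by
  simp [PiLp.inner_apply, Complex.inner]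

variable {E : Type*} [NormedAddCommGroup E] [NormedSpace ℝ E]
  {H : Type*} [TopologicalSpace H] {I : ModelWithCorners ℝ E H} [I.Boundaryless]
  {M : Type*} [TopologicalSpace M] [ChartedSpace H M]

lemma IsCTotallyReal.inner_mfderiv_eq_zero {f : M → EuclideanSpace ℂ (Fin n)}
    (hf : IsSphericalImmersion I f) (h : IsCTotallyReal I f) (x : M) (w : TangentSpace I x) :
    inner ℂ (f x) (mfderiv I 𝓘(ℝ, EuclideanSpace ℂ (Fin n)) f x w : EuclideanSpace ℂ (Fin n))
      = 0 := by
  have h1 := h x w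
  have h2 : inner ℝ (f x) (mfderiv I 𝓘(ℝ, EuclideanSpace ℂ (Fin n)) f x w :
      EuclideanSpace ℂ (Fin n)) = 0 := by
    have h3 := inner_fderiv_eq_zero (fun e => norm_localRep (I := I) hf.2.2 x e)
      ((contDiffAt_localRep hf.1 x).differentiableAt (by simp)) w
    rw [localRep_self] at h3
    rw [mfderiv_eq_fderiv_localRep hf.1 x]
    exact h3
  refine Complex.ext ((real_inner_euclideanSpace _ _).symm.trans h2) ?_
  have h4 := (congrArg Complex.re (inner_smul_left (𝕜 := ℂ) (f x)
    (mfderiv I 𝓘(ℝ, EuclideanSpace ℂ (Fin n)) f x w : EuclideanSpace ℂ (Fin n))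
    Complex.I)).symm.trans h1
  simpa using h4

end Euclidean

end

end SpiralProduct

theorem mainTheorem2 (k₁ k₂ : ℕ) (hk : 1 ≤ k₁ + k₂) :
    -- the integrals converge
    (∀ C C' : ℝ, C ≠ 0 → (SpiralProduct.basicDomain k₁ k₂ C C').Nonempty →
      IntegrableOn (SpiralProduct.integrand₁ k₁ k₂ C C') (SpiralProduct.basicDomain k₁ k₂ C C') ∧
      IntegrableOn (SpiralProduct.integrand₂ k₁ k₂ C C') (SpiralProduct.basicDomain k₁ k₂ C C')) ∧
    -- the number of pairs
    Cardinal.mk (ℚ × ℚ) ≤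
      Cardinal.mk {p : ℝ × ℝ | 0 < p.1 ∧ SpiralProduct.IsClosingPair k₁ k₂ p.1 p.2} ∧
    -- every pair closes up
    ∀ (m₁ m₂ : ℕ)
      (M₁ : Type u) [TopologicalSpace M₁] [ChartedSpace (EuclideanSpace ℝ (Fin k₁)) M₁]
      [IsManifold (𝓡 k₁) ∞ M₁] [CompactSpace M₁] [T2Space M₁]
      (M₂ : Type v) [TopologicalSpace M₂] [ChartedSpace (EuclideanSpace ℝ (Fin k₂)) M₂]
      [IsManifold (𝓡 k₂) ∞ M₂] [CompactSpace M₂] [T2Space M₂]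
      (f₁ : M₁ → EuclideanSpace ℂ (Fin (m₁ + 1))) (f₂ : M₂ → EuclideanSpace ℂ (Fin (m₂ + 1))),
      SpiralProduct.IsSphericalMinimalImmersion (𝓡 k₁) f₁ →
      SpiralProduct.IsCTotallyReal (𝓡 k₁) f₁ →
      SpiralProduct.IsSphericalMinimalImmersion (𝓡 k₂) f₂ →
      SpiralProduct.IsCTotallyReal (𝓡 k₂) f₂ →
      ∀ C C' : ℝ, C ≠ 0 → SpiralProduct.IsClosingPair k₁ k₂ C C' →
        ∃ γ : ℝ → ℂ × ℂ,
          SpiralProduct.IsImmersedCurve γ ∧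
          SpiralProduct.IsSolutionCurve k₁ k₂ C C' γ ∧
          SpiralProduct.IsDoublySpiral γ ∧
          ¬ SpiralProduct.HasSteadyMagnitudes γ ∧
          SpiralProduct.IsSphericalMinimalImmersion (𝓘(ℝ, ℝ).prod ((𝓡 k₁).prod (𝓡 k₂)))
            (SpiralProduct.gammaProduct γ f₁ f₂) ∧
          SpiralProduct.FactorsThroughClosedMinimal (𝓘(ℝ, ℝ).prod ((𝓡 k₁).prod (𝓡 k₂)))
            (k₁ + k₂ + 1) (SpiralProduct.gammaProduct γ f₁ f₂) := by
  refine ⟨fun C C' hC h => ?_, SpiralProduct.card_closingPairs hk, ?_⟩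
  · obtain ⟨x, y, hr⟩ := SpiralProduct.exists_isRootPair_of_nonempty hC h
    exact ⟨(hr.integral₁ rfl).1, (hr.integral₂ rfl).1⟩
  intro m₁ m₂ M₁ _ _ _ _ _ M₂ _ _ _ _ _ f₁ f₂ h₁ r₁ h₂ r₂ C C' hC hcl
  obtain ⟨x, y, hr⟩ := SpiralProduct.exists_isRootPair_of_nonempty hC hcl.1
  have hT : 0 < C' := by
    have hmem : (x + y) / 2 ∈ Set.Ioo x y :=
      ⟨by linarith [hr.lt], by linarith [hr.lt]⟩
    have hu : (x + y) / 2 ∈ Set.Ioo (0 : ℝ) 1 :=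
      ⟨by linarith [hr.left_pos, hmem.1], by linarith [hr.right_lt, hmem.2]⟩
    exact SpiralProduct.pos_of_polyRadicand_pos (sq_nonneg C) hu ((hr.pos_iff _ hu).2 hmem)
  have hprof := hr.isMinimalProfile rfl hT
  obtain ⟨p, hp, hper⟩ := hr.exists_period rfl hcl.2.1 hcl.2.2
  have hmin : SpiralProduct.IsSphericalMinimalImmersion (𝓘(ℝ, ℝ).prod ((𝓡 k₁).prod (𝓡 k₂)))
      (SpiralProduct.gammaProduct (SpiralProduct.spiral k₁ k₂ C C' x y) f₁ f₂) := by
    refine SpiralProduct.isSphericalMinimalImmersion_gammaProduct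
      SpiralProduct.real_inner_euclideanSpace SpiralProduct.real_inner_euclideanSpace ?_ h₁ h₂
      (r₁.inner_mfderiv_eq_zero h₁.1) (r₂.inner_mfderiv_eq_zero h₂.1)
    rw [finrank_euclideanSpace_fin, finrank_euclideanSpace_fin]
    exact hprof
  refine ⟨SpiralProduct.spiral k₁ k₂ C C' x y, hprof.isImmersedCurve, hr.isSolutionCurve rfl,
    hr.isDoublySpiral hC, hr.not_hasSteadyMagnitudes C, hmin, ?_⟩
  have hfac := SpiralProduct.factorsThroughClosedMinimal_gammaProduct hp hper hmin
  rwa [finrank_euclideanSpace_fin, finrank_euclideanSpace_fin] at hfac
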